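/- Let $E$ be a Euclidean space of finite dimension $n\ge 1$, let $\mathrm{Sim}\,E$ be the group of its similarity transformations, and let $A\cong\mathbb R^+$ be the group of dilations $x\mapsto ax$, $a>0$. Subgroups and homomorphisms are meant in the sense of Lie groups: a connected subgroup is a connected, not necessarily closed Lie subgroup $G$, i.e. it is generated by $\exp\mathfrak g$, where its Lie algebra $\mathfrak g=\{X:\exp(tX)\in G\ \forall t\in\mathbb R\}$; homomorphisms are continuous. A linear subspace $W\subseteq E$ is also regarded as the group of translations by its vectors, and $SO(W)\subseteq SO(E)$ as the group of rotations that fix $W^\perp$ pointwise. Let $V=\mathbb Rp\oplus E\oplus\mathbb Rq$ be the Minkowski space with the form $\eta$ for which $p,q$ are isotropic, $\eta(p,q)=1$, $E\perp p,q$, and $\eta|_E$ is the Euclidean inner product. Let $SO(V)_{\mathbb Rp}$ be the group of linear automorphisms of $V$ of determinant $1$ that preserve $\eta$, the line $\mathbb Rp$ and the sheet $L=\{v:\eta(v,v)=-1,\ v_0>0\}$, where $v_0$ is the coordinate along $(p-q)/\sqrt2$; let $\mathfrak{so}(V)_{\mathbb Rp}$ be the Lie algebra of the $\eta$-skew endomorphisms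 preserving $\mathbb Rp$. Its elements are the triples $(a,A,X)$, $a\in\mathbb R$, $A\in\mathfrak{so}(E)$, $X\in E$, acting by $p\mapsto ap$, $Y\mapsto -\langle X,Y\rangle p+AY$ for $Y\in E$, $q\mapsto X-aq$. Put $\mathcal A=\{(a,0,0)\}$, $\mathcal N_W=\{(0,0,X):X\in W\}$ for $W\subseteq E$, $\mathcal N=\mathcal N_E$. Identifying $Y\in E$ with the isotropic line spanned by $-\tfrac12|Y|^2p+Y+q$, one identifies $E$ with the set of isotropic lines different from $\mathbb Rp$, so that $SO(V)_{\mathbb Rp}$ acts on $E$ by similarity transformations. Let $G\subseteq\mathrm{Sim}\,E$ be a connected subgroup. Then every element of $G$ is induced by exactly one element of $SO(V)_{\mathbb Rp}$; the elements so obtained form a connected Lie subgroup of $SO(V)_{\mathbb Rp}$ with a Lie algebra $\mathfrak g\subseteq\mathfrak{so}(V)_{\mathbb Rp}$. The group $G$ acts transitively on $E$ if and only if $\mathfrak g$ is weakly irreducible (it preserves no proper nonzero subspace of $V$ on which $\eta$ is nondegenerate) and not irreducible. If $G$ acts transitively, then it belongs to exactly one of the following types, where $H\subseteq SO(E)$ denotes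 a connected Lie subgroup and the products are internal direct and semidirect products: 1. $G=(A\times H)\ltimes E$; 2. $G=H\ltimes E$; 3. $G=(A^\Phi\times H)\ltimes E$, where $\Phi:A\to SO(E)$ is a homomorphism with $\Phi(A)\not\subseteq H$ and $A^\Phi=\{\Phi(a)\cdot a:a\in A\}$ is a group of screw dilations; 4. $G=(H\times U^\Psi)\ltimes W$, where $E=U\oplus W$ is an orthogonal decomposition, $\Psi:U\to SO(W)$ is a homomorphism with $\Psi(U)\not\subseteq H$, and $U^\Psi=\{\Psi(u)\cdot u:u\in U\}$ is a group of screw isometries. Moreover, for each $i=1,2,3,4$, $G$ is of type $i$ if and only if $\mathfrak g$ is of the $i$-th of the following Bérard Bergery–Ikemakhen types, where $\mathcal B\subseteq\mathfrak{so}(E)$ is a subalgebra with commutant $\mathcal B'$ and centre $\mathfrak z(\mathcal B)$: 1. $\mathfrak g=(\mathcal A\oplus\mathcal B)\ltimes\mathcal N$; 2. $\mathfrak g=\mathcal B\ltimes\mathcal N$; 3. $\mathfrak g=(\mathcal B'\oplus\{\varphi(Z)+Z:Z\in\mathfrak z(\mathcal B)\})\ltimes\mathcal N$, where $\varphi:\mathfrak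 z(\mathcal B)\to\mathcal A$ is a nonzero linear map; 4. $\mathfrak g=(\mathcal B'\oplus\{\psi(Z)+Z:Z\in\mathfrak z(\mathcal B)\})\ltimes\mathcal N_W$, where $E=U\oplus W$ is an orthogonal decomposition with $U,W\neq0$, $\mathcal B\subseteq\mathfrak{so}(W)$, and $\psi:\mathfrak z(\mathcal B)\to\mathcal N_U$ is a surjective linear map. -/

import Mathlib

/- Associative algebras are Lie algebras with the commutator bracket. -/
attribute [local instance] LieRing.ofAssociativeRing LieAlgebra.ofAssociativeAlgebra

/-! ### Linear Lie groups -/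

section LinearLie

variable {F : Type*} [NormedAddCommGroup F] [NormedSpace ℝ F]

/-- The tangent vectors at the identity of the one-parameter subgroups contained in `G`. -/
def lieSet (G : Subgroup (F →L[ℝ] F)ˣ) : Set (F →L[ℝ] F) :=
  {X | ∀ t : ℝ, ∃ g ∈ G, (g : F →L[ℝ] F) = NormedSpace.exp (t • X)}

/-- `G` is a connected (not necessarily closed) Lie subgroup of the general linear group of `F`, and
`𝔤` is its Lie algebra: `𝔤` consists of all `X` with `exp (tX) ∈ G` for all `t`, and the group `G` is
generated by `exp 𝔤`. -/
structure IsConnectedLieSubgroupWith (G : Subgroup (F →L[ℝ] F)ˣ)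
    (𝔤 : LieSubalgebra ℝ (F →L[ℝ] F)) : Prop where
  lie_eq : (𝔤 : Set (F →L[ℝ] F)) = lieSet G
  generates : G = Subgroup.closure
    {g : (F →L[ℝ] F)ˣ | ∃ X ∈ 𝔤, (g : F →L[ℝ] F) = NormedSpace.exp X}

end LinearLie

/-! ### Internal direct and semidirect products of subgroups -/

section Products

variable {S : Type*} [Group S]

/-- `G = K × L`. -/
def IsInternalDirect (K L G : Subgroup S) : Prop :=
  (∀ k ∈ K, ∀ l ∈ L, k * l = l * k) ∧ K ⊓ L = ⊥ ∧ K ⊔ L = G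

/-- `G = K ⋉ N`, with `N` normal in `G`. -/
def IsInternalSemidirect (K N G : Subgroup S) : Prop :=
  (∀ g ∈ G, ∀ x ∈ N, g * x * g⁻¹ ∈ N) ∧ K ⊓ N = ⊥ ∧ K ⊔ N = G

end Products

noncomputable section

/-! ### The similarity group of a Euclidean space -/

section Similarity

variable (E : Type*) [NormedAddCommGroup E] [InnerProductSpace ℝ E]

/-- The group of similarity transformations of `E`. -/
abbrev Sim : Type _ := E ≃ᵈ E

variable {E}

/-- The group `G` of similarity transformations written in homogeneous coordinates: the linear
automorphisms of `E × ℝ` that restrict to elements of `G` on the affine hyperplane `E × {1}`. -/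
def homogeneous (G : Subgroup (Sim E)) : Subgroup ((E × ℝ) →L[ℝ] (E × ℝ))ˣ where
  carrier := {M | ∃ f ∈ G, ∀ x : E, (M : (E × ℝ) →L[ℝ] (E × ℝ)) (x, 1) = (f x, 1)}
  one_mem' := ⟨1, G.one_mem, fun x => rfl⟩
  mul_mem' := by
    rintro M N ⟨f, hf, h⟩ ⟨g, hg, k⟩
    refine ⟨f * g, G.mul_mem hf hg, fun x => ?_⟩
    simp [k, h]
  inv_mem' := by
    rintro M ⟨f, hf, h⟩
    refine ⟨f⁻¹, G.inv_mem hf, fun x => ?_⟩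
    have h1 := h (f⁻¹ x)
    have h2 : f (f⁻¹ x) = x := f.apply_symm_apply x
    rw [h2] at h1
    rw [← h1, ← mul_apply_eq_comp]
    simp

/-- A connected Lie subgroup of `Sim E`. -/
def IsConnectedSimSubgroup (G : Subgroup (Sim E)) : Prop :=
  ∃ 𝔤 : LieSubalgebra ℝ ((E × ℝ) →L[ℝ] (E × ℝ)), IsConnectedLieSubgroupWith (homogeneous G) 𝔤

/-- `G` acts transitively on `E`. -/
def ActsTransitively (G : Subgroup (Sim E)) : Prop :=
  ∀ x y : E, ∃ g ∈ G, g x = y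

/-- `SO(W)`, as the group of the rotations of `E` that fix the orthogonal complement of `W`
pointwise. In particular `rotations ⊤` is `SO(E)`. -/
def rotations (W : Submodule ℝ E) : Subgroup (E ≃ₗᵢ[ℝ] E) where
  carrier := {f | LinearMap.det (f.toLinearEquiv : E →ₗ[ℝ] E) = 1 ∧ ∀ x ∈ Wᗮ, f x = x}
  one_mem' := ⟨LinearMap.det_id, fun x _ => rfl⟩
  mul_mem' := by
    rintro f g ⟨hf, hf'⟩ ⟨hg, hg'⟩
    refine ⟨?_, fun x hx => by simp [hg' x hx, hf' x hx]⟩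
    have : ((f * g).toLinearEquiv : E →ₗ[ℝ] E)
        = (f.toLinearEquiv : E →ₗ[ℝ] E) ∘ₗ (g.toLinearEquiv : E →ₗ[ℝ] E) := rfl
    rw [this, LinearMap.det_comp, hf, hg, one_mul]
  inv_mem' := by
    rintro f ⟨hf, hf'⟩
    refine ⟨?_, fun x hx => ?_⟩
    · have := LinearEquiv.det_symm_mul_det f.toLinearEquiv
      rw [hf, mul_one] at this
      exact this
    · conv_lhs => rw [← hf' x hx]
      exact f.symm_apply_apply x

/-- `SO(E)` as a subgroup of `Sim E`. -/
def linearRotations (E : Type*) [NormedAddCommGroup E] [InnerProductSpace ℝ E] :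
    Subgroup (Sim E) where
  carrier := {g | ∃ f ∈ rotations (⊤ : Submodule ℝ E), ∀ x, g x = f x}
  one_mem' := ⟨1, Subgroup.one_mem _, fun _ => rfl⟩
  mul_mem' := by
    rintro g g' ⟨f, hf, h⟩ ⟨f', hf', h'⟩
    exact ⟨f * f', Subgroup.mul_mem _ hf hf', fun x => by simp [h, h']⟩
  inv_mem' := by
    rintro g ⟨f, hf, h⟩
    refine ⟨f⁻¹, Subgroup.inv_mem _ hf, fun x => ?_⟩
    apply g.injective
    rw [h (f⁻¹ x)]
    exact (g.apply_symm_apply x).trans (f.apply_symm_apply x).symm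

/-- The group of the translations of `E` by the vectors of `W`. -/
def translations (W : Submodule ℝ E) : Subgroup (Sim E) where
  carrier := {g | ∃ w ∈ W, ∀ x, g x = x + w}
  one_mem' := ⟨0, W.zero_mem, fun x => by simp⟩
  mul_mem' := by
    rintro g g' ⟨w, hw, h⟩ ⟨w', hw', h'⟩
    exact ⟨w' + w, W.add_mem hw' hw, fun x => by simp [h, h', add_assoc]⟩
  inv_mem' := by
    rintro g ⟨w, hw, h⟩
    refine ⟨-w, W.neg_mem hw, fun x => ?_⟩
    apply g.injective
    rw [h (x + -w)]
    exact (g.apply_symm_apply x).trans (by simp)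

/-- `A^Φ = {Φ(a) ∘ a : a ∈ A}`, where `A = ℝ⁺` is the group of dilations about the origin with
positive ratio. -/
def screwDilations (Φ : {a : ℝ // 0 < a} →* rotations (⊤ : Submodule ℝ E)) :
    Subgroup (Sim E) where
  carrier := {g | ∃ a : {a : ℝ // 0 < a}, ∀ x, g x = (Φ a : E ≃ₗᵢ[ℝ] E) ((a : ℝ) • x)}
  one_mem' := ⟨1, fun x => by simp⟩
  mul_mem' := by
    rintro g g' ⟨a, h⟩ ⟨a', h'⟩
    refine ⟨a * a', fun x => ?_⟩
    simp [h, h', mul_smul]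
  inv_mem' := by
    rintro g ⟨a, h⟩
    refine ⟨a⁻¹, fun x => ?_⟩
    apply g.injective
    refine Eq.trans ?_ (h _).symm
    refine (g.apply_symm_apply x).trans ?_
    have ha : (a : ℝ) ≠ 0 := a.2.ne'
    have : (Φ a : E ≃ₗᵢ[ℝ] E) ((Φ a⁻¹ : E ≃ₗᵢ[ℝ] E) x) = x := by
      rw [map_inv]
      exact (Φ a : E ≃ₗᵢ[ℝ] E).apply_symm_apply x
    simp only [map_smul, this, smul_smul]
    simp [ha]

/-- The group `A = ℝ⁺` of the dilations of `E` about the origin with positive ratio. -/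
def dilations (E : Type*) [NormedAddCommGroup E] [InnerProductSpace ℝ E] : Subgroup (Sim E) :=
  screwDilations (E := E) 1

/-- `U^Ψ = {Ψ(u) ∘ u : u ∈ U}`, where `u` acts as a translation and `Ψ : U → SO(W)`, `W = Uᗮ`. -/
def screwIsometries (U : Submodule ℝ E) (Ψ : Multiplicative U →* rotations Uᗮ) :
    Subgroup (Sim E) where
  carrier := {g | ∃ u : U, ∀ x, g x = (Ψ (Multiplicative.ofAdd u) : E ≃ₗᵢ[ℝ] E) (x + u)}
  one_mem' := ⟨0, fun x => by simp⟩
  mul_mem' := by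
    rintro g g' ⟨u, h⟩ ⟨u', h'⟩
    refine ⟨u + u', fun x => ?_⟩
    have fix : (Ψ (Multiplicative.ofAdd u') : E ≃ₗᵢ[ℝ] E) u = u :=
      (Ψ (Multiplicative.ofAdd u')).2.2 u (Submodule.le_orthogonal_orthogonal U u.2)
    simp [h, h', ofAdd_add, fix]
    abel
  inv_mem' := by
    rintro g ⟨u, h⟩
    refine ⟨-u, fun x => ?_⟩
    apply g.injective
    refine Eq.trans ?_ (h _).symm
    refine (g.apply_symm_apply x).trans ?_
    have fix : (Ψ (Multiplicative.ofAdd u) : E ≃ₗᵢ[ℝ] E) u = u :=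
      (Ψ (Multiplicative.ofAdd u)).2.2 u (Submodule.le_orthogonal_orthogonal U u.2)
    have inv : ∀ y, (Ψ (Multiplicative.ofAdd u) : E ≃ₗᵢ[ℝ] E)
        ((Ψ (Multiplicative.ofAdd (-u)) : E ≃ₗᵢ[ℝ] E) y) = y := by
      intro y
      rw [ofAdd_neg, map_inv]
      exact (Ψ (Multiplicative.ofAdd u) : E ≃ₗᵢ[ℝ] E).apply_symm_apply y
    rw [map_add, inv, fix]
    simp

/-- Labels of the four types. -/
inductive FourTypes
  | type1
  | type2
  | type3
  | type4

/-- The four types of groups of similarity transformations. In all of them `H` is a connected Lie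
subgroup of `SO(E)`, and homomorphisms of Lie groups are continuous. The last condition in types 3
and 4 says that the screw parts of the motions are not all contained in `H`; if they were, then `G`
would be of type 1 or 2. -/
def SimType (G : Subgroup (Sim E)) : FourTypes → Prop
  -- `G = (A × H) ⋉ E`
  | .type1 => ∃ H K : Subgroup (Sim E), H ≤ linearRotations E ∧ IsConnectedSimSubgroup H ∧
      IsInternalDirect (dilations E) H K ∧ IsInternalSemidirect K (translations ⊤) G
  -- `G = H ⋉ E`
  | .type2 => ∃ H : Subgroup (Sim E), H ≤ linearRotations E ∧ IsConnectedSimSubgroup H ∧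
      IsInternalSemidirect H (translations ⊤) G
  -- `G = (A^Φ × H) ⋉ E`
  | .type3 => ∃ (H K : Subgroup (Sim E))
      (Φ : {a : ℝ // 0 < a} →* rotations (⊤ : Submodule ℝ E)),
      H ≤ linearRotations E ∧ IsConnectedSimSubgroup H ∧
      (∀ x : E, Continuous fun a => (Φ a : E ≃ₗᵢ[ℝ] E) x) ∧
      IsInternalDirect (screwDilations Φ) H K ∧ IsInternalSemidirect K (translations ⊤) G ∧
      ∃ a, ¬ ∃ h ∈ H, ∀ x, h x = (Φ a : E ≃ₗᵢ[ℝ] E) x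
  -- `G = (H × U^Ψ) ⋉ W`, `E = U ⊕ W`
  | .type4 => ∃ (H K : Subgroup (Sim E)) (U : Submodule ℝ E)
      (Ψ : Multiplicative U →* rotations Uᗮ),
      H ≤ linearRotations E ∧ IsConnectedSimSubgroup H ∧
      (∀ x : E, Continuous fun u : U => (Ψ (Multiplicative.ofAdd u) : E ≃ₗᵢ[ℝ] E) x) ∧
      IsInternalDirect H (screwIsometries U Ψ) K ∧ IsInternalSemidirect K (translations Uᗮ) G ∧
      ∃ u, ¬ ∃ h ∈ H, ∀ x, h x = (Ψ u : E ≃ₗᵢ[ℝ] E) x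

end Similarity

/-! ### Minkowski space -/

section Minkowski

variable (E : Type*) [NormedAddCommGroup E] [InnerProductSpace ℝ E]

/-- The Minkowski space `V = ℝp ⊕ E ⊕ ℝq`; the triple `(x, Y, z)` stands for `x p + Y + z q`. -/
abbrev Mink : Type _ := ℝ × E × ℝ

variable {E}

/-- The Lorentzian form on `V`: `p`, `q` are isotropic, `η(p, q) = 1`, and `E` is orthogonal to `p`
and `q` and carries its Euclidean inner product. -/
def eta : LinearMap.BilinForm ℝ (Mink E) :=
  LinearMap.mk₂ ℝ (fun v w => v.1 * w.2.2 + inner ℝ v.2.1 w.2.1 + v.2.2 * w.1)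
    (by intro v v' w; simp [inner_add_left]; ring)
    (by intro c v w; simp [real_inner_smul_left]; ring)
    (by intro v w w'; simp [inner_add_right]; ring)
    (by intro c v w; simp [real_inner_smul_right]; ring)

/-- The isotropic vector `p`. -/
def vecP : Mink E := (1, 0, 0)

/-- The vector model `{v : η(v, v) = -1, v₀ > 0}` of Lobachevskian space, where `v₀` is the
coordinate of `v` along `e₀ = (p - q) / √2`. -/
def lobachevsky (E : Type*) [NormedAddCommGroup E] [InnerProductSpace ℝ E] : Set (Mink E) :=
  {v | eta v v = -1 ∧ 0 < (v.1 - v.2.2) / √2}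

/-- The group `SO(V)_{ℝp}`: the linear automorphisms of `V` of determinant one that preserve `η`,
the Lobachevskian space and the line `ℝp`. -/
def specialOrthogonalP (E : Type*) [NormedAddCommGroup E] [InnerProductSpace ℝ E] :
    Subgroup (Mink E →L[ℝ] Mink E)ˣ where
  carrier := {M | (M : Mink E →L[ℝ] Mink E).det = 1 ∧
    (∀ v w, eta ((M : Mink E →L[ℝ] Mink E) v) ((M : Mink E →L[ℝ] Mink E) w) = eta v w) ∧
    (∀ v, (M : Mink E →L[ℝ] Mink E) v ∈ lobachevsky E ↔ v ∈ lobachevsky E) ∧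
    (∀ v, (M : Mink E →L[ℝ] Mink E) v ∈ Submodule.span ℝ {vecP (E := E)} ↔
      v ∈ Submodule.span ℝ {vecP (E := E)})}
  one_mem' := ⟨LinearMap.det_id, fun _ _ => rfl, fun _ => Iff.rfl, fun _ => Iff.rfl⟩
  mul_mem' := by
    rintro M N ⟨h1, h2, h3, h4⟩ ⟨k1, k2, k3, k4⟩
    refine ⟨?_, fun v w => ?_, fun v => ?_, fun v => ?_⟩
    · have : (((M * N : (Mink E →L[ℝ] Mink E)ˣ) : Mink E →L[ℝ] Mink E)).det
          = (M : Mink E →L[ℝ] Mink E).det * (N : Mink E →L[ℝ] Mink E).det :=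
        LinearMap.det_comp _ _
      rw [this, h1, k1, one_mul]
    · simp [h2, k2]
    · simp [h3, k3]
    · simp [h4, k4]
  inv_mem' := by
    rintro M ⟨h1, h2, h3, h4⟩
    have inv : ∀ v, (M : Mink E →L[ℝ] Mink E)
        (((M⁻¹ : (Mink E →L[ℝ] Mink E)ˣ) : Mink E →L[ℝ] Mink E) v) = v := by
      intro v
      rw [← mul_apply_eq_comp]
      simp
    refine ⟨?_, fun v w => ?_, fun v => ?_, fun v => ?_⟩
    · have : ((M * M⁻¹ : (Mink E →L[ℝ] Mink E)ˣ) : Mink E →L[ℝ] Mink E).det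
          = (M : Mink E →L[ℝ] Mink E).det *
            ((M⁻¹ : (Mink E →L[ℝ] Mink E)ˣ) : Mink E →L[ℝ] Mink E).det :=
        LinearMap.det_comp _ _
      rw [h1, one_mul, mul_inv_cancel] at this
      rw [← this]
      exact LinearMap.det_id
    · rw [← h2, inv, inv]
    · rw [← h3, inv]
    · rw [← h4, inv]

/-- The identification of `E` with the set of the isotropic lines of `V` other than `ℝp`. -/
def isotropicLine (Y : E) : Submodule ℝ (Mink E) :=
  Submodule.span ℝ {((-(1 / 2) * ‖Y‖ ^ 2, Y, 1) : Mink E)}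

/-- The automorphism `M` of `V` acts on the isotropic lines other than `ℝp` as `f` acts on `E`. -/
def Induces (M : (Mink E →L[ℝ] Mink E)ˣ) (f : Sim E) : Prop :=
  ∀ Y : E, (isotropicLine Y).map ((M : Mink E →L[ℝ] Mink E) : Mink E →ₗ[ℝ] Mink E)
    = isotropicLine (f Y)

/-- The subgroup of `SO(V)_{ℝp}` that corresponds to the subgroup `G` of `Sim E`. -/
def lorentzGroup (G : Subgroup (Sim E)) : Subgroup (Mink E →L[ℝ] Mink E)ˣ where
  carrier := {M | M ∈ specialOrthogonalP E ∧ ∃ f ∈ G, Induces M f}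
  one_mem' := ⟨Subgroup.one_mem _, 1, G.one_mem, fun Y => Submodule.map_id _⟩
  mul_mem' := by
    rintro M N ⟨hM, f, hf, h⟩ ⟨hN, g, hg, k⟩
    refine ⟨Subgroup.mul_mem _ hM hN, f * g, G.mul_mem hf hg, fun Y => ?_⟩
    have := h (g Y)
    rw [← k, ← Submodule.map_comp] at this
    exact this
  inv_mem' := by
    rintro M ⟨hM, f, hf, h⟩
    refine ⟨Subgroup.inv_mem _ hM, f⁻¹, G.inv_mem hf, fun Y => ?_⟩
    have h1 := h (f⁻¹ Y)
    have h2 : f (f⁻¹ Y) = Y := f.apply_symm_apply Y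
    rw [h2] at h1
    rw [← h1, ← Submodule.map_comp]
    have : (((M⁻¹ : (Mink E →L[ℝ] Mink E)ˣ) : Mink E →L[ℝ] Mink E) : Mink E →ₗ[ℝ] Mink E) ∘ₗ
        ((M : Mink E →L[ℝ] Mink E) : Mink E →ₗ[ℝ] Mink E) = LinearMap.id := by
      ext1 <;> ext <;> simp [← mul_apply_eq_comp]
    rw [this, Submodule.map_id]

/-! ### Subalgebras of `𝔰𝔬(V)_{ℝp}` -/

/-- `𝔤 ⊆ 𝔰𝔬(V)_{ℝp}`: the elements of `𝔤` are `η`-skew and preserve the line `ℝp`. -/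
def IsSubalgebraOfSOP (𝔤 : LieSubalgebra ℝ (Mink E →L[ℝ] Mink E)) : Prop :=
  ∀ T ∈ 𝔤, (∀ v w, eta (T v) w = -eta v (T w)) ∧ T vecP ∈ Submodule.span ℝ {vecP (E := E)}

/-- `𝔤` preserves the subspace `F` of `V`. -/
def Preserves (𝔤 : LieSubalgebra ℝ (Mink E →L[ℝ] Mink E)) (F : Submodule ℝ (Mink E)) : Prop :=
  ∀ T ∈ 𝔤, ∀ v ∈ F, T v ∈ F

/-- `𝔤` preserves no proper subspace. -/
def IsIrreducibleAlg (𝔤 : LieSubalgebra ℝ (Mink E →L[ℝ] Mink E)) : Prop :=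
  ∀ F : Submodule ℝ (Mink E), Preserves 𝔤 F → F = ⊥ ∨ F = ⊤

/-- `𝔤` preserves no nondegenerate proper subspace. -/
def IsWeaklyIrreducibleAlg (𝔤 : LieSubalgebra ℝ (Mink E →L[ℝ] Mink E)) : Prop :=
  ∀ F : Submodule ℝ (Mink E), Preserves 𝔤 F → (eta.restrict F).Nondegenerate → F = ⊥ ∨ F = ⊤

/-- The element `(a, A, X)` of `𝔰𝔬(V)_{ℝp}`: the endomorphism of `V = ℝp ⊕ E ⊕ ℝq` with block matrix
`(a, -Xᵗ, 0; 0, A, X; 0, 0, -a)`. -/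
def triple (a : ℝ) (A : E →L[ℝ] E) (X : E) : Mink E →L[ℝ] Mink E :=
  (a • ContinuousLinearMap.fst ℝ ℝ (E × ℝ)
      - innerSL ℝ X ∘L ContinuousLinearMap.fst ℝ E ℝ ∘L ContinuousLinearMap.snd ℝ ℝ (E × ℝ)).prod
    ((A ∘L ContinuousLinearMap.fst ℝ E ℝ ∘L ContinuousLinearMap.snd ℝ ℝ (E × ℝ)
      + (ContinuousLinearMap.snd ℝ E ℝ ∘L
          ContinuousLinearMap.snd ℝ ℝ (E × ℝ)).smulRight X).prod
      (-(a • (ContinuousLinearMap.snd ℝ E ℝ ∘L ContinuousLinearMap.snd ℝ ℝ (E × ℝ)))))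

theorem triple_apply (a : ℝ) (A : E →L[ℝ] E) (X : E) (x : ℝ) (Y : E) (z : ℝ) :
    triple a A X (x, Y, z) = (a * x - inner ℝ X Y, A Y + z • X, -(a * z)) := by
  simp [triple]

/-- `ℬ ⊆ 𝔰𝔬(W)`: the elements of `ℬ` are skew-symmetric and vanish on the orthogonal complement of
`W`. -/
def IsSkewOn (W : Submodule ℝ E) (ℬ : LieSubalgebra ℝ (E →L[ℝ] E)) : Prop :=
  ∀ A ∈ ℬ, (∀ Y Z : E, inner ℝ (A Y) Z = -inner ℝ Y (A Z)) ∧ ∀ Y ∈ Wᗮ, A Y = 0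

/-- The commutant `ℬ'`. -/
abbrev commutant (ℬ : LieSubalgebra ℝ (E →L[ℝ] E)) : LieIdeal ℝ ℬ :=
  ⁅(⊤ : LieIdeal ℝ ℬ), (⊤ : LieIdeal ℝ ℬ)⁆

/-- The four Bérard Bergery–Ikemakhen types of subalgebras of `𝔰𝔬(V)_{ℝp}`. -/
def AlgType (𝔤 : LieSubalgebra ℝ (Mink E →L[ℝ] Mink E)) : FourTypes → Prop
  -- `𝔤 = (𝒜 ⊕ ℬ) ⋉ 𝒩`
  | .type1 => ∃ ℬ : LieSubalgebra ℝ (E →L[ℝ] E), IsSkewOn ⊤ ℬ ∧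
      ∀ T, T ∈ 𝔤 ↔ ∃ (a : ℝ) (A : ℬ) (X : E), T = triple a A X
  -- `𝔤 = ℬ ⋉ 𝒩`
  | .type2 => ∃ ℬ : LieSubalgebra ℝ (E →L[ℝ] E), IsSkewOn ⊤ ℬ ∧
      ∀ T, T ∈ 𝔤 ↔ ∃ (A : ℬ) (X : E), T = triple 0 A X
  -- `𝔤 = (ℬ' ⊕ {φ(A) + A : A ∈ 𝔷(ℬ)}) ⋉ 𝒩`
  | .type3 => ∃ (ℬ : LieSubalgebra ℝ (E →L[ℝ] E)) (φ : LieAlgebra.center ℝ ℬ →ₗ[ℝ] ℝ),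
      IsSkewOn ⊤ ℬ ∧ φ ≠ 0 ∧
      ∀ T, T ∈ 𝔤 ↔ ∃ (C : commutant ℬ) (A : LieAlgebra.center ℝ ℬ) (X : E),
        T = triple 0 ((C : ℬ) : E →L[ℝ] E) 0 + triple (φ A) ((A : ℬ) : E →L[ℝ] E) 0 + triple 0 0 X
  -- `𝔤 = (ℬ' ⊕ {ψ(A) + A : A ∈ 𝔷(ℬ)}) ⋉ 𝒩_W`
  | .type4 => ∃ (U : Submodule ℝ E) (ℬ : LieSubalgebra ℝ (E →L[ℝ] E))
      (ψ : LieAlgebra.center ℝ ℬ →ₗ[ℝ] U),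
      U ≠ ⊥ ∧ Uᗮ ≠ ⊥ ∧ IsSkewOn Uᗮ ℬ ∧ Function.Surjective ψ ∧
      ∀ T, T ∈ 𝔤 ↔ ∃ (C : commutant ℬ) (A : LieAlgebra.center ℝ ℬ) (X : Uᗮ),
        T = triple 0 ((C : ℬ) : E →L[ℝ] E) 0 + triple 0 ((A : ℬ) : E →L[ℝ] E) (ψ A : E)
          + triple 0 0 (X : E)

end Minkowski

end

/-! The bridge between the two pictures is that `V/ℝp` is again `E × ℝ`: modulo `p`, the triple `(a,
A, X)` acts as the scalar `-a` plus the affine field `x ↦ (a + A)x + X`. Scalars do not move lines,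
so the exponential of a triple induces on the isotropic lines exactly the similarity obtained by
exponentiating the field (`snd_exp_triple`, `expTriple_induces_iff`). Infinitesimal similarities are
of this form, and triples and fields have corresponding brackets; so 𝔤 is the Lie algebra of `G` in
other coordinates, and products of exponentials lift `G` to `V`. The lift is unique because the null
vectors `nullVec Y` span `V` (`Induces.unique`).

If `G` is transitive and `V = F ⊕ F'` is an orthogonal invariant splitting, let `p₁` be the
`F`-component of `p`. Up to the factor by which it scales `p`, the group fixes `p₁`, so `η(p₁,
nullVec Y)` does not depend on `Y`; this forces `p₁ ∈ ℝp`. Hence one summand contains `p`, and by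
transitivity it contains all null vectors.

The converse passes through the classification. A weakly irreducible 𝔤 preserves no proper affine
subspace of `E` (`eq_top_of_invariant_affine`). If some element has `a ≠ 0`, the fixed point of a
suitable such element produces an invariant affine subspace directed by the translations, so all
translations lie in 𝔤; whether `(1, 0, 0) ∈ 𝔤` separates types 1 and 3. If always `a = 0` and the
translation space `W` is proper, the `Wᗮ`-parts form a cocycle on the skew parts. A Casimir argument
(`exists_coboundary`) makes it a coboundary up to invariant vectors, and two more invariant
subspaces yield type 4. The splitting of a skew algebra into commutant and centre comes from the
invariant trace inner product.

Each algebra type is then exponentiated to a group of the same type, with `H` generated by the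
rotations `exp A`, `(0, A, 0) ∈ 𝔤`; such groups are transitive by inspection. Finally both group
types and algebra types imply the mutually exclusive conditions `TypeCondition` on 𝔤, which gives
uniqueness and the matching of labels. -/

/-! ### The exponential of an endomorphism -/

section Velocity

variable {F : Type*} [NormedAddCommGroup F] [NormedSpace ℝ F]

/-- The velocity of a curve that stays in a closed subspace lies in this subspace. -/
theorem HasDerivAt.mem_submodule {f : ℝ → F} {f' : F} {t : ℝ} (h : HasDerivAt f f' t)
    {W : Submodule ℝ F} (hW : IsClosed (W : Set F)) (hf : ∀ s, f s ∈ W) : f' ∈ W := by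
  refine hW.mem_of_tendsto (hasDerivAt_iff_tendsto_slope.1 h)
    (Filter.Eventually.of_forall fun s => ?_)
  rw [slope_def_module]
  exact W.smul_mem _ (W.sub_mem (hf _) (hf _))

end Velocity

section Exponential

open NormedSpace

variable {F F₂ : Type*} [NormedAddCommGroup F] [NormedSpace ℝ F] [CompleteSpace F]
  [NormedAddCommGroup F₂] [NormedSpace ℝ F₂] [CompleteSpace F₂]

/-- The exponential of a bounded operator. -/
noncomputable def opExp {F : Type*} [NormedAddCommGroup F] [NormedSpace ℝ F] (T : F →L[ℝ] F) :
    F →L[ℝ] F :=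
  exp T

@[simp]
theorem opExp_zero {F : Type*} [NormedAddCommGroup F] [NormedSpace ℝ F] :
    opExp (0 : F →L[ℝ] F) = 1 :=
  exp_zero

theorem clm_exp_add {S T : F →L[ℝ] F} (h : Commute S T) : opExp (S + T) = opExp S * opExp T := by
  let _ : NormedAlgebra ℚ (F →L[ℝ] F) := NormedAlgebra.restrictScalars ℚ ℝ _
  exact exp_add_of_commute h

theorem clm_isUnit_exp (T : F →L[ℝ] F) : IsUnit (opExp T) := by
  let _ : NormedAlgebra ℚ (F →L[ℝ] F) := NormedAlgebra.restrictScalars ℚ ℝ _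
  exact isUnit_exp T

theorem clm_exp_continuous : Continuous (opExp : (F →L[ℝ] F) → (F →L[ℝ] F)) := by
  let _ : NormedAlgebra ℚ (F →L[ℝ] F) := NormedAlgebra.restrictScalars ℚ ℝ _
  exact exp_continuous

theorem clm_exp_neg_mul (T : F →L[ℝ] F) : opExp (-T) * opExp T = 1 := by
  rw [← clm_exp_add (Commute.refl T).neg_left]
  simp [opExp]

theorem clm_exp_neg_apply (T : F →L[ℝ] F) (v : F) : opExp (-T) (opExp T v) = v := by
  have := congrArg (fun S : F →L[ℝ] F => S v) (clm_exp_neg_mul T)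
  simpa using this

theorem clm_exp_commute {S T : F →L[ℝ] F} (h : Commute S T) : Commute (opExp S) (opExp T) := by
  rw [Commute, SemiconjBy, ← clm_exp_add h, ← clm_exp_add h.symm, add_comm]

theorem hasSum_exp_apply (T : F →L[ℝ] F) (v : F) :
    HasSum (fun n : ℕ => ((n.factorial : ℝ)⁻¹) • (T ^ n) v) (opExp T v) := by
  have := (ContinuousLinearMap.apply ℝ F v).hasSum (exp_series_hasSum_exp' (𝕂 := ℝ) T)
  simpa [opExp] using this

/-- A linear map that intertwines two endomorphisms intertwines their exponentials. -/
theorem exp_intertwine {P : F →L[ℝ] F₂} {S : F →L[ℝ] F} {T : F₂ →L[ℝ] F₂}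
    (h : ∀ v, P (S v) = T (P v)) (v : F) : P (opExp S v) = opExp T (P v) := by
  have key : ∀ n : ℕ, P ((S ^ n) v) = (T ^ n) (P v) := by
    intro n
    induction n with
    | zero => simp
    | succ n ih => rw [pow_succ', pow_succ', mul_apply_eq_comp, mul_apply_eq_comp, h, ih]
  have h1 := P.hasSum (hasSum_exp_apply S v)
  have h2 := hasSum_exp_apply T (P v)
  simp only [map_smul, key] at h1
  exact h1.unique h2

theorem exp_mem_of_invariant {T : F →L[ℝ] F} {W : Submodule ℝ F} (hW : IsClosed (W : Set F))
    (h : ∀ v ∈ W, T v ∈ W) {v : F} (hv : v ∈ W) : opExp T v ∈ W := by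
  have key : ∀ n : ℕ, (T ^ n) v ∈ W := by
    intro n
    induction n with
    | zero => simpa using hv
    | succ n ih => simpa [pow_succ'] using h _ ih
  exact hW.mem_of_tendsto (hasSum_exp_apply T v)
    (Filter.Eventually.of_forall fun s => W.sum_mem fun n _ => W.smul_mem _ (key n))

theorem exp_apply_of_apply_eq_zero {T : F →L[ℝ] F} {v : F} (h : T v = 0) : opExp T v = v := by
  have key := exp_intertwine (P := ContinuousLinearMap.toSpanSingleton ℝ v) (S := 0) (T := T)
    (by simp [h]) 1
  simpa [opExp] using key.symm

theorem exp_smul_one_add (a : ℝ) (T : F →L[ℝ] F) :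
    opExp (a • (1 : F →L[ℝ] F) + T) = Real.exp a • opExp T := by
  rw [clm_exp_add ((Commute.one_left T).smul_left a)]
  have : opExp (a • (1 : F →L[ℝ] F)) = Real.exp a • (1 : F →L[ℝ] F) := by
    rw [opExp, ← Algebra.algebraMap_eq_smul_one, ← Algebra.algebraMap_eq_smul_one, Real.exp_eq_exp_ℝ,
      algebraMap_exp_comm]
  rw [this, smul_mul_assoc, one_mul]

theorem hasDerivAt_exp_smul_apply_zero (T : F →L[ℝ] F) (v : F) :
    HasDerivAt (fun t : ℝ => opExp (t • T) v) (T v) 0 := by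
  have := (hasDerivAt_exp_smul_const' (𝕂 := ℝ) T 0).clm_apply (hasDerivAt_const 0 v)
  simpa [opExp] using this

theorem apply_mem_of_forall_exp_mem {T : F →L[ℝ] F} {W : Submodule ℝ F}
    (hW : IsClosed (W : Set F)) {v : F} (h : ∀ t : ℝ, opExp (t • T) v ∈ W) : T v ∈ W :=
  (hasDerivAt_exp_smul_apply_zero T v).mem_submodule hW h

end Exponential

/-! ### One-parameter groups preserving a bilinear form. -/

section Forms

variable {F : Type*} [NormedAddCommGroup F] [NormedSpace ℝ F] [FiniteDimensional ℝ F]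

/-- Skewness moves `T ^ n` across `B` as `(-T) ^ n`, so termwise `exp T` has the adjoint `exp (-T)`,
which is its inverse. -/
theorem bilin_exp_apply {B : LinearMap.BilinForm ℝ F} {T : F →L[ℝ] F}
    (h : ∀ v w, B (T v) w = -B v (T w)) (v w : F) : B (opExp T v) (opExp T w) = B v w := by
  have := FiniteDimensional.complete ℝ F
  have key : ∀ (n : ℕ) (v w : F), B ((T ^ n) v) w = B v (((-T) ^ n) w) := by
    intro n
    induction n with
    | zero => simp
    | succ n ih =>
      intro v w
      rw [pow_succ', pow_succ, mul_apply_eq_comp, mul_apply_eq_comp, h, ih,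
        neg_apply, map_neg, map_neg]
  have adj : ∀ v w, B (opExp T v) w = B v (opExp (-T) w) := by
    intro v w
    have h1 := (LinearMap.toContinuousLinearMap (B.flip w)).hasSum (hasSum_exp_apply T v)
    have h2 := (LinearMap.toContinuousLinearMap (B v)).hasSum (hasSum_exp_apply (-T) w)
    simp only [LinearMap.coe_toContinuousLinearMap', map_smul] at h1 h2
    change HasSum (fun n : ℕ => (n.factorial : ℝ)⁻¹ • B ((T ^ n) v) w) (B (opExp T v) w) at h1
    simp only [key] at h1
    exact h1.unique h2
  rw [adj, clm_exp_neg_apply]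

theorem hasDerivAt_bilin_exp (B : LinearMap.BilinForm ℝ F) (T : F →L[ℝ] F) (v w : F) :
    HasDerivAt (fun t : ℝ => B (opExp (t • T) v) (opExp (t • T) w)) (B (T v) w + B v (T w)) 0 := by
  have := FiniteDimensional.complete ℝ F
  let L : F →L[ℝ] F →L[ℝ] ℝ := LinearMap.toContinuousLinearMap
    ((LinearMap.toContinuousLinearMap : (F →ₗ[ℝ] ℝ) ≃ₗ[ℝ] (F →L[ℝ] ℝ)).toLinearMap ∘ₗ B)
  have h1 := L.hasFDerivAt.comp_hasDerivAt (0 : ℝ) (hasDerivAt_exp_smul_apply_zero T v)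
  have h2 := h1.clm_apply (hasDerivAt_exp_smul_apply_zero T w)
  simpa [L] using h2

theorem bilin_skew_of_forall_exp {B : LinearMap.BilinForm ℝ F} {T : F →L[ℝ] F}
    (h : ∀ (t : ℝ) v w, B (opExp (t • T) v) (opExp (t • T) w) = B v w) (v w : F) :
    B (T v) w = -B v (T w) := by
  have h1 := hasDerivAt_bilin_exp B T v w
  simp only [h] at h1
  linarith [h1.unique (hasDerivAt_const 0 _)]

/-- An isometry of a nondegenerate form has determinant `±1`, by comparing Gram matrices. The sign
is settled by writing `exp T` as the square of the isometry `exp (T/2)`. -/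
theorem det_exp_eq_one_of_skew {B : LinearMap.BilinForm ℝ F} (hB : B.Nondegenerate)
    {T : F →L[ℝ] F} (h : ∀ v w, B (T v) w = -B v (T w)) : (opExp T).det = 1 := by
  have := FiniteDimensional.complete ℝ F
  let S := (1 / 2 : ℝ) • T
  have hS : ∀ v w, B (opExp S v) (opExp S w) = B v w :=
    bilin_exp_apply fun v w => by simp [S, h]
  have hT : opExp T = opExp S * opExp S := by
    rw [← clm_exp_add (Commute.refl S), ← add_smul]
    norm_num
  have hdet : (opExp S).det * (opExp S).det = 1 := by
    let b := Module.finBasis ℝ F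
    let M : F →ₗ[ℝ] F := (opExp S).toLinearMap
    have e : B.comp M M = B := by
      ext v w
      exact hS v w
    have e2 := LinearMap.BilinForm.toMatrix_comp b b B M M
    rw [e] at e2
    have e3 := congrArg Matrix.det e2
    rw [Matrix.det_mul, Matrix.det_mul, Matrix.det_transpose, LinearMap.det_toMatrix] at e3
    have hne := (LinearMap.BilinForm.nondegenerate_iff_det_ne_zero b).1 hB
    change LinearMap.det M * LinearMap.det M = 1
    have : (LinearMap.BilinForm.toMatrix b B).det *
        (LinearMap.det M * LinearMap.det M - 1) = 0 := by
      linear_combination -e3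
    rcases mul_eq_zero.1 this with h0 | h0
    · exact absurd h0 hne
    · linarith
  rw [hT, ← hdet]
  exact LinearMap.det_comp _ _

end Forms

/-! ### Affine vector fields and one-parameter groups of similarities -/

/-- A similarity multiplies all distances by its ratio. -/
theorem Sim.norm_sub {E : Type*} [NormedAddCommGroup E] (f : E ≃ᵈ E) (x y : E) :
    ‖f x - f y‖ = Dilation.ratio f * ‖x - y‖ := by
  have := Dilation.dist_eq f x y
  rwa [dist_eq_norm, dist_eq_norm] at this

section Affine

variable {E : Type*} [NormedAddCommGroup E] [InnerProductSpace ℝ E]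

/-- The affine vector field `x ↦ l x + X` in homogeneous coordinates. -/
noncomputable def affineField (l : E →L[ℝ] E) (X : E) : (E × ℝ) →L[ℝ] (E × ℝ) :=
  (l ∘L ContinuousLinearMap.fst ℝ E ℝ + (ContinuousLinearMap.snd ℝ E ℝ).smulRight X).prod 0

@[simp]
theorem affineField_apply (l : E →L[ℝ] E) (X : E) (v : E × ℝ) :
    affineField l X v = (l v.1 + v.2 • X, 0) := by
  simp [affineField]

theorem smul_affineField (t : ℝ) (l : E →L[ℝ] E) (X : E) :
    t • affineField l X = affineField (t • l) (t • X) := by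
  refine ContinuousLinearMap.ext fun v => ?_
  simp [smul_smul, mul_comm]

theorem add_affineField (l m : E →L[ℝ] E) (X Y : E) :
    affineField l X + affineField m Y = affineField (l + m) (X + Y) := by
  refine ContinuousLinearMap.ext fun v => ?_
  simp only [add_apply, affineField_apply, Prod.mk_add_mk, smul_add, add_zero]
  congr 1
  abel

theorem lie_affineField (l m : E →L[ℝ] E) (X Y : E) :
    ⁅affineField l X, affineField m Y⁆ = affineField ⁅l, m⁆ (l Y - m X) := by
  refine ContinuousLinearMap.ext fun v => ?_
  simp only [LieRing.of_associative_ring_bracket, sub_apply,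
    mul_apply_eq_comp, affineField_apply, map_add, map_smul, zero_smul, add_zero, smul_sub,
    Prod.mk_sub_mk, sub_zero]
  congr 1
  abel

/-! ### Exponentials of affine fields. -/

section Exp

variable [CompleteSpace E]

theorem exp_affineField_linear (l : E →L[ℝ] E) (X x : E) :
    opExp (affineField l X) (x, 0) = (opExp l x, 0) := by
  have := exp_intertwine (P := ContinuousLinearMap.inl ℝ E ℝ) (S := l) (T := affineField l X)
    (by simp) x
  simpa using this.symm

theorem exp_affineField_apply (l : E →L[ℝ] E) (X x : E) :
    opExp (affineField l X) (x, 1) = (opExp l x + (opExp (affineField l X) (0, 1)).1, 1) := by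
  have h1 : (opExp (affineField l X) (0, 1)).2 = 1 := by
    have := exp_intertwine (P := ContinuousLinearMap.snd ℝ E ℝ) (S := affineField l X)
      (T := (0 : ℝ →L[ℝ] ℝ)) (by simp) (0, 1)
    simpa using this
  have h2 : ((x, 1) : E × ℝ) = (x, 0) + (0, 1) := by simp
  rw [h2, map_add, exp_affineField_linear]
  ext
  · simp
  · simp [h1]

theorem exp_translationField (X x : E) :
    opExp (affineField (0 : E →L[ℝ] E) X) (x, 1) = (x + X, 1) := by
  -- The action on `(x, 1)` is the image of a `2 × 2` nilpotent Jordan block under `(s, r) ↦ r(x, 1)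
  -- + s(X, 0)`, so only the series of that block, which stops after two terms, is computed.
  have key := exp_intertwine
    (P := (ContinuousLinearMap.snd ℝ ℝ ℝ).smulRight ((x, 1) : E × ℝ) +
      (ContinuousLinearMap.fst ℝ ℝ ℝ).smulRight ((X, 0) : E × ℝ))
    (S := affineField (0 : ℝ →L[ℝ] ℝ) 1) (T := affineField (0 : E →L[ℝ] E) X)
    (by intro v; simp [add_comm]) (0, 1)
  have nil : opExp (affineField (0 : ℝ →L[ℝ] ℝ) 1) (0, 1) = (1, 1) := by
    have h := hasSum_exp_apply (affineField (0 : ℝ →L[ℝ] ℝ) 1) (0, 1)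
    have h' := hasSum_sum_of_ne_finset_zero (L := .unconditional ℕ) (s := Finset.range 2)
      (f := fun n : ℕ =>
      ((n.factorial : ℝ)⁻¹) • ((affineField (0 : ℝ →L[ℝ] ℝ) 1) ^ n) ((0, 1) : ℝ × ℝ)) (by
        intro n hn
        obtain ⟨k, rfl⟩ : ∃ k, n = k + 2 := ⟨n - 2, by simp at hn; omega⟩
        have h2 : ((affineField (0 : ℝ →L[ℝ] ℝ) 1) ^ 2) ((0, 1) : ℝ × ℝ) = 0 := by
          simp [pow_two]
        rw [pow_add, mul_apply_eq_comp, h2, map_zero, smul_zero])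
    have e := HasSum.unique h h'
    rw [e]
    simp [Finset.sum_range_succ]
  rw [nil] at key
  simpa using key.symm

end Exp

theorem mem_lieSet_iff {F : Type*} [NormedAddCommGroup F] [NormedSpace ℝ F] [CompleteSpace F]
    {G : Subgroup (F →L[ℝ] F)ˣ} {X : F →L[ℝ] F} :
    X ∈ lieSet G ↔ ∀ t : ℝ, (clm_isUnit_exp (t • X)).unit ∈ G := by
  refine forall_congr' fun t => ⟨?_, fun h => ⟨_, h, IsUnit.unit_spec _⟩⟩
  rintro ⟨g, hg, e⟩
  convert hg
  ext1
  exact e.symm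

theorem mem_lieSet_homogeneous_iff [CompleteSpace E] {G : Subgroup (Sim E)}
    {T : (E × ℝ) →L[ℝ] (E × ℝ)} :
    T ∈ lieSet (homogeneous G) ↔
      ∀ t : ℝ, ∃ f ∈ G, ∀ x : E, opExp (t • T) (x, 1) = (f x, 1) := by
  rw [mem_lieSet_iff]
  rfl

theorem affineField_mem_lieSet_iff [CompleteSpace E] {G : Subgroup (Sim E)} {l : E →L[ℝ] E}
    {X : E} : affineField l X ∈ lieSet (homogeneous G) ↔ ∀ t : ℝ, ∃ f ∈ G, ∀ x : E,
      opExp (affineField (t • l) (t • X)) (x, 1) = (f x, 1) := by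
  simp_rw [mem_lieSet_homogeneous_iff, smul_affineField]

/-- Skew-symmetric operators. -/
def IsSkewOp (A : E →L[ℝ] E) : Prop := ∀ Y Z : E, inner ℝ (A Y) Z = -inner ℝ Y (A Z)

theorem isSkewOp_of_inner_self {A : E →L[ℝ] E} (h : ∀ x, inner ℝ (A x) x = 0) : IsSkewOp A := by
  intro Y Z
  have := h (Y + Z)
  simp only [map_add, inner_add_left, inner_add_right, h] at this
  rw [real_inner_comm Y (A Z)] at this
  linarith

theorem IsSkewOp.inner_self {A : E →L[ℝ] E} (h : IsSkewOp A) (x : E) : inner ℝ (A x) x = 0 := by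
  have := h x x
  rw [real_inner_comm (A x) x] at this
  linarith

theorem IsSkewOp.zero : IsSkewOp (0 : E →L[ℝ] E) := fun Y Z => by simp

theorem IsSkewOp.add {A B : E →L[ℝ] E} (hA : IsSkewOp A) (hB : IsSkewOp B) : IsSkewOp (A + B) :=
  fun Y Z => by simp [inner_add_left, inner_add_right, hA Y Z, hB Y Z, add_comm]

theorem IsSkewOp.smul {A : E →L[ℝ] E} (t : ℝ) (hA : IsSkewOp A) : IsSkewOp (t • A) :=
  fun Y Z => by simp [real_inner_smul_left, real_inner_smul_right, hA Y Z]

theorem IsSkewOp.lie {A B : E →L[ℝ] E} (hA : IsSkewOp A) (hB : IsSkewOp B) : IsSkewOp ⁅A, B⁆ :=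
  fun Y Z => by
    simp only [LieRing.of_associative_ring_bracket, sub_apply,
      mul_apply_eq_comp, inner_sub_left, inner_sub_right]
    rw [hA, hB, hB, hA]
    ring

theorem IsSkewOp.mem_orthogonal {A : E →L[ℝ] E} (hA : IsSkewOp A) {W : Submodule ℝ E}
    (h : ∀ x ∈ W, A x ∈ W) {u : E} (hu : u ∈ Wᗮ) : A u ∈ Wᗮ := by
  rw [Submodule.mem_orthogonal] at hu ⊢
  intro w hw
  have h1 := hA w u
  rw [hu _ (h w hw)] at h1
  linarith

variable [FiniteDimensional ℝ E]

theorem norm_exp_skew {A : E →L[ℝ] E} (hA : IsSkewOp A) (x : E) : ‖opExp A x‖ = ‖x‖ := by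
  have h : inner ℝ (opExp A x) (opExp A x) = inner ℝ x x :=
    bilin_exp_apply (B := innerₗ E) (T := A) (fun v w => hA v w) x x
  rw [real_inner_self_eq_norm_sq, real_inner_self_eq_norm_sq] at h
  exact (sq_eq_sq₀ (norm_nonneg _) (norm_nonneg _)).1 h

/-- The infinitesimal similarities are the sums of a homothety, a skew-symmetric operator and a
translation. -/
theorem exists_of_mem_lieSet_homogeneous [Nontrivial E] {G : Subgroup (Sim E)}
    {T : (E × ℝ) →L[ℝ] (E × ℝ)} (hT : T ∈ lieSet (homogeneous G)) :
    ∃ (a : ℝ) (A : E →L[ℝ] E) (X : E), IsSkewOp A ∧ T = affineField (a • 1 + A) X := by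
  have := FiniteDimensional.complete ℝ E
  obtain ⟨l, X, rfl⟩ : ∃ (l : E →L[ℝ] E) (X : E), T = affineField l X := by
    -- The curve `exp (tT)(x, 1)` stays in the hyperplane `E × {1}`, so its velocity has no second
    -- component.
    have h2 : ∀ x : E, (T (x, 1)).2 = 0 := by
      intro x
      have h := (ContinuousLinearMap.snd ℝ E ℝ).hasFDerivAt.comp_hasDerivAt (0 : ℝ)
        (hasDerivAt_exp_smul_apply_zero T (x, 1))
      have h' : (ContinuousLinearMap.snd ℝ E ℝ) ∘ (fun t : ℝ => opExp (t • T) (x, 1)) =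
          fun _ => 1 := by
        funext t
        obtain ⟨f, -, hf⟩ := mem_lieSet_homogeneous_iff.1 hT t
        simp [hf]
      rw [h'] at h
      exact h.unique (hasDerivAt_const 0 _)
    refine ⟨ContinuousLinearMap.fst ℝ E ℝ ∘L T ∘L ContinuousLinearMap.inl ℝ E ℝ,
      (T (0, 1)).1, ContinuousLinearMap.ext fun v => ?_⟩
    have hv : v = (v.1, 0) + v.2 • ((0, 1) : E × ℝ) := by ext <;> simp
    have h3 : ∀ x : E, (T (x, 0)).2 = 0 := by
      intro x
      have : ((x, 0) : E × ℝ) = (x, 1) - (0, 1) := by simp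
      rw [this, map_sub, Prod.snd_sub, h2, h2, sub_zero]
    conv_lhs => rw [hv, map_add, map_smul]
    ext
    · simp
    · simp [h2, h3]
  -- The linear part of a similarity stretches all vectors by the same ratio, so `‖exp (tl) x‖²
  -- ‖y‖²` is symmetric in `x` and `y`. The derivative at `t = 0` gives the claim: the Rayleigh
  -- quotient of `l` is constant.
  have hl : ∀ x y : E, inner ℝ (l x) x * ‖y‖ ^ 2 = inner ℝ (l y) y * ‖x‖ ^ 2 := by
    intro x y
    have hd : ∀ x : E, HasDerivAt (fun t : ℝ => ‖opExp (t • l) x‖ ^ 2)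
        (2 * inner ℝ (l x) x) 0 := by
      intro x
      have := hasDerivAt_bilin_exp (innerₗ E) l x x
      simp only [innerₗ_apply_apply, real_inner_self_eq_norm_sq] at this
      convert this using 1
      rw [real_inner_comm (l x) x]
      ring
    have h1 := (hd x).mul_const (‖y‖ ^ 2)
    have h2 := (hd y).mul_const (‖x‖ ^ 2)
    have h3 : (fun t : ℝ => ‖opExp (t • l) x‖ ^ 2 * ‖y‖ ^ 2) =
        fun t : ℝ => ‖opExp (t • l) y‖ ^ 2 * ‖x‖ ^ 2 := by
      funext t
      obtain ⟨f, -, hf⟩ := affineField_mem_lieSet_iff.1 hT t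
      have hn : ∀ x, ‖opExp (t • l) x‖ = Dilation.ratio f * ‖x‖ := by
        intro x
        have h0 := congrArg Prod.fst (hf 0)
        have hx := congrArg Prod.fst (hf x)
        rw [exp_affineField_apply] at hx h0
        dsimp only at hx h0
        have := Sim.norm_sub f x 0
        rw [← hx, ← h0] at this
        simpa using this
      rw [hn, hn]
      ring
    rw [h3] at h1
    linarith [h1.unique h2]
  obtain ⟨y, hy⟩ := exists_ne (0 : E)
  -- The homothety coefficient is the common Rayleigh quotient; removing it leaves an operator with
  -- vanishing quadratic form, which is therefore skew.
  refine ⟨inner ℝ (l y) y / ‖y‖ ^ 2, l - (inner ℝ (l y) y / ‖y‖ ^ 2) • 1, X,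
    isSkewOp_of_inner_self fun x => ?_, by simp⟩
  have hy' : ‖y‖ ^ 2 ≠ 0 := by simpa using hy
  simp only [sub_apply, smul_apply,
    one_apply_eq_self, inner_sub_left, real_inner_smul_left, real_inner_self_eq_norm_sq]
  field_simp
  linarith [hl x y]

end Affine

/-! ### The Lorentzian picture -/

section Lorentz

variable {E : Type*} [NormedAddCommGroup E] [InnerProductSpace ℝ E]

theorem eta_apply (v w : Mink E) :
    eta v w = v.1 * w.2.2 + inner ℝ v.2.1 w.2.1 + v.2.2 * w.1 := rfl

theorem eta_comm (v w : Mink E) : eta v w = eta w v := by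
  rw [eta_apply, eta_apply, real_inner_comm]
  ring

theorem eta_isRefl : (eta (E := E)).IsRefl := fun v w h => by rw [eta_comm, h]

theorem eta_vecP (v : Mink E) : eta v vecP = v.2.2 := by simp [eta_apply, vecP]

theorem eq_zero_of_eta_eq_zero {v : Mink E} (h : ∀ w, eta v w = 0) : v = 0 := by
  obtain ⟨x, Y, z⟩ := v
  have h1 := h (0, 0, 1)
  have h2 := h (0, Y, 0)
  have h3 := h (1, 0, 0)
  simp only [eta_apply, mul_one, mul_zero, inner_zero_right, add_zero, zero_add,
    inner_self_eq_zero] at h1 h2 h3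
  simp [h1, h2, h3]

theorem eta_nondegenerate : (eta (E := E)).Nondegenerate :=
  ⟨fun _ h => eq_zero_of_eta_eq_zero h,
    fun v h => eq_zero_of_eta_eq_zero fun w => by rw [eta_comm]; exact h w⟩

/-! #### Triples -/

theorem triple_add (a b : ℝ) (A B : E →L[ℝ] E) (X Y : E) :
    triple a A X + triple b B Y = triple (a + b) (A + B) (X + Y) := by
  refine ContinuousLinearMap.ext fun ⟨x, y, z⟩ => ?_
  simp only [add_apply, triple_apply, Prod.mk_add_mk, inner_add_left, smul_add]
  refine Prod.ext (by dsimp only; ring) (Prod.ext (by dsimp only; abel) (by dsimp only; ring))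

theorem triple_smul (t a : ℝ) (A : E →L[ℝ] E) (X : E) :
    t • triple a A X = triple (t * a) (t • A) (t • X) := by
  refine ContinuousLinearMap.ext fun ⟨x, y, z⟩ => ?_
  simp only [smul_apply, triple_apply, Prod.smul_mk, inner_smul_left, smul_add,
    smul_eq_mul, smul_smul, conj_trivial]
  refine Prod.ext (by dsimp only; ring) (Prod.ext (by dsimp only; rw [mul_comm]) (by dsimp only; ring))

theorem triple_zero : triple 0 (0 : E →L[ℝ] E) (0 : E) = 0 := by
  refine ContinuousLinearMap.ext fun ⟨x, y, z⟩ => ?_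
  simp [triple_apply]

theorem triple_sub (a b : ℝ) (A B : E →L[ℝ] E) (X Y : E) :
    triple a A X - triple b B Y = triple (a - b) (A - B) (X - Y) := by
  refine ContinuousLinearMap.ext fun ⟨x, y, z⟩ => ?_
  simp only [sub_apply, triple_apply, Prod.mk_sub_mk, inner_sub_left, smul_sub]
  refine Prod.ext (by dsimp only; ring) (Prod.ext (by dsimp only; abel) (by dsimp only; ring))

theorem triple_injective {a b : ℝ} {A B : E →L[ℝ] E} {X Y : E}
    (h : triple a A X = triple b B Y) : a = b ∧ A = B ∧ X = Y := by
  have h1 := fun v : Mink E => congrArg (fun T : Mink E →L[ℝ] Mink E => T v) h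
  refine ⟨?_, ContinuousLinearMap.ext fun y => ?_, ?_⟩
  · simpa [triple_apply] using congrArg Prod.fst (h1 (1, 0, 0))
  · simpa [triple_apply] using congrArg (fun v => v.2.1) (h1 (0, y, 0))
  · simpa [triple_apply] using congrArg (fun v => v.2.1) (h1 (0, 0, 1))

theorem lie_triple {a b : ℝ} {A B : E →L[ℝ] E} (hA : IsSkewOp A) (hB : IsSkewOp B) (X Y : E) :
    ⁅triple a A X, triple b B Y⁆ = triple 0 ⁅A, B⁆ ((a • 1 + A) Y - (b • 1 + B) X) := by
  refine ContinuousLinearMap.ext fun ⟨x, y, z⟩ => ?_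
  simp only [LieRing.of_associative_ring_bracket, sub_apply, add_apply, smul_apply,
    one_apply_eq_self, mul_apply_eq_comp, triple_apply, map_add, map_smul, Prod.mk_sub_mk,
    inner_add_right, inner_add_left, inner_sub_left, real_inner_smul_left, real_inner_smul_right,
    hA Y y, hB X y, real_inner_comm X Y]
  refine Prod.ext (by dsimp only; ring) (Prod.ext ?_ (by dsimp only; ring))
  dsimp only
  module

theorem triple_skew {A : E →L[ℝ] E} (hA : IsSkewOp A) (a : ℝ) (X : E) (v w : Mink E) :
    eta (triple a A X v) w = -eta v (triple a A X w) := by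
  obtain ⟨x, y, z⟩ := v
  obtain ⟨x', y', z'⟩ := w
  simp only [eta_apply, triple_apply, inner_add_left, inner_add_right, real_inner_smul_left,
    real_inner_smul_right, hA y y', real_inner_comm X y]
  ring

theorem triple_vecP (a : ℝ) (A : E →L[ℝ] E) (X : E) : triple a A X vecP = a • vecP := by
  simp [vecP, triple_apply]

/-- The blocks are read off from skewness tested on pairs among `p`, `q` and vectors of `E`;
invariance of `ℝp` kills the remaining corner. -/
theorem exists_triple_of_skew {T : Mink E →L[ℝ] Mink E} (h : ∀ v w, eta (T v) w = -eta v (T w))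
    (hp : T vecP ∈ Submodule.span ℝ {vecP (E := E)}) :
    ∃ (a : ℝ) (A : E →L[ℝ] E) (X : E), IsSkewOp A ∧ T = triple a A X := by
  obtain ⟨a, ha⟩ := Submodule.mem_span_singleton.1 hp
  have hp' : T (1, 0, 0) = (a, 0, 0) := by
    change T vecP = _
    rw [← ha]
    simp [vecP]
  let ι : E →L[ℝ] Mink E :=
    ContinuousLinearMap.inr ℝ ℝ (E × ℝ) ∘L ContinuousLinearMap.inl ℝ E ℝ
  let π : Mink E →L[ℝ] E := ContinuousLinearMap.fst ℝ E ℝ ∘L ContinuousLinearMap.snd ℝ ℝ (E × ℝ)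
  let A : E →L[ℝ] E := π ∘L T ∘L ι
  have hAY : ∀ Y, A Y = (T (0, Y, 0)).2.1 := fun Y => rfl
  have hA : IsSkewOp A := by
    intro Y Z
    have := h (0, Y, 0) (0, Z, 0)
    simpa [eta_apply, hAY] using this
  refine ⟨a, A, (T (0, 0, 1)).2.1, hA, ContinuousLinearMap.ext fun ⟨x, Y, z⟩ => ?_⟩
  have hv : ((x, Y, z) : Mink E) = x • ((1, 0, 0) : Mink E) + (0, Y, 0) + z • ((0, 0, 1) : Mink E) := by
    simp
  have hq1 : (T (0, 0, 1)).1 = 0 := by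
    have := h (0, 0, 1) (0, 0, 1)
    simp [eta_apply] at this
    linarith
  have hq2 : (T (0, 0, 1)).2.2 = -a := by
    have := h (0, 0, 1) (1, 0, 0)
    rw [hp'] at this
    simpa [eta_apply] using this
  have hY1 : (T (0, Y, 0)).1 = -inner ℝ (T (0, 0, 1)).2.1 Y := by
    have := h (0, Y, 0) (0, 0, 1)
    simp [eta_apply] at this
    rw [this, real_inner_comm]
  have hY2 : (T (0, Y, 0)).2.2 = 0 := by
    have := h (0, Y, 0) (1, 0, 0)
    rw [hp'] at this
    simpa [eta_apply] using this
  rw [triple_apply, hAY]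
  conv_lhs => rw [hv, map_add, map_add, map_smul, map_smul, hp']
  refine Prod.ext ?_ (Prod.ext ?_ ?_)
  · simp [hq1, hY1]
    ring
  · simp
  · simp [hq2, hY2]
    ring

/-! #### The stabilizer of the isotropic line -/

/-- The equation `2xz + |Y|² = -1` forces `x` and `z` to have opposite signs, so the sheet is
detected by `z = η(v, p)` alone, a coordinate that the stabilizer of `ℝp` merely rescales. -/
theorem mem_lobachevsky_iff {v : Mink E} :
    v ∈ lobachevsky E ↔ eta v v = -1 ∧ v.2.2 < 0 := by
  have h2 : (0 : ℝ) < √2 := by positivity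
  refine and_congr_right fun h => ?_
  rw [div_pos_iff_of_pos_right h2]
  rw [eta_apply, real_inner_self_eq_norm_sq] at h
  have : 0 ≤ ‖v.2.1‖ ^ 2 := by positivity
  constructor
  · intro h0
    by_contra hz
    push Not at hz
    nlinarith
  · intro h0
    have : 0 < v.1 := by
      by_contra hx
      push Not at hx
      nlinarith
    linarith

/-- The isotropic vector over the point `Y`. -/
noncomputable def nullVec (Y : E) : Mink E := (-(1 / 2) * ‖Y‖ ^ 2, Y, 1)

theorem eta_nullVec (Y Z : E) : eta (nullVec Y) (nullVec Z) = -(1 / 2) * ‖Y - Z‖ ^ 2 := by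
  simp only [eta_apply, nullVec, norm_sub_sq_real]
  ring

theorem nullVec_mem_isotropicLine (Y : E) : nullVec Y ∈ isotropicLine Y :=
  Submodule.mem_span_singleton_self _

theorem eq_smul_vecP_add (v : Mink E) :
    v = (v.1 + (1 / 2) * ‖v.2.1‖ ^ 2) • vecP + nullVec v.2.1 + (v.2.2 - 1) • nullVec 0 := by
  obtain ⟨x, Y, z⟩ := v
  simp [nullVec, vecP]

/-- Together with `eq_smul_vecP_add` this shows that the null vectors over points of `E` span `V`; a
nonzero `Y` is what makes `p` available. -/
theorem vecP_eq (Y : E) (hY : Y ≠ 0) :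
    vecP = (-(‖Y‖ ^ 2)⁻¹) • (nullVec Y + nullVec (-Y) - (2 : ℝ) • nullVec (0 : E)) := by
  have : ‖Y‖ ≠ 0 := by simpa using hY
  simp only [nullVec, vecP, Prod.mk_add_mk, Prod.smul_mk, Prod.mk_sub_mk, norm_neg, norm_zero]
  refine Prod.ext ?_ (Prod.ext ?_ ?_)
  · simp; field_simp; ring
  · simp
  · simp; norm_num

/-- With `M p = c p`, invariance of `η(v, p)` gives the action on the last coordinate. The sign of
`c` is tested on one vector of the sheet, whose last coordinate must stay negative. -/
theorem specialOrthogonalP_structure {M : (Mink E →L[ℝ] Mink E)ˣ}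
    (hM : M ∈ specialOrthogonalP E) :
    ∃ c : ℝ, 0 < c ∧ (M : Mink E →L[ℝ] Mink E) vecP = c • vecP ∧
      ∀ v, ((M : Mink E →L[ℝ] Mink E) v).2.2 = c⁻¹ * v.2.2 := by
  obtain ⟨-, h2, h3, h4⟩ := hM
  obtain ⟨c, hc⟩ := Submodule.mem_span_singleton.1
    ((h4 vecP).2 (Submodule.mem_span_singleton_self _))
  have key : ∀ v, c * ((M : Mink E →L[ℝ] Mink E) v).2.2 = v.2.2 := by
    intro v
    have := h2 v vecP
    rw [← hc, map_smul, eta_vecP, eta_vecP] at this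
    exact this
  have hL : ((1, 0, -(1 / 2)) : Mink E) ∈ lobachevsky E := by
    rw [mem_lobachevsky_iff, eta_apply]
    norm_num
  have h0 := (mem_lobachevsky_iff.1 ((h3 _).2 hL)).2
  have hk := key (1, 0, -(1 / 2))
  have hpos : 0 < c := by
    by_contra hc
    push Not at hc
    dsimp only at hk
    nlinarith
  refine ⟨c, hpos, hc.symm, fun v => ?_⟩
  rw [← key v]
  field_simp

theorem Induces.apply_nullVec {M : (Mink E →L[ℝ] Mink E)ˣ} {f : Sim E} (h : Induces M f) {c : ℝ}
    (hc : ∀ v, ((M : Mink E →L[ℝ] Mink E) v).2.2 = c⁻¹ * v.2.2) (Y : E) :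
    (M : Mink E →L[ℝ] Mink E) (nullVec Y) = c⁻¹ • nullVec (f Y) := by
  have h1 : (M : Mink E →L[ℝ] Mink E) (nullVec Y) ∈ isotropicLine (f Y) := by
    rw [← h Y]
    exact Submodule.mem_map_of_mem (nullVec_mem_isotropicLine Y)
  obtain ⟨d, hd⟩ := Submodule.mem_span_singleton.1 h1
  change d • nullVec (f Y) = _ at hd
  have h2 := hc (nullVec Y)
  rw [← hd] at h2 ⊢
  simp [nullVec] at h2
  rw [h2]

theorem induces_iff {M : (Mink E →L[ℝ] Mink E)ˣ} {f : Sim E} {c : ℝ} (hc0 : c ≠ 0)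
    (hc : ∀ v, ((M : Mink E →L[ℝ] Mink E) v).2.2 = c⁻¹ * v.2.2) :
    Induces M f ↔ ∀ Y, (M : Mink E →L[ℝ] Mink E) (nullVec Y) = c⁻¹ • nullVec (f Y) := by
  refine ⟨fun h Y => h.apply_nullVec hc Y, fun h Y => ?_⟩
  rw [isotropicLine, isotropicLine, Submodule.map_span, Set.image_singleton]
  change Submodule.span ℝ {(M : Mink E →L[ℝ] Mink E) (nullVec Y)} = Submodule.span ℝ {nullVec (f Y)}
  rw [h]
  exact Submodule.span_singleton_smul_eq (IsUnit.mk0 _ (inv_ne_zero hc0)) _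

/-- On null vectors `M` is `c⁻¹` times the map given by `f`, and the positive number `c` is
determined by `f`, because `η` of two null vectors is `-½` times the squared distance of their base
points. The null vectors span. -/
theorem Induces.unique [Nontrivial E] {M N : (Mink E →L[ℝ] Mink E)ˣ} {f : Sim E}
    (hM : M ∈ specialOrthogonalP E) (hN : N ∈ specialOrthogonalP E)
    (h : Induces M f) (k : Induces N f) : M = N := by
  obtain ⟨c, hc0, -, hc⟩ := specialOrthogonalP_structure hM
  obtain ⟨d, hd0, -, hd⟩ := specialOrthogonalP_structure hN
  obtain ⟨Y, hY⟩ := exists_ne (0 : E)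
  have hcd : c⁻¹ = d⁻¹ := by
    have h1 := hM.2.1 (nullVec Y) (nullVec 0)
    have h2 := hN.2.1 (nullVec Y) (nullVec 0)
    rw [h.apply_nullVec hc, h.apply_nullVec hc] at h1
    rw [k.apply_nullVec hd, k.apply_nullVec hd] at h2
    simp only [map_smul, LinearMap.smul_apply, eta_nullVec, smul_eq_mul] at h1 h2
    have hne : ‖f Y - f 0‖ ≠ 0 := by
      rw [norm_ne_zero_iff, sub_ne_zero]
      exact fun e => hY (f.injective e)
    have h3 : (c⁻¹ ^ 2 - d⁻¹ ^ 2) * ‖f Y - f 0‖ ^ 2 = 0 := by linear_combination (-2) * (h1 - h2)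
    rcases mul_eq_zero.1 h3 with h3 | h3
    · exact (sq_eq_sq₀ (by positivity) (by positivity)).1 (sub_eq_zero.1 h3)
    · exact absurd (pow_eq_zero_iff two_ne_zero |>.1 h3) hne
  have hn : ∀ Y, (M : Mink E →L[ℝ] Mink E) (nullVec Y) = (N : Mink E →L[ℝ] Mink E) (nullVec Y) := by
    intro Y
    rw [h.apply_nullVec hc, k.apply_nullVec hd, hcd]
  have hp : (M : Mink E →L[ℝ] Mink E) vecP = (N : Mink E →L[ℝ] Mink E) vecP := by
    rw [vecP_eq Y hY]
    simp only [map_smul, map_sub, map_add, hn]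
  ext1
  refine ContinuousLinearMap.ext fun v => ?_
  rw [eq_smul_vecP_add v]
  simp only [map_smul, map_add, hn, hp]

/-! #### Exponentials of triples -/

variable [FiniteDimensional ℝ E]

/-- Projection along `p` intertwines the triple with `-a` plus an affine field. The scalar commutes
with the field and factors out of the exponential. -/
theorem snd_exp_triple (a : ℝ) (A : E →L[ℝ] E) (X : E) (v : Mink E) :
    (opExp (triple a A X) v).2 = Real.exp (-a) • opExp (affineField (a • 1 + A) X) v.2 := by
  have := FiniteDimensional.complete ℝ E
  have h := exp_intertwine (P := ContinuousLinearMap.snd ℝ ℝ (E × ℝ)) (S := triple a A X)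
    (T := (-a) • 1 + affineField (a • 1 + A) X) (by
      rintro ⟨x, Y, z⟩
      simp [triple_apply]
      abel) v
  rw [exp_smul_one_add] at h
  exact h

theorem exp_triple_vecP (a : ℝ) (A : E →L[ℝ] E) (X : E) :
    opExp (triple a A X) vecP = Real.exp a • vecP := by
  have := FiniteDimensional.complete ℝ E
  have h := exp_intertwine (P := ContinuousLinearMap.toSpanSingleton ℝ (vecP (E := E)))
    (S := a • 1 + 0) (T := triple a A X) (by simp [triple_vecP, smul_smul, mul_comm]) 1
  rw [exp_smul_one_add] at h
  simpa using h.symm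

theorem snd_snd_exp_triple (a : ℝ) (A : E →L[ℝ] E) (X : E) (v : Mink E) :
    (opExp (triple a A X) v).2.2 = (Real.exp a)⁻¹ * v.2.2 := by
  have := FiniteDimensional.complete ℝ E
  have h := exp_intertwine (P := ContinuousLinearMap.snd ℝ E ℝ)
    (S := affineField (a • 1 + A) X) (T := (0 : ℝ →L[ℝ] ℝ)) (by simp) v.2
  rw [opExp_zero] at h
  have h' : (opExp (affineField (a • 1 + A) X) v.2).2 = v.2.2 := h
  rw [snd_exp_triple, Prod.smul_snd, h', Real.exp_neg, smul_eq_mul]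

/-- The exponential of a triple, as an invertible operator. -/
noncomputable def expTriple (a : ℝ) (A : E →L[ℝ] E) (X : E) : (Mink E →L[ℝ] Mink E)ˣ :=
  haveI := FiniteDimensional.complete ℝ E
  (clm_isUnit_exp (triple a A X)).unit

theorem coe_expTriple (a : ℝ) (A : E →L[ℝ] E) (X : E) :
    (expTriple a A X : Mink E →L[ℝ] Mink E) = opExp (triple a A X) := rfl

theorem eta_exp_triple {A : E →L[ℝ] E} (hA : IsSkewOp A) (a : ℝ) (X : E) (v w : Mink E) :
    eta (opExp (triple a A X) v) (opExp (triple a A X) w) = eta v w :=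
  bilin_exp_apply (triple_skew hA a X) v w

theorem expTriple_mem {A : E →L[ℝ] E} (hA : IsSkewOp A) (a : ℝ) (X : E) :
    expTriple a A X ∈ specialOrthogonalP E := by
  have hp : ∀ v : Mink E, v ∈ Submodule.span ℝ {vecP (E := E)} →
      opExp (triple a A X) v ∈ Submodule.span ℝ {vecP (E := E)} := by
    intro v hv
    obtain ⟨c, rfl⟩ := Submodule.mem_span_singleton.1 hv
    rw [map_smul, exp_triple_vecP]
    exact Submodule.smul_mem _ _ (Submodule.smul_mem _ _ (Submodule.mem_span_singleton_self _))
  refine ⟨det_exp_eq_one_of_skew eta_nondegenerate (triple_skew hA a X),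
    eta_exp_triple hA a X, fun v => ?_, fun v => ⟨fun h => ?_, hp v⟩⟩
  · rw [mem_lobachevsky_iff, mem_lobachevsky_iff, coe_expTriple, eta_exp_triple hA,
      snd_snd_exp_triple]
    refine and_congr_right fun _ => ?_
    exact smul_neg_iff_of_pos_left (inv_pos.2 (Real.exp_pos a))
  · obtain ⟨c, hc⟩ := Submodule.mem_span_singleton.1 h
    have hinj : Function.Injective (expTriple a A X : Mink E →L[ℝ] Mink E) := by
      intro v w e
      have := FiniteDimensional.complete ℝ E
      have e' : opExp (triple a A X) v = opExp (triple a A X) w := e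
      rw [← clm_exp_neg_apply (triple a A X) v, e', clm_exp_neg_apply]
    have : v = (c * (Real.exp a)⁻¹) • vecP := by
      apply hinj
      rw [← hc, coe_expTriple, map_smul, exp_triple_vecP, smul_smul, mul_assoc,
        inv_mul_cancel₀ (Real.exp_pos a).ne', mul_one]
    rw [this]
    exact Submodule.smul_mem _ _ (Submodule.mem_span_singleton_self _)

/-- Modulo `p` both sides say the same by `snd_exp_triple`. The lost `p`-coordinate of the image is
recovered from isotropy, since its last coordinate is nonzero. -/
theorem expTriple_induces_iff {A : E →L[ℝ] E} (hA : IsSkewOp A) (a : ℝ) (X : E) (f : Sim E) :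
    Induces (expTriple a A X) f ↔
      ∀ x : E, opExp (affineField (a • 1 + A) X) (x, 1) = (f x, 1) := by
  have hc : ∀ v, ((expTriple a A X : Mink E →L[ℝ] Mink E) v).2.2 = (Real.exp a)⁻¹ * v.2.2 :=
    snd_snd_exp_triple a A X
  rw [induces_iff (Real.exp_pos a).ne' hc]
  have hpos := Real.exp_pos (-a)
  have hs : ∀ x : E, (opExp (triple a A X) (nullVec x)).2 =
      Real.exp (-a) • opExp (affineField (a • 1 + A) X) (x, 1) := fun x => snd_exp_triple a A X _
  refine forall_congr' fun x => ⟨fun h => ?_, fun h => ?_⟩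
  · have h1 := congrArg Prod.snd h
    rw [coe_expTriple, hs, ← Real.exp_neg] at h1
    exact smul_right_injective _ hpos.ne' h1
  · have h2 : (opExp (triple a A X) (nullVec x)).2 = ((Real.exp a)⁻¹ • nullVec (f x)).2 := by
      rw [hs, h, ← Real.exp_neg]
      rfl
    refine Prod.ext ?_ h2
    rw [coe_expTriple]
    have h3 := eta_exp_triple hA a X (nullVec x) (nullVec x)
    have h4 : eta ((Real.exp a)⁻¹ • nullVec (f x)) ((Real.exp a)⁻¹ • nullVec (f x)) = 0 := by
      simp [eta_nullVec]
    rw [eta_nullVec, sub_self, norm_zero, eta_apply, h2] at h3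
    rw [eta_apply] at h4
    have h5 : ((Real.exp a)⁻¹ • nullVec (f x)).2.2 = (Real.exp a)⁻¹ := by simp [nullVec]
    rw [h5] at h3 h4
    have h6 : (Real.exp a)⁻¹ ≠ 0 := inv_ne_zero (Real.exp_pos a).ne'
    refine mul_right_cancel₀ h6 ?_
    linarith

end Lorentz

/-! ### The Lie algebra of the Lorentzian group of a connected group of similarities -/

section Correspondence

variable {E : Type*} [NormedAddCommGroup E] [InnerProductSpace ℝ E]

/-- Divided by its ratio, a similarity is a surjective isometry, hence affine by Mazur–Ulam. -/
theorem Sim.exists_linear (f : Sim E) :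
    ∃ r : ℝ, 0 < r ∧ ∃ R : E ≃ₗᵢ[ℝ] E, ∀ x, f x = r • R x + f 0 := by
  have hr : (0 : ℝ) < Dilation.ratio f := by exact_mod_cast Dilation.ratio_pos f
  let g : E ≃ᵢ E :=
    { toEquiv := f.toEquiv.trans
        (LinearEquiv.smulOfNeZero ℝ E (Dilation.ratio f : ℝ)⁻¹ (inv_ne_zero hr.ne')).toEquiv
      isometry_toFun := by
        refine Isometry.of_dist_eq fun x y => ?_
        change dist ((Dilation.ratio f : ℝ)⁻¹ • f x) ((Dilation.ratio f : ℝ)⁻¹ • f y) = _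
        rw [dist_smul₀, dist_eq_norm (f x), Sim.norm_sub, dist_eq_norm, norm_inv,
          Real.norm_of_nonneg hr.le, inv_mul_cancel_left₀ hr.ne'] }
  have hg : ∀ x, g x = (Dilation.ratio f : ℝ)⁻¹ • f x := fun x => rfl
  refine ⟨Dilation.ratio f, hr, g.toRealAffineIsometryEquiv.linearIsometryEquiv, fun x => ?_⟩
  have h := g.toRealAffineIsometryEquiv.map_vadd 0 x
  simp only [vadd_eq_add, add_zero, IsometryEquiv.coeFn_toRealAffineIsometryEquiv, hg] at h
  have h' := congrArg (fun y => (Dilation.ratio f : ℝ) • y) h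
  simpa [smul_smul, hr.ne'] using h'

theorem clm_ext_of_affine {F : Type*} [NormedAddCommGroup F] [NormedSpace ℝ F]
    {S T : (E × ℝ) →L[ℝ] F} (h : ∀ x : E, S (x, 1) = T (x, 1)) : S = T := by
  refine ContinuousLinearMap.ext fun v => ?_
  have hv : v = ((v.1, 1) : E × ℝ) + (v.2 - 1) • ((0, 1) : E × ℝ) := by ext <;> simp
  rw [hv, map_add, map_add, map_smul, map_smul, h, h]

theorem Sim.exists_homogeneous (f : Sim E) : ∃ M : ((E × ℝ) →L[ℝ] (E × ℝ))ˣ,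
    ∀ x : E, (M : (E × ℝ) →L[ℝ] (E × ℝ)) (x, 1) = (f x, 1) := by
  have key : ∀ f : Sim E, ∃ M : (E × ℝ) →L[ℝ] (E × ℝ), ∀ x : E, M (x, 1) = (f x, 1) := by
    intro f
    obtain ⟨r, -, R, h⟩ := f.exists_linear
    refine ⟨((r • (R.toContinuousLinearEquiv : E →L[ℝ] E)) ∘L ContinuousLinearMap.fst ℝ E ℝ +
      (ContinuousLinearMap.snd ℝ E ℝ).smulRight (f 0)).prod (ContinuousLinearMap.snd ℝ E ℝ),
      fun x => ?_⟩
    rw [h x]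
    simp
  obtain ⟨M, hM⟩ := key f
  obtain ⟨N, hN⟩ := key f⁻¹
  refine ⟨⟨M, N, clm_ext_of_affine fun x => ?_, clm_ext_of_affine fun x => ?_⟩, hM⟩
  · rw [mul_apply_eq_comp, hN, hM]
    exact congrArg (·, (1 : ℝ)) (f.apply_symm_apply x)
  · rw [mul_apply_eq_comp, hM, hN]
    exact congrArg (·, (1 : ℝ)) (f.symm_apply_apply x)

theorem Induces.mul {M N : (Mink E →L[ℝ] Mink E)ˣ} {f g : Sim E} (h : Induces M f)
    (k : Induces N g) : Induces (M * N) (f * g) := by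
  intro Y
  have := h (g Y)
  rw [← k, ← Submodule.map_comp] at this
  exact this

theorem Induces.inv {M : (Mink E →L[ℝ] Mink E)ˣ} {f : Sim E} (h : Induces M f) :
    Induces M⁻¹ f⁻¹ := by
  intro Y
  have h1 := h (f⁻¹ Y)
  have h2 : f (f⁻¹ Y) = Y := f.apply_symm_apply Y
  rw [h2] at h1
  rw [← h1, ← Submodule.map_comp]
  have : (((M⁻¹ : (Mink E →L[ℝ] Mink E)ˣ) : Mink E →L[ℝ] Mink E) : Mink E →ₗ[ℝ] Mink E) ∘ₗ
      ((M : Mink E →L[ℝ] Mink E) : Mink E →ₗ[ℝ] Mink E) = LinearMap.id := by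
    ext1 <;> ext <;> simp [← mul_apply_eq_comp]
  rw [this, Submodule.map_id]

theorem induces_one : Induces (1 : (Mink E →L[ℝ] Mink E)ˣ) 1 := fun _ => Submodule.map_id _

theorem mem_lieSet_iff_of_coe_eq {G : Subgroup (Sim E)}
    {𝔥 : LieSubalgebra ℝ ((E × ℝ) →L[ℝ] (E × ℝ))}
    (h : (𝔥 : Set ((E × ℝ) →L[ℝ] (E × ℝ))) = lieSet (homogeneous G))
    (T : (E × ℝ) →L[ℝ] (E × ℝ)) : T ∈ lieSet (homogeneous G) ↔ T ∈ 𝔥 := by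
  rw [← h]
  rfl

variable [FiniteDimensional ℝ E]

/-- This is the dictionary between the two Lie algebras: the one-parameter groups of the triple and
of the affine field correspond for every time `t`. -/
theorem triple_mem_lieSet_iff {G : Subgroup (Sim E)} {a : ℝ} {A : E →L[ℝ] E} (hA : IsSkewOp A)
    {X : E} : triple a A X ∈ lieSet (lorentzGroup G) ↔
      affineField (a • 1 + A) X ∈ lieSet (homogeneous G) := by
  have := FiniteDimensional.complete ℝ E
  rw [mem_lieSet_iff, affineField_mem_lieSet_iff]
  refine forall_congr' fun t => ?_
  have e : (clm_isUnit_exp (t • triple a A X)).unit = expTriple (t * a) (t • A) (t • X) := by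
    ext1
    rw [coe_expTriple, ← triple_smul]
    rfl
  have e2 : t • (a • (1 : E →L[ℝ] E) + A) = (t * a) • 1 + t • A := by rw [smul_add, smul_smul]
  rw [e, e2]
  constructor
  · rintro ⟨-, f, hf, h⟩
    exact ⟨f, hf, (expTriple_induces_iff (hA.smul t) _ _ f).1 h⟩
  · rintro ⟨f, hf, h⟩
    exact ⟨expTriple_mem (hA.smul t) _ _, f, hf, (expTriple_induces_iff (hA.smul t) _ _ f).2 h⟩

theorem exists_triple_of_mem_lieSet {G : Subgroup (Sim E)} {T : Mink E →L[ℝ] Mink E}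
    (hT : T ∈ lieSet (lorentzGroup G)) :
    ∃ (a : ℝ) (A : E →L[ℝ] E) (X : E), IsSkewOp A ∧ T = triple a A X := by
  have := FiniteDimensional.complete ℝ E
  rw [mem_lieSet_iff] at hT
  refine exists_triple_of_skew (bilin_skew_of_forall_exp fun t v w => (hT t).1.2.1 v w) ?_
  exact apply_mem_of_forall_exp_mem (Submodule.closed_of_finiteDimensional _)
    fun t => ((hT t).1.2.2.2 vecP).2 (Submodule.mem_span_singleton_self _)

/-- The Lie algebra of `lorentzGroup G`. -/
def lorentzAlgebra {G : Subgroup (Sim E)} {𝔥 : LieSubalgebra ℝ ((E × ℝ) →L[ℝ] (E × ℝ))}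
    (h : (𝔥 : Set ((E × ℝ) →L[ℝ] (E × ℝ))) = lieSet (homogeneous G)) :
    LieSubalgebra ℝ (Mink E →L[ℝ] Mink E) where
  carrier := lieSet (lorentzGroup G)
  add_mem' := by
    intro S T hS hT
    obtain ⟨a, A, X, hA, rfl⟩ := exists_triple_of_mem_lieSet hS
    obtain ⟨b, B, Y, hB, rfl⟩ := exists_triple_of_mem_lieSet hT
    rw [triple_mem_lieSet_iff hA, mem_lieSet_iff_of_coe_eq h] at hS
    rw [triple_mem_lieSet_iff hB, mem_lieSet_iff_of_coe_eq h] at hT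
    rw [triple_add, triple_mem_lieSet_iff (hA.add hB), mem_lieSet_iff_of_coe_eq h]
    convert 𝔥.add_mem hS hT using 1
    rw [add_affineField]
    congr 1
    module
  zero_mem' := by
    have h0 : (0 : (E × ℝ) →L[ℝ] (E × ℝ)) ∈ 𝔥 := 𝔥.zero_mem
    rw [← triple_zero, triple_mem_lieSet_iff IsSkewOp.zero, mem_lieSet_iff_of_coe_eq h]
    convert h0 using 1
    refine ContinuousLinearMap.ext fun v => ?_
    simp
  smul_mem' := by
    intro t S hS
    obtain ⟨a, A, X, hA, rfl⟩ := exists_triple_of_mem_lieSet hS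
    rw [triple_mem_lieSet_iff hA, mem_lieSet_iff_of_coe_eq h] at hS
    rw [triple_smul, triple_mem_lieSet_iff (hA.smul t), mem_lieSet_iff_of_coe_eq h]
    convert 𝔥.smul_mem t hS using 1
    rw [smul_affineField]
    congr 1
    module
  lie_mem' := by
    intro S T hS hT
    obtain ⟨a, A, X, hA, rfl⟩ := exists_triple_of_mem_lieSet hS
    obtain ⟨b, B, Y, hB, rfl⟩ := exists_triple_of_mem_lieSet hT
    rw [triple_mem_lieSet_iff hA, mem_lieSet_iff_of_coe_eq h] at hS
    rw [triple_mem_lieSet_iff hB, mem_lieSet_iff_of_coe_eq h] at hT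
    change ⁅triple a A X, triple b B Y⁆ ∈ lieSet (lorentzGroup G)
    rw [lie_triple hA hB, triple_mem_lieSet_iff (hA.lie hB), mem_lieSet_iff_of_coe_eq h]
    -- Scalars commute with all operators, so the linear part of the bracket of the fields is also
    -- `[A, B]`.
    convert 𝔥.lie_mem hS hT using 1
    rw [lie_affineField]
    congr 1
    simp only [LieRing.of_associative_ring_bracket, add_mul, mul_add, smul_mul_assoc,
      mul_smul_comm, one_mul, mul_one]
    module

variable {G : Subgroup (Sim E)} {𝔥 : LieSubalgebra ℝ ((E × ℝ) →L[ℝ] (E × ℝ))}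

theorem mem_lorentzAlgebra_iff
    (h : (𝔥 : Set ((E × ℝ) →L[ℝ] (E × ℝ))) = lieSet (homogeneous G)) {T : Mink E →L[ℝ] Mink E} :
    T ∈ lorentzAlgebra h ↔ T ∈ lieSet (lorentzGroup G) := Iff.rfl

/-- `G` is generated by exponentials of infinitesimal similarities; each of them lifts to the
exponential of a triple, and lifts can be multiplied and inverted. -/
theorem exists_mem_closure_induces [Nontrivial E]
    (h : IsConnectedLieSubgroupWith (homogeneous G) 𝔥) {f : Sim E} (hf : f ∈ G) :
    ∃ M ∈ Subgroup.closure {g : (Mink E →L[ℝ] Mink E)ˣ | ∃ T ∈ lorentzAlgebra h.lie_eq,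
      (g : Mink E →L[ℝ] Mink E) = opExp T}, Induces M f := by
  have := FiniteDimensional.complete ℝ E
  obtain ⟨N, hN⟩ := f.exists_homogeneous
  have hNG : N ∈ homogeneous G := ⟨f, hf, hN⟩
  rw [h.generates] at hNG
  suffices H : ∃ M ∈ Subgroup.closure {g : (Mink E →L[ℝ] Mink E)ˣ |
      ∃ T ∈ lorentzAlgebra h.lie_eq, (g : Mink E →L[ℝ] Mink E) = opExp T},
      -- The induction runs over the matrix `N`, so the similarity it represents has to be
      -- existential; it is identified with `f` only at the end.
      ∃ g : Sim E, (∀ x : E, (N : (E × ℝ) →L[ℝ] (E × ℝ)) (x, 1) = (g x, 1)) ∧ Induces M g by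
    obtain ⟨M, hM, g, hg, hMg⟩ := H
    have : g = f := DilationEquiv.ext fun x => by
      have := hg x
      rw [hN] at this
      exact (congrArg Prod.fst this).symm
    exact ⟨M, hM, this ▸ hMg⟩
  clear hN
  induction hNG using Subgroup.closure_induction with
  | mem N hN =>
    obtain ⟨X0, hX0, e⟩ := hN
    have hX0' : X0 ∈ lieSet (homogeneous G) := h.lie_eq ▸ hX0
    obtain ⟨a, A, X, hA, rfl⟩ := exists_of_mem_lieSet_homogeneous hX0'
    have hT : triple a A X ∈ lorentzAlgebra h.lie_eq := (triple_mem_lieSet_iff hA).2 hX0'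
    obtain ⟨g, -, hg⟩ := affineField_mem_lieSet_iff.1 hX0' 1
    simp only [one_smul] at hg
    refine ⟨expTriple a A X, Subgroup.subset_closure ⟨_, hT, rfl⟩, g, fun x => ?_,
      (expTriple_induces_iff hA a X g).2 hg⟩
    rw [e]
    exact hg x
  | one => exact ⟨1, Subgroup.one_mem _, 1, fun x => rfl, induces_one⟩
  | mul N N' _ _ h1 h2 =>
    obtain ⟨M, hM, g, hg, hMg⟩ := h1
    obtain ⟨M', hM', g', hg', hMg'⟩ := h2
    exact ⟨M * M', Subgroup.mul_mem _ hM hM', g * g', fun x => by simp [hg', hg], hMg.mul hMg'⟩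
  | inv N _ h1 =>
    obtain ⟨M, hM, g, hg, hMg⟩ := h1
    refine ⟨M⁻¹, Subgroup.inv_mem _ hM, g⁻¹, fun x => ?_, hMg.inv⟩
    have h1 := hg (g⁻¹ x)
    have h2 : g (g⁻¹ x) = x := g.apply_symm_apply x
    rw [h2] at h1
    rw [← h1, ← mul_apply_eq_comp]
    simp

theorem closure_exp_le_lorentzGroup
    (h : (𝔥 : Set ((E × ℝ) →L[ℝ] (E × ℝ))) = lieSet (homogeneous G)) :
    Subgroup.closure {g : (Mink E →L[ℝ] Mink E)ˣ | ∃ T ∈ lorentzAlgebra h,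
      (g : Mink E →L[ℝ] Mink E) = opExp T} ≤ lorentzGroup G := by
  rw [Subgroup.closure_le]
  rintro g ⟨T, hT, e⟩
  obtain ⟨g', hg', e'⟩ := hT 1
  rw [one_smul] at e'
  rwa [← Units.ext (e'.trans e.symm)]

theorem lorentzGroup_isConnected [Nontrivial E]
    (h : IsConnectedLieSubgroupWith (homogeneous G) 𝔥) :
    IsConnectedLieSubgroupWith (lorentzGroup G) (lorentzAlgebra h.lie_eq) where
  lie_eq := rfl
  generates := by
    refine le_antisymm (fun M hM => ?_) (closure_exp_le_lorentzGroup h.lie_eq)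
    obtain ⟨hM', f, hf, hMf⟩ := hM
    obtain ⟨N, hN, hNf⟩ := exists_mem_closure_induces h hf
    rwa [hMf.unique hM' (closure_exp_le_lorentzGroup h.lie_eq hN).1 hNf]

theorem existsUnique_induces [Nontrivial E]
    (h : IsConnectedLieSubgroupWith (homogeneous G) 𝔥) {f : Sim E} (hf : f ∈ G) :
    ∃! M, M ∈ lorentzGroup G ∧ Induces M f := by
  obtain ⟨N, hN, hNf⟩ := exists_mem_closure_induces h hf
  have hN' := closure_exp_le_lorentzGroup h.lie_eq hN
  exact ⟨N, ⟨hN', hNf⟩, fun M hM => hM.2.unique hM.1.1 hN'.1 hNf⟩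

theorem lorentzAlgebra_isSubalgebraOfSOP
    (h : (𝔥 : Set ((E × ℝ) →L[ℝ] (E × ℝ))) = lieSet (homogeneous G)) :
    IsSubalgebraOfSOP (lorentzAlgebra h) := by
  intro T hT
  obtain ⟨a, A, X, hA, rfl⟩ := exists_triple_of_mem_lieSet hT
  refine ⟨triple_skew hA a X, ?_⟩
  rw [triple_vecP]
  exact Submodule.smul_mem _ _ (Submodule.mem_span_singleton_self _)

end Correspondence

/-! ### Transitivity and weak irreducibility -/

section Transitivity

variable {E : Type*} [NormedAddCommGroup E] [InnerProductSpace ℝ E]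

theorem vecP_ne_zero {E : Type*} [NormedAddCommGroup E] [InnerProductSpace ℝ E] :
    (vecP : Mink E) ≠ 0 := by simp [vecP]

/-- A weakly irreducible algebra preserves no proper affine subspace of `E`. -/
theorem eq_top_of_invariant_affine {𝔤 : LieSubalgebra ℝ (Mink E →L[ℝ] Mink E)}
    (hwi : IsWeaklyIrreducibleAlg 𝔤)
    (ht : ∀ T ∈ 𝔤, ∃ (a : ℝ) (A : E →L[ℝ] E) (X : E), IsSkewOp A ∧ T = triple a A X)
    (u : E) (S : Submodule ℝ E)
    (h : ∀ (a : ℝ) (A : E →L[ℝ] E) (X : E), IsSkewOp A → triple a A X ∈ 𝔤 →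
      (∀ s ∈ S, A s ∈ S) ∧ a • u + A u + X ∈ S) : S = ⊤ := by
  -- `F` is the span of `p` and the isotropic lines over the affine subspace `u + S`. The hypothesis
  -- says that each field is tangent to `u + S`.
  let F : Submodule ℝ (Mink E) :=
    { carrier := {v | v.2.1 - v.2.2 • u ∈ S}
      add_mem' := by
        intro v w hv hw
        have := S.add_mem hv hw
        simp only [Set.mem_ofPred_eq, Prod.snd_add, Prod.fst_add, add_smul]
        convert this using 1
        abel
      zero_mem' := by simp
      smul_mem' := by
        intro c v hv
        have := S.smul_mem c hv
        simpa [smul_sub, smul_smul] using this }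
  have hF : ∀ v : Mink E, v ∈ F ↔ v.2.1 - v.2.2 • u ∈ S := fun v => Iff.rfl
  have hp : Preserves 𝔤 F := by
    intro T hT v hv
    obtain ⟨a, A, X, hA, rfl⟩ := ht T hT
    obtain ⟨h1, h2⟩ := h a A X hA hT
    obtain ⟨x, Y, z⟩ := v
    rw [hF] at hv ⊢
    rw [triple_apply]
    dsimp only at hv ⊢
    have := S.add_mem (h1 _ hv) (S.smul_mem z h2)
    convert this using 1
    rw [map_sub, map_smul]
    module
  -- A vector in the radical is tested against `p`, then against its own `E`-part, which now lies in
  -- `S`, then against `u + q`; these kill its three coordinates.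
  have hnd : (eta.restrict F).Nondegenerate := by
    have key : ∀ v : F, (∀ w : F, eta (v : Mink E) (w : Mink E) = 0) → v = 0 := by
      rintro ⟨⟨x, Y, z⟩, hv⟩ hw
      have h1 := hw ⟨(1, 0, 0), by simp [hF]⟩
      have h2 := hw ⟨(0, u, 1), by simp [hF]⟩
      simp only [eta_apply, mul_zero, inner_zero_right, zero_add, mul_one, add_zero] at h1 h2
      rw [hF] at hv
      have hY : Y ∈ S := by simpa [h1] using hv
      have h3 := hw ⟨(0, Y, 0), by simpa [hF] using hY⟩
      simp only [eta_apply, mul_zero, zero_add, add_zero, inner_self_eq_zero] at h3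
      rw [h3, inner_zero_left, add_zero] at h2
      simp [h1, h2, h3]
    exact ⟨fun v hv => key v hv, fun v hv => key v fun w => by rw [eta_comm]; exact hv w⟩
  rcases hwi F hp hnd with hbot | htop
  · have h1 : (vecP : Mink E) ∈ F := by simp [hF, vecP]
    rw [hbot, Submodule.mem_bot] at h1
    exact absurd h1 vecP_ne_zero
  · rw [eq_top_iff]
    intro Y _
    have h1 : ((0, Y, 0) : Mink E) ∈ F := htop ▸ Submodule.mem_top
    simpa [hF] using h1

theorem not_isIrreducibleAlg [Nontrivial E] {𝔤 : LieSubalgebra ℝ (Mink E →L[ℝ] Mink E)}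
    (h : IsSubalgebraOfSOP 𝔤) : ¬ IsIrreducibleAlg 𝔤 := by
  intro hi
  have hp : Preserves 𝔤 (Submodule.span ℝ {vecP (E := E)}) := by
    intro T hT v hv
    obtain ⟨c, rfl⟩ := Submodule.mem_span_singleton.1 hv
    rw [map_smul]
    exact Submodule.smul_mem _ _ (h T hT).2
  rcases hi _ hp with hb | ht
  · exact vecP_ne_zero (Submodule.span_singleton_eq_bot.1 hb)
  · have h1 : ((0, 0, 1) : Mink E) ∈ Submodule.span ℝ {vecP (E := E)} := ht ▸ Submodule.mem_top
    obtain ⟨c, hc⟩ := Submodule.mem_span_singleton.1 h1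
    simpa [vecP] using congrArg (fun v => v.2.2) hc

variable [FiniteDimensional ℝ E]

theorem Preserves.group {Γ : Subgroup (Mink E →L[ℝ] Mink E)ˣ}
    {𝔤 : LieSubalgebra ℝ (Mink E →L[ℝ] Mink E)} (hΓ : IsConnectedLieSubgroupWith Γ 𝔤)
    {F : Submodule ℝ (Mink E)} (hF : Preserves 𝔤 F) {M : (Mink E →L[ℝ] Mink E)ˣ} (hM : M ∈ Γ)
    {v : Mink E} (hv : v ∈ F) : (M : Mink E →L[ℝ] Mink E) v ∈ F := by
  have := FiniteDimensional.complete ℝ E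
  rw [hΓ.generates] at hM
  -- Invariance under `M⁻¹` is carried along so that the inverse step of the closure induction is
  -- available.
  suffices H : (∀ v ∈ F, (M : Mink E →L[ℝ] Mink E) v ∈ F) ∧
      ∀ v ∈ F, ((M⁻¹ : (Mink E →L[ℝ] Mink E)ˣ) : Mink E →L[ℝ] Mink E) v ∈ F from H.1 v hv
  clear hv v
  have hcl : IsClosed (F : Set (Mink E)) := Submodule.closed_of_finiteDimensional F
  induction hM using Subgroup.closure_induction with
  | mem M hM =>
    obtain ⟨T, hT, e⟩ := hM
    refine ⟨fun v hv => ?_, fun v hv => ?_⟩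
    · rw [e]
      exact exp_mem_of_invariant hcl (hF T hT) hv
    · have h1 : ((M⁻¹ : (Mink E →L[ℝ] Mink E)ˣ) : Mink E →L[ℝ] Mink E) = opExp (-T) :=
        Units.inv_eq_of_mul_eq_one_left (by rw [e]; exact clm_exp_neg_mul T)
      rw [h1]
      exact exp_mem_of_invariant hcl (fun w hw => by simpa using F.neg_mem (hF T hT w hw)) hv
  | one => simp
  | mul M N _ _ h1 h2 =>
    refine ⟨fun v hv => ?_, fun v hv => ?_⟩
    · simpa using h1.1 _ (h2.1 v hv)
    · rw [mul_inv_rev]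
      simpa using h2.2 _ (h1.2 v hv)
  | inv M _ h => exact ⟨h.2, by rw [inv_inv]; exact h.1⟩

/-- For an invariant splitting `V = F ⊕ F'`, the component of `p` in `F` must be a multiple of `p`,
so `p` lies in one summand. The other is orthogonal to `p`, so the first contains a vector off `pᗮ`,
and transitivity makes it everything. -/
theorem ActsTransitively.isWeaklyIrreducibleAlg [Nontrivial E] {G : Subgroup (Sim E)}
    {𝔤 : LieSubalgebra ℝ (Mink E →L[ℝ] Mink E)}
    (hΓ : IsConnectedLieSubgroupWith (lorentzGroup G) 𝔤) (hsub : IsSubalgebraOfSOP 𝔤)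
    (hex : ∀ f ∈ G, ∃! M, M ∈ lorentzGroup G ∧ Induces M f)
    (htr : ActsTransitively G) : IsWeaklyIrreducibleAlg 𝔤 := by
  have move : ∀ Y Z : E, ∃ M ∈ lorentzGroup G, ∃ c : ℝ, c ≠ 0 ∧
      (M : Mink E →L[ℝ] Mink E) vecP = c • vecP ∧
      (M : Mink E →L[ℝ] Mink E) (nullVec Y) = c⁻¹ • nullVec Z := by
    intro Y Z
    obtain ⟨f, hf, hfY⟩ := htr Y Z
    obtain ⟨M, ⟨hM, hMf⟩, -⟩ := hex f hf
    obtain ⟨c, hc, hp, hc'⟩ := specialOrthogonalP_structure hM.1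
    exact ⟨M, hM, c, hc.ne', hp, by rw [hMf.apply_nullVec hc', hfY]⟩
  -- Subtracting a multiple of `p` from a vector off `pᗮ` yields a null vector over some point; the
  -- group then carries it to null vectors over all points.
  have full : ∀ K : Submodule ℝ (Mink E), Preserves 𝔤 K → vecP ∈ K → (∃ w ∈ K, w.2.2 ≠ 0) →
      K = ⊤ := by
    rintro K hK hp ⟨w, hw, hw0⟩
    obtain ⟨Y, hY⟩ : ∃ Y, nullVec Y ∈ K := by
      refine ⟨w.2.2⁻¹ • w.2.1, ?_⟩
      have : nullVec (w.2.2⁻¹ • w.2.1) = w.2.2⁻¹ • w +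
          (-(1 / 2) * ‖w.2.2⁻¹ • w.2.1‖ ^ 2 - w.2.2⁻¹ * w.1) • vecP := by
        obtain ⟨x, Y, z⟩ := w
        dsimp only at hw0
        simp [nullVec, vecP, hw0]
      rw [this]
      exact K.add_mem (K.smul_mem _ hw) (K.smul_mem _ hp)
    have hall : ∀ Z, nullVec Z ∈ K := by
      intro Z
      obtain ⟨M, hM, c, hc, -, h⟩ := move Y Z
      have := hK.group hΓ hM hY
      rw [h] at this
      exact (K.smul_mem_iff (inv_ne_zero hc)).1 this
    rw [eq_top_iff]
    intro v _
    rw [eq_smul_vecP_add v]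
    exact K.add_mem (K.add_mem (K.smul_mem _ hp) (hall _)) (K.smul_mem _ (hall _))
  intro F hF hnd
  have hcompl := LinearMap.BilinForm.isCompl_orthogonal_of_restrict_nondegenerate
    (eta_isRefl (E := E)) hnd
  set F' := eta.orthogonal F with hF'
  have hFp : Preserves 𝔤 F' := by
    intro T hT v hv
    rw [hF', LinearMap.BilinForm.mem_orthogonal_iff] at hv ⊢
    intro w hw
    have h1 := (hsub T hT).1 w v
    have h2 : eta (T w) v = 0 := hv _ (hF T hT w hw)
    rw [h2] at h1
    change eta w (T v) = 0
    linarith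
  have hp : vecP ∈ F ⊔ F' := hcompl.sup_eq_top ▸ Submodule.mem_top
  obtain ⟨p₁, h₁, p₂, h₂, e⟩ := Submodule.mem_sup.1 hp
  -- `M p = c p` splits uniquely along `F ⊕ F'`, so each component of `p` is scaled by the same `c`.
  have hM : ∀ M ∈ lorentzGroup G, ∀ c : ℝ, (M : Mink E →L[ℝ] Mink E) vecP = c • vecP →
      (M : Mink E →L[ℝ] Mink E) p₁ = c • p₁ := by
    intro M hM c hc
    rw [← e, map_add, smul_add] at hc
    have e1 : (M : Mink E →L[ℝ] Mink E) p₁ - c • p₁ = c • p₂ - (M : Mink E →L[ℝ] Mink E) p₂ := by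
      rw [sub_eq_sub_iff_add_eq_add, hc, add_comm]
    have m1 : (M : Mink E →L[ℝ] Mink E) p₁ - c • p₁ ∈ F ⊓ F' := by
      refine ⟨F.sub_mem (hF.group hΓ hM h₁) (F.smul_mem _ h₁), ?_⟩
      rw [e1]
      exact F'.sub_mem (F'.smul_mem _ h₂) (hFp.group hΓ hM h₂)
    rw [hcompl.inf_eq_bot, Submodule.mem_bot, sub_eq_zero] at m1
    exact m1
  -- The factors `c` on `p₁` and `c⁻¹` on the null vector cancel. As a polynomial in `Y` the pairing
  -- is `x + ⟨P, Y⟩ - z|Y|²/2`, so constancy forces `z = 0` and `P = 0`.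
  have hconst : ∀ Y, eta p₁ (nullVec Y) = eta p₁ (nullVec 0) := by
    intro Y
    obtain ⟨M, hMG, c, hc, hp, hn⟩ := move Y 0
    have h1 := hMG.1.2.1 p₁ (nullVec Y)
    rw [hM M hMG c hp, hn, map_smul, map_smul, LinearMap.smul_apply, smul_smul,
      inv_mul_cancel₀ hc, one_smul] at h1
    exact h1.symm
  obtain ⟨x, P, z⟩ := p₁
  simp only [eta_apply, nullVec, norm_zero, inner_zero_right] at hconst
  obtain ⟨Y, hY⟩ := exists_ne (0 : E)
  have hz : z = 0 := by
    have ha := hconst Y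
    have hb := hconst (-Y)
    rw [inner_neg_right, norm_neg] at hb
    have hY' : ‖Y‖ ^ 2 ≠ 0 := by simpa using hY
    have : z * ‖Y‖ ^ 2 = 0 := by linarith
    exact (mul_eq_zero.1 this).resolve_right hY'
  have hP : P = 0 := by
    have ha := hconst P
    rw [hz] at ha
    exact inner_self_eq_zero (𝕜 := ℝ) |>.1 (by linarith)
  subst hz hP
  have hx : ((x, 0, 0) : Mink E) = x • vecP := by simp [vecP]
  rw [hx] at h₁ e
  have hdeg : ∀ K : Submodule ℝ (Mink E), (∀ w ∈ K, w.2.2 = 0) →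
      K ≤ eta.orthogonal (Submodule.span ℝ {vecP}) := by
    intro K hK w hw
    rw [LinearMap.BilinForm.mem_orthogonal_iff]
    intro v hv
    obtain ⟨c, rfl⟩ := Submodule.mem_span_singleton.1 hv
    change eta (c • vecP) w = 0
    rw [map_smul, LinearMap.smul_apply, eta_comm, eta_vecP, hK w hw, smul_zero]
  have hnot : ¬ ((∀ w ∈ F, w.2.2 = 0) ∧ ∀ w ∈ F', w.2.2 = 0) := by
    rintro ⟨ha, hb⟩
    have h1 := sup_le (hdeg F ha) (hdeg F' hb)
    rw [hcompl.sup_eq_top] at h1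
    have h2 := h1 (Submodule.mem_top (x := ((0, 0, 1) : Mink E)))
    have h3 := (LinearMap.BilinForm.mem_orthogonal_iff.1 h2) vecP (Submodule.mem_span_singleton_self _)
    change eta vecP _ = 0 at h3
    simp [eta_apply, vecP] at h3
  by_cases hx0 : x = 0
  · left
    rw [hx0, zero_smul, zero_add] at e
    rw [e] at h₂
    have hF0 : ∀ w ∈ F, w.2.2 = 0 := fun w hw => by
      rw [← eta_vecP]
      exact LinearMap.BilinForm.mem_orthogonal_iff.1 h₂ w hw
    have hw : ∃ w ∈ F', w.2.2 ≠ 0 := by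
      by_contra! hcon
      exact hnot ⟨hF0, hcon⟩
    exact (LinearMap.BilinForm.orthogonal_eq_top_iff eta_isRefl hnd).1 (full F' hFp h₂ hw)
  · right
    have hpF : vecP ∈ F := (F.smul_mem_iff hx0).1 h₁
    have hF0 : ∀ w ∈ F', w.2.2 = 0 := fun w hw => by
      rw [← eta_vecP, eta_comm]
      exact LinearMap.BilinForm.mem_orthogonal_iff.1 hw vecP hpF
    have hw : ∃ w ∈ F, w.2.2 ≠ 0 := by
      by_contra! hcon
      exact hnot ⟨hcon, hF0⟩
    exact full F hF hpF hw

end Transitivity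

/-! ### Lie algebras of skew-symmetric operators -/

section Skew

variable {E : Type*} [NormedAddCommGroup E] [InnerProductSpace ℝ E]
  {ℬ : LieSubalgebra ℝ (E →L[ℝ] E)}

theorem commutant_toSubmodule : (commutant ℬ).toSubmodule =
    Submodule.span ℝ {x : ℬ | ∃ A B : ℬ, ⁅A, B⁆ = x} := by
  rw [LieSubmodule.lieIdeal_oper_eq_linear_span']
  congr 1
  ext x
  simp

theorem lie_mem_commutant (A B : ℬ) : ⁅A, B⁆ ∈ commutant ℬ := by
  change _ ∈ (commutant ℬ).toSubmodule
  rw [commutant_toSubmodule]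
  exact Submodule.subset_span ⟨A, B, rfl⟩

theorem mem_center_iff {Z : ℬ} : Z ∈ LieAlgebra.center ℝ ℬ ↔
    ∀ B ∈ ℬ, ⁅B, (Z : E →L[ℝ] E)⁆ = 0 := by
  rw [LieModule.mem_maxTrivSubmodule]
  constructor
  · intro h B hB
    have := congrArg (Subtype.val) (h ⟨B, hB⟩)
    simpa using this
  · intro h B
    exact Subtype.ext (by simpa using h B B.2)

variable [FiniteDimensional ℝ E]

/-- An operator as the tuple of its values on an orthonormal basis. -/
noncomputable def hsVec :
    (E →L[ℝ] E) →ₗ[ℝ] PiLp 2 (fun _ : Fin (Module.finrank ℝ E) => E) where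
  toFun A := WithLp.toLp 2 fun i => A (stdOrthonormalBasis ℝ E i)
  map_add' A B := by ext; simp
  map_smul' t A := by ext; simp

theorem hsVec_apply (A : E →L[ℝ] E) (i : Fin (Module.finrank ℝ E)) :
    hsVec A i = A (stdOrthonormalBasis ℝ E i) := rfl

theorem hsVec_injective : Function.Injective (hsVec (E := E)) := by
  intro A B h
  have : (A : E →ₗ[ℝ] E) = B := (stdOrthonormalBasis ℝ E).toBasis.ext fun i => by
    have := congrArg (fun v : PiLp 2 (fun _ : Fin (Module.finrank ℝ E) => E) => v i) h
    simpa [hsVec_apply] using this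
  exact ContinuousLinearMap.coe_injective this

/-- This is invariance of the trace inner product. Left multiplication by `m` is skew term by term;
right multiplication is handled by expanding `m` in the orthonormal basis. -/
theorem inner_hsVec_lie {m : E →L[ℝ] E} (hm : IsSkewOp m) (A B : E →L[ℝ] E) :
    inner ℝ (hsVec ⁅m, A⁆) (hsVec B) = -inner ℝ (hsVec A) (hsVec ⁅m, B⁆) := by
  have h1 : ∀ A B : E →L[ℝ] E, inner ℝ (hsVec (m * A)) (hsVec B) =
      -inner ℝ (hsVec A) (hsVec (m * B)) := by
    intro A B
    simp only [PiLp.inner_apply, hsVec_apply, mul_apply_eq_comp, ← Finset.sum_neg_distrib]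
    exact Finset.sum_congr rfl fun i _ => hm _ _
  have h2 : inner ℝ (hsVec (A * m)) (hsVec B) = -inner ℝ (hsVec A) (hsVec (B * m)) := by
    let b := stdOrthonormalBasis ℝ E
    have hx : ∀ i, m (b i) = ∑ j, inner ℝ (b j) (m (b i)) • b j :=
      fun i => (b.sum_repr' (m (b i))).symm
    have e1 : ∀ i, A (m (b i)) = ∑ j, inner ℝ (b j) (m (b i)) • A (b j) := by
      intro i
      conv_lhs => rw [hx i, map_sum]
      simp
    have e2 : ∀ i, B (m (b i)) = ∑ j, inner ℝ (b j) (m (b i)) • B (b j) := by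
      intro i
      conv_lhs => rw [hx i, map_sum]
      simp
    simp only [PiLp.inner_apply, hsVec_apply, mul_apply_eq_comp]
    change ∑ i, inner ℝ (A (m (b i))) (B (b i)) = -∑ i, inner ℝ (A (b i)) (B (m (b i)))
    simp only [e1, e2, sum_inner, inner_sum, real_inner_smul_left, real_inner_smul_right]
    rw [Finset.sum_comm, ← Finset.sum_neg_distrib]
    refine Finset.sum_congr rfl fun i _ => ?_
    rw [← Finset.sum_neg_distrib]
    refine Finset.sum_congr rfl fun j _ => ?_
    have := hm (b i) (b j)
    rw [real_inner_comm (b j) (m (b i))] at this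
    rw [this]
    ring
  rw [LieRing.of_associative_ring_bracket, LieRing.of_associative_ring_bracket, map_sub, map_sub,
    inner_sub_left, inner_sub_right, h1, h2]
  ring

theorem exists_sub_orthogonal (K : Submodule ℝ (E →L[ℝ] E)) (A : E →L[ℝ] E) :
    ∃ k ∈ K, ∀ k' ∈ K, inner ℝ (hsVec (A - k)) (hsVec k') = 0 := by
  obtain ⟨y, hy, z, hz, e⟩ := (K.map hsVec).exists_add_mem_mem_orthogonal (hsVec A)
  obtain ⟨k, hk, rfl⟩ := hy
  refine ⟨k, hk, fun k' hkk => ?_⟩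
  rw [map_sub, e, add_sub_cancel_left, real_inner_comm]
  exact hz _ (Submodule.mem_map_of_mem hkk)

/-- A subspace that contains the commutant has a central complement. -/
theorem exists_central_of_lie_mem (hℬ : ∀ A ∈ ℬ, IsSkewOp A) {K : Submodule ℝ (E →L[ℝ] E)}
    (hK : K ≤ ℬ.toSubmodule) (hlie : ∀ A ∈ ℬ, ∀ B ∈ ℬ, ⁅A, B⁆ ∈ K) {A : E →L[ℝ] E} (hA : A ∈ ℬ) :
    ∃ k ∈ K, A - k ∈ ℬ ∧ ∀ B ∈ ℬ, ⁅B, A - k⁆ = 0 := by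
  obtain ⟨k, hk, h⟩ := exists_sub_orthogonal K A
  have hz : A - k ∈ ℬ := ℬ.sub_mem hA (hK hk)
  refine ⟨k, hk, hz, fun B hB => ?_⟩
  -- With `Z = A - k` orthogonal to `K`, invariance gives `|[B, Z]|² = -⟨Z, [B, [B, Z]]⟩`, and the
  -- double bracket lies in `K`.
  have h1 := inner_hsVec_lie (hℬ B hB) (A - k) ⁅B, A - k⁆
  rw [h _ (hlie _ hB _ (ℬ.lie_mem hB hz)), neg_zero, inner_self_eq_zero] at h1
  exact hsVec_injective (h1.trans (map_zero _).symm)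

theorem exists_commutant_add_center (hℬ : ∀ A ∈ ℬ, IsSkewOp A) {A : E →L[ℝ] E} (hA : A ∈ ℬ) :
    ∃ (C : commutant ℬ) (Z : LieAlgebra.center ℝ ℬ),
      A = ((C : ℬ) : E →L[ℝ] E) + ((Z : ℬ) : E →L[ℝ] E) := by
  obtain ⟨k, hk, hz, hc⟩ := exists_central_of_lie_mem hℬ
    (K := (commutant ℬ).toSubmodule.map ℬ.toSubmodule.subtype)
    (by rintro _ ⟨x, -, rfl⟩; exact x.2)
    (fun A hA B hB => ⟨⁅⟨A, hA⟩, ⟨B, hB⟩⁆, lie_mem_commutant _ _, rfl⟩) hA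
  obtain ⟨C, hC, rfl⟩ := hk
  exact ⟨⟨C, hC⟩, ⟨⟨_, hz⟩, mem_center_iff.2 hc⟩, by simp⟩

/-- Centre and commutant are orthogonal: `⟨[A, B], C⟩ = -⟨B, [A, C]⟩ = 0` for central `C`. -/
theorem eq_zero_of_commutant_of_center (hℬ : ∀ A ∈ ℬ, IsSkewOp A) {C : ℬ}
    (hC : C ∈ commutant ℬ) (hZ : C ∈ LieAlgebra.center ℝ ℬ) : C = 0 := by
  have key : ∀ D ∈ commutant ℬ, inner ℝ (hsVec (D : E →L[ℝ] E)) (hsVec (C : E →L[ℝ] E)) = 0 := by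
    intro D hD
    change D ∈ (commutant ℬ).toSubmodule at hD
    rw [commutant_toSubmodule] at hD
    induction hD using Submodule.span_induction with
    | mem x hx =>
      obtain ⟨A, B, rfl⟩ := hx
      have := inner_hsVec_lie (hℬ A A.2) (B : E →L[ℝ] E) (C : E →L[ℝ] E)
      rw [mem_center_iff.1 hZ A A.2, map_zero, inner_zero_right, neg_zero] at this
      exact this
    | zero => simp
    | add x y _ _ hx hy => simp [inner_add_left, hx, hy]
    | smul t x _ hx => simp [real_inner_smul_left, hx]
  have h := inner_self_eq_zero (𝕜 := ℝ) |>.1 (key C hC)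
  exact Subtype.ext (hsVec_injective (h.trans (map_zero _).symm))

/-- Every cocycle of a Lie algebra of skew-symmetric operators is a coboundary up to a cocycle with
invariant values. -/
theorem exists_coboundary (hℬ : ∀ A ∈ ℬ, IsSkewOp A) (c : ℬ →ₗ[ℝ] E)
    (hc : ∀ A B : ℬ, c ⁅A, B⁆ = (A : E →L[ℝ] E) (c B) - (B : E →L[ℝ] E) (c A)) :
    ∃ u : E, ∀ A B : ℬ, (B : E →L[ℝ] E) (c A - (A : E →L[ℝ] E) u) = 0 := by
  let J : ℬ →ₗ[ℝ] PiLp 2 (fun _ : Fin (Module.finrank ℝ E) => E) :=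
    hsVec ∘ₗ ℬ.toSubmodule.subtype
  have hJinj : Function.Injective J := hsVec_injective.comp Subtype.val_injective
  let b := stdOrthonormalBasis ℝ (LinearMap.range J)
  have hb : ∀ i, ∃ A : ℬ, J A = b i := fun i => (b i).2
  choose e he using hb
  have hsum : ∀ A : ℬ, A = ∑ i, inner ℝ (J (e i)) (J A) • e i := by
    intro A
    apply hJinj
    have h := congrArg Subtype.val (b.sum_repr' ⟨J A, LinearMap.mem_range_self J A⟩)
    rw [map_sum]
    simp only [map_smul, he]
    refine h.symm.trans ?_
    simp
  -- The tensor `∑ eᵢ ⊗ eᵢ` of an orthonormal basis is invariant under `ad m`, since `ad m` has a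
  -- skew matrix.
  have hanti : ∀ (m : ℬ) (β : ℬ →ₗ[ℝ] ℬ →ₗ[ℝ] E),
      ∑ i, (β ⁅m, e i⁆ (e i) + β (e i) ⁅m, e i⁆) = 0 := by
    intro m β
    have hs : ∀ i j, inner ℝ (J (e j)) (J ⁅m, e i⁆) = -inner ℝ (J (e i)) (J ⁅m, e j⁆) := by
      intro i j
      have := inner_hsVec_lie (hℬ m m.2) (e i : E →L[ℝ] E) (e j : E →L[ℝ] E)
      rw [real_inner_comm]
      exact this
    have h1 : ∀ i, β ⁅m, e i⁆ (e i) = ∑ j, inner ℝ (J (e j)) (J ⁅m, e i⁆) • β (e j) (e i) := by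
      intro i
      conv_lhs => rw [hsum ⁅m, e i⁆]
      simp
    have h2 : ∀ i, β (e i) ⁅m, e i⁆ = ∑ j, inner ℝ (J (e j)) (J ⁅m, e i⁆) • β (e i) (e j) := by
      intro i
      conv_lhs => rw [hsum ⁅m, e i⁆]
      simp
    rw [Finset.sum_add_distrib]
    simp only [h1, h2]
    rw [Finset.sum_comm, ← Finset.sum_add_distrib]
    refine Finset.sum_eq_zero fun i _ => ?_
    rw [← Finset.sum_add_distrib]
    refine Finset.sum_eq_zero fun j _ => ?_
    rw [hs j i]
    simp
  -- `Ω` is the Casimir operator. By `hanti` it commutes with ℬ, and being minus a sum of squares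
  -- `eᵢᵀeᵢ` its kernel is the common kernel of ℬ.
  let Ω : E →ₗ[ℝ] E := ∑ i, ((e i : E →L[ℝ] E) * (e i : E →L[ℝ] E) : E →L[ℝ] E).toLinearMap
  have hΩ : ∀ x, Ω x = ∑ i, (e i : E →L[ℝ] E) ((e i : E →L[ℝ] E) x) := by
    intro x
    simp [Ω]
  let app : ℬ →ₗ[ℝ] E →ₗ[ℝ] E :=
    (ContinuousLinearMap.coeLM ℝ : (E →L[ℝ] E) →ₗ[ℝ] (E →ₗ[ℝ] E)) ∘ₗ ℬ.toSubmodule.subtype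
  have happ : ∀ (A : ℬ) x, app A x = (A : E →L[ℝ] E) x := fun A x => rfl
  have hbr : ∀ (A B : ℬ) (x : E), ((⁅A, B⁆ : ℬ) : E →L[ℝ] E) x =
      (A : E →L[ℝ] E) ((B : E →L[ℝ] E) x) - (B : E →L[ℝ] E) ((A : E →L[ℝ] E) x) := by
    intro A B x
    simp [LieRing.of_associative_ring_bracket]
  have hΩcomm : ∀ (m : ℬ) x, (m : E →L[ℝ] E) (Ω x) = Ω ((m : E →L[ℝ] E) x) := by
    intro m x
    have h := hanti m (LinearMap.mk₂ ℝ (fun A B : ℬ => (A : E →L[ℝ] E) ((B : E →L[ℝ] E) x))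
      (by simp) (by simp) (by simp) (by simp))
    simp only [LinearMap.mk₂_apply, hbr, map_sub] at h
    rw [hΩ, hΩ, map_sum, ← sub_eq_zero, ← Finset.sum_sub_distrib, ← h]
    refine Finset.sum_congr rfl fun i _ => ?_
    abel
  -- `s` is the cocycle contracted with the Casimir tensor; invariance and the cocycle identity give
  -- `m s = Ω (c m)`. If `Ω u = s`, then `Ω (c m - m u) = 0`.
  let s : E := ∑ i, (e i : E →L[ℝ] E) (c (e i))
  have hs : ∀ m : ℬ, (m : E →L[ℝ] E) s = Ω (c m) := by
    intro m
    have h := hanti m (LinearMap.mk₂ ℝ (fun A B : ℬ => (A : E →L[ℝ] E) (c B))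
      (by simp) (by simp) (by simp) (by simp))
    simp only [LinearMap.mk₂_apply, hbr, hc, map_sub] at h
    rw [hΩ, map_sum, ← sub_eq_zero, ← Finset.sum_sub_distrib, ← h]
    refine Finset.sum_congr rfl fun i _ => ?_
    abel
  have hker : ∀ x, Ω x = 0 → ∀ B : ℬ, (B : E →L[ℝ] E) x = 0 := by
    intro x hx B
    have h1 : ∑ i, ‖(e i : E →L[ℝ] E) x‖ ^ 2 = 0 := by
      have h2 : inner ℝ (Ω x) x = 0 := by rw [hx, inner_zero_left]
      rw [hΩ, sum_inner] at h2
      rw [← neg_eq_zero, ← Finset.sum_neg_distrib, ← h2]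
      refine Finset.sum_congr rfl fun i _ => ?_
      rw [hℬ _ (e i).2, real_inner_self_eq_norm_sq]
    have h3 : ∀ i, (e i : E →L[ℝ] E) x = 0 := by
      intro i
      have := (Finset.sum_eq_zero_iff_of_nonneg (fun i _ => by positivity)).1 h1 i (Finset.mem_univ i)
      simpa using this
    rw [← happ, hsum B, map_sum]
    simp [happ, h3]
  have hsym : Ω.IsSymmetric := by
    intro x y
    rw [hΩ, hΩ, sum_inner, inner_sum]
    refine Finset.sum_congr rfl fun i _ => ?_
    rw [hℬ _ (e i).2, hℬ _ (e i).2, neg_neg]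
  -- `Ω` is symmetric, so its range is the orthogonal complement of its kernel; vectors killed by ℬ
  -- are orthogonal to every `eᵢ (c eᵢ)`.
  obtain ⟨u, hu⟩ : s ∈ LinearMap.range Ω := by
    rw [← Submodule.orthogonal_orthogonal (LinearMap.range Ω), hsym.orthogonal_range,
      Submodule.mem_orthogonal]
    intro x hx
    have hx' := hker x hx
    change inner ℝ x (∑ i, (e i : E →L[ℝ] E) (c (e i))) = 0
    rw [inner_sum]
    refine Finset.sum_eq_zero fun i _ => ?_
    have := hℬ _ (e i).2 x (c (e i))
    rw [hx' (e i), inner_zero_left] at this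
    linarith
  refine ⟨u, fun A B => hker _ ?_ B⟩
  rw [map_sub, ← hs, ← hΩcomm, hu, sub_self]

end Skew

/-! ### Weakly irreducible subalgebras -/

section Classification

theorem exists_linearMap_of_graph {V Y : Type*} [AddCommGroup V] [Module ℝ V] [AddCommGroup Y]
    [Module ℝ Y] (R : Submodule ℝ (V × Y)) (h : ∀ x, ∃ y, (x, y) ∈ R)
    (h0 : ∀ y, ((0 : V), y) ∈ R → y = 0) : ∃ f : V →ₗ[ℝ] Y, ∀ x y, (x, y) ∈ R ↔ y = f x := by
  have huniq : ∀ x y y', (x, y) ∈ R → (x, y') ∈ R → y = y' := by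
    intro x y y' hy hy'
    have := R.sub_mem hy hy'
    rw [Prod.mk_sub_mk, sub_self] at this
    exact sub_eq_zero.1 (h0 _ this)
  choose g hg using h
  refine ⟨⟨⟨g, fun x x' => ?_⟩, fun t x => ?_⟩, fun x y => ⟨fun hy => huniq _ _ _ hy (hg x), ?_⟩⟩
  · exact huniq _ _ _ (hg _) (R.add_mem (hg x) (hg x'))
  · exact huniq _ _ _ (hg _) (R.smul_mem t (hg x))
  · rintro rfl
    exact hg x

variable {E : Type*} [NormedAddCommGroup E] [InnerProductSpace ℝ E]

/-- `𝔤` consists of triples. -/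
def ConsistsOfTriples (𝔤 : LieSubalgebra ℝ (Mink E →L[ℝ] Mink E)) : Prop :=
  ∀ T ∈ 𝔤, ∃ (a : ℝ) (A : E →L[ℝ] E) (X : E), IsSkewOp A ∧ T = triple a A X

variable {𝔤 : LieSubalgebra ℝ (Mink E →L[ℝ] Mink E)}

theorem ConsistsOfTriples.isSkewOp (ht : ConsistsOfTriples 𝔤) {a : ℝ} {A : E →L[ℝ] E} {X : E}
    (h : triple a A X ∈ 𝔤) : IsSkewOp A := by
  obtain ⟨b, B, Y, hB, e⟩ := ht _ h
  rwa [(triple_injective e).2.1]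

theorem triple_add_mem {a b c : ℝ} {A B C : E →L[ℝ] E} {X Y Z : E} (h : triple a A X ∈ 𝔤)
    (k : triple b B Y ∈ 𝔤) (h1 : a + b = c) (h2 : A + B = C) (h3 : X + Y = Z) :
    triple c C Z ∈ 𝔤 := by
  subst h1 h2 h3
  rw [← triple_add]
  exact 𝔤.add_mem h k

theorem triple_sub_mem {a b c : ℝ} {A B C : E →L[ℝ] E} {X Y Z : E} (h : triple a A X ∈ 𝔤)
    (k : triple b B Y ∈ 𝔤) (h1 : a - b = c) (h2 : A - B = C) (h3 : X - Y = Z) :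
    triple c C Z ∈ 𝔤 := by
  subst h1 h2 h3
  rw [← triple_sub]
  exact 𝔤.sub_mem h k

theorem triple_smul_mem {a : ℝ} {A : E →L[ℝ] E} {X : E} (h : triple a A X ∈ 𝔤) (t : ℝ) :
    triple (t * a) (t • A) (t • X) ∈ 𝔤 := by
  rw [← triple_smul]
  exact 𝔤.smul_mem t h

theorem triple_zero_mem : triple 0 (0 : E →L[ℝ] E) (0 : E) ∈ 𝔤 := by
  rw [triple_zero]
  exact 𝔤.zero_mem

theorem ConsistsOfTriples.lie_mem (ht : ConsistsOfTriples 𝔤) {a b : ℝ} {A B : E →L[ℝ] E} {X Y : E}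
    (h : triple a A X ∈ 𝔤) (k : triple b B Y ∈ 𝔤) :
    triple 0 ⁅A, B⁆ (a • Y + A Y - (b • X + B X)) ∈ 𝔤 := by
  have := 𝔤.lie_mem h k
  rw [lie_triple (ht.isSkewOp h) (ht.isSkewOp k)] at this
  exact this

/-- The vectors of the translations in `𝔤`. -/
def translationSpace (𝔤 : LieSubalgebra ℝ (Mink E →L[ℝ] Mink E)) : Submodule ℝ E where
  carrier := {X | triple 0 0 X ∈ 𝔤}
  add_mem' hX hY := triple_add_mem hX hY (add_zero 0) (add_zero 0) rfl
  zero_mem' := triple_zero_mem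
  smul_mem' t X hX := by
    have := triple_smul_mem (show triple 0 0 X ∈ 𝔤 from hX) t
    rwa [mul_zero, smul_zero] at this

theorem mem_translationSpace {X : E} : X ∈ translationSpace 𝔤 ↔ triple 0 0 X ∈ 𝔤 := Iff.rfl

/-- The skew-symmetric parts of the elements of `𝔤`. -/
def ConsistsOfTriples.skewPart (ht : ConsistsOfTriples 𝔤) : LieSubalgebra ℝ (E →L[ℝ] E) where
  carrier := {A | ∃ a X, triple a A X ∈ 𝔤}
  add_mem' := by
    rintro A B ⟨a, X, h⟩ ⟨b, Y, k⟩
    exact ⟨a + b, X + Y, triple_add_mem h k rfl rfl rfl⟩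
  zero_mem' := ⟨0, 0, triple_zero_mem⟩
  smul_mem' := by
    rintro t A ⟨a, X, h⟩
    exact ⟨_, _, triple_smul_mem h t⟩
  lie_mem' := by
    rintro A B ⟨a, X, h⟩ ⟨b, Y, k⟩
    exact ⟨_, _, ht.lie_mem h k⟩

theorem ConsistsOfTriples.isSkewOp_of_mem_skewPart (ht : ConsistsOfTriples 𝔤) {A : E →L[ℝ] E}
    (hA : A ∈ ht.skewPart) : IsSkewOp A := by
  obtain ⟨a, X, h⟩ := hA
  exact ht.isSkewOp h

/-- Brackets of triples have no dilation part, so commutant elements occur with `a = 0`. -/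
theorem ConsistsOfTriples.exists_of_mem_commutant (ht : ConsistsOfTriples 𝔤) {C : ht.skewPart}
    (hC : C ∈ commutant ht.skewPart) : ∃ X, triple 0 (C : E →L[ℝ] E) X ∈ 𝔤 := by
  change C ∈ (commutant ht.skewPart).toSubmodule at hC
  rw [commutant_toSubmodule] at hC
  induction hC using Submodule.span_induction with
  | mem x hx =>
    obtain ⟨⟨A, a, X, h⟩, ⟨B, b, Y, k⟩, rfl⟩ := hx
    exact ⟨_, ht.lie_mem h k⟩
  | zero => exact ⟨0, triple_zero_mem⟩
  | add x y _ _ hx hy =>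
    obtain ⟨X, hX⟩ := hx
    obtain ⟨Y, hY⟩ := hy
    exact ⟨X + Y, triple_add_mem hX hY (add_zero 0) rfl rfl⟩
  | smul t x _ hx =>
    obtain ⟨X, hX⟩ := hx
    have := triple_smul_mem hX t
    rw [mul_zero] at this
    exact ⟨_, this⟩

theorem ConsistsOfTriples.apply_mem_translationSpace (ht : ConsistsOfTriples 𝔤) {a : ℝ}
    {A : E →L[ℝ] E} {X Y : E} (h : triple a A X ∈ 𝔤) (hY : Y ∈ translationSpace 𝔤) :
    A Y ∈ translationSpace 𝔤 := by
  have h1 := ht.lie_mem h (mem_translationSpace.1 hY)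
  rw [lie_zero, zero_smul, zero_apply, add_zero, sub_zero] at h1
  have := (translationSpace 𝔤).sub_mem (mem_translationSpace.2 h1)
    ((translationSpace 𝔤).smul_mem a hY)
  simpa using this

theorem type1_of_mem (ht : ConsistsOfTriples 𝔤) (hN : ∀ X, triple 0 0 X ∈ 𝔤)
    (h1 : triple 1 0 0 ∈ 𝔤) : AlgType 𝔤 .type1 := by
  refine ⟨ht.skewPart, fun A hA => ⟨ht.isSkewOp_of_mem_skewPart hA, fun Y hY => ?_⟩,
    fun T => ⟨fun hT => ?_, ?_⟩⟩
  · rw [Submodule.top_orthogonal_eq_bot, Submodule.mem_bot] at hY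
    rw [hY, map_zero]
  · obtain ⟨a, A, X, hA, rfl⟩ := ht T hT
    exact ⟨a, ⟨A, a, X, hT⟩, X, rfl⟩
  · rintro ⟨a, ⟨A, b, Y, h⟩, X, rfl⟩
    refine triple_add_mem (triple_add_mem h (triple_smul_mem h1 (a - b)) rfl rfl rfl)
      (hN (X - Y)) ?_ ?_ ?_ <;> simp

theorem type2_of_forall (ht : ConsistsOfTriples 𝔤) (hN : ∀ X, triple 0 0 X ∈ 𝔤)
    (h0 : ∀ a A X, triple a A X ∈ 𝔤 → a = 0) : AlgType 𝔤 .type2 := by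
  refine ⟨ht.skewPart, fun A hA => ⟨ht.isSkewOp_of_mem_skewPart hA, fun Y hY => ?_⟩,
    fun T => ⟨fun hT => ?_, ?_⟩⟩
  · rw [Submodule.top_orthogonal_eq_bot, Submodule.mem_bot] at hY
    rw [hY, map_zero]
  · obtain ⟨a, A, X, hA, rfl⟩ := ht T hT
    obtain rfl := h0 _ _ _ hT
    exact ⟨⟨A, 0, X, hT⟩, X, rfl⟩
  · rintro ⟨⟨A, b, Y, h⟩, X, rfl⟩
    obtain rfl := h0 _ _ _ h
    refine triple_add_mem h (hN (X - Y)) ?_ ?_ ?_ <;> simp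

variable [FiniteDimensional ℝ E]

/-- Translation parts can be dropped. Since `(1, 0, 0) ∉ 𝔤`, the dilation part is a function `φ` of
the central skew part, and the commutant contributes nothing to it. -/
theorem type3_of_notMem (ht : ConsistsOfTriples 𝔤) (hN : ∀ X, triple 0 0 X ∈ 𝔤)
    (h1 : triple 1 0 0 ∉ 𝔤) (hex : ∃ a A X, triple a A X ∈ 𝔤 ∧ a ≠ 0) : AlgType 𝔤 .type3 := by
  have hX : ∀ a A X, triple a A X ∈ 𝔤 → triple a A 0 ∈ 𝔤 := fun a A X h =>
    triple_sub_mem h (hN X) (sub_zero _) (sub_zero _) (sub_self _)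
  let R : Submodule ℝ (LieAlgebra.center ℝ ht.skewPart × ℝ) :=
    { carrier := {v | triple v.2 ((v.1 : ht.skewPart) : E →L[ℝ] E) 0 ∈ 𝔤}
      add_mem' := fun h k => triple_add_mem h k rfl rfl (add_zero 0)
      zero_mem' := triple_zero_mem
      smul_mem' := fun t v h => by
        have := triple_smul_mem (show triple v.2 ((v.1 : ht.skewPart) : E →L[ℝ] E) 0 ∈ 𝔤 from h) t
        rw [smul_zero] at this
        exact this }
  have hR : ∀ A a, (A, a) ∈ R ↔ triple a ((A : ht.skewPart) : E →L[ℝ] E) 0 ∈ 𝔤 :=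
    fun A a => Iff.rfl
  obtain ⟨φ, hφ⟩ := exists_linearMap_of_graph R
    (fun ⟨⟨A, a, X, h⟩, _⟩ => ⟨a, hX _ _ _ h⟩) (fun a ha => by
      by_contra hne
      have := triple_smul_mem ((hR _ _).1 ha) a⁻¹
      rw [inv_mul_cancel₀ hne] at this
      simp at this
      exact h1 this)
  have hφ' : ∀ (A : LieAlgebra.center ℝ ht.skewPart) a,
      triple a ((A : ht.skewPart) : E →L[ℝ] E) 0 ∈ 𝔤 ↔ a = φ A := hφ
  have hdec : ∀ a A X, triple a A X ∈ 𝔤 → ∃ (C : commutant ht.skewPart)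
      (Z : LieAlgebra.center ℝ ht.skewPart),
      A = ((C : ht.skewPart) : E →L[ℝ] E) + ((Z : ht.skewPart) : E →L[ℝ] E) ∧
      a = φ Z := by
    intro a A X h
    obtain ⟨C, Z, e⟩ := exists_commutant_add_center
      (fun A hA => ht.isSkewOp_of_mem_skewPart hA) (show A ∈ ht.skewPart from ⟨a, X, h⟩)
    obtain ⟨Y, hY⟩ := ht.exists_of_mem_commutant C.2
    refine ⟨C, Z, e, (hφ' Z a).1 ?_⟩
    exact triple_sub_mem (hX _ _ _ h) (hX _ _ _ hY) (sub_zero _) (by rw [e]; abel) (sub_zero 0)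
  refine ⟨ht.skewPart, φ, fun A hA => ⟨ht.isSkewOp_of_mem_skewPart hA, fun Y hY => ?_⟩, ?_,
    fun T => ⟨fun hT => ?_, ?_⟩⟩
  · rw [Submodule.top_orthogonal_eq_bot, Submodule.mem_bot] at hY
    rw [hY, map_zero]
  · rintro rfl
    obtain ⟨a, A, X, h, ha⟩ := hex
    obtain ⟨C, Z, -, e⟩ := hdec a A X h
    exact ha (by simpa using e)
  · obtain ⟨a, A, X, hA, rfl⟩ := ht T hT
    obtain ⟨C, Z, e1, e2⟩ := hdec a A X hT
    refine ⟨C, Z, X, ?_⟩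
    rw [triple_add, triple_add, e1, e2]
    simp
  · rintro ⟨C, Z, X, rfl⟩
    obtain ⟨Y, hY⟩ := ht.exists_of_mem_commutant C.2
    exact 𝔤.add_mem (𝔤.add_mem (hX _ _ _ hY) ((hφ' Z _).2 rfl)) (hN X)

/-- If a weakly irreducible algebra contains an element that is not an infinitesimal isometry, then
it contains all translations. -/
theorem translationSpace_eq_top (hwi : IsWeaklyIrreducibleAlg 𝔤) (ht : ConsistsOfTriples 𝔤)
    (hex : ∃ a A X, triple a A X ∈ 𝔤 ∧ a ≠ 0) : translationSpace 𝔤 = ⊤ := by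
  obtain ⟨a, A, X, hT, ha⟩ := hex
  let K : Submodule ℝ (E →L[ℝ] E) :=
    { carrier := {B | ∃ Y, triple 0 B Y ∈ 𝔤}
      add_mem' := by
        rintro B C ⟨Y, h⟩ ⟨Z, k⟩
        exact ⟨_, triple_add_mem h k (add_zero 0) rfl rfl⟩
      zero_mem' := ⟨0, triple_zero_mem⟩
      smul_mem' := by
        rintro t B ⟨Y, h⟩
        have := triple_smul_mem h t
        rw [mul_zero] at this
        exact ⟨_, this⟩ }
  -- `K` contains all brackets, so removing an element with zero dilation part makes the skew part
  -- of the chosen element central.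
  obtain ⟨k, ⟨Y, hk⟩, -, hz⟩ := exists_central_of_lie_mem (ℬ := ht.skewPart) (K := K)
    (fun A hA => ht.isSkewOp_of_mem_skewPart hA) (fun B ⟨Y, h⟩ => ⟨0, Y, h⟩)
    (fun A ⟨a, X, h⟩ B ⟨b, Y, k⟩ => ⟨_, ht.lie_mem h k⟩) ⟨a, X, hT⟩
  set Z := A - k with hZ
  have hTZ : triple a Z (X - Y) ∈ 𝔤 := triple_sub_mem hT hk (sub_zero a) rfl rfl
  have hZs : IsSkewOp Z := ht.isSkewOp hTZ
  set X' := X - Y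
  let L : E →ₗ[ℝ] E := a • LinearMap.id + (Z : E →ₗ[ℝ] E)
  have hL : ∀ x, L x = a • x + Z x := fun x => rfl
  have hLinj : Function.Injective L := by
    rw [← LinearMap.ker_eq_bot, LinearMap.ker_eq_bot']
    intro x hx
    have h1 : inner ℝ (L x) x = 0 := by rw [hx, inner_zero_left]
    rw [hL, inner_add_left, hZs.inner_self, real_inner_smul_left, add_zero] at h1
    exact inner_self_eq_zero (𝕜 := ℝ) |>.1 ((mul_eq_zero.1 h1).resolve_left ha)
  -- `v` is the zero of the field `x ↦ L x + X'`; `L = a + Z` is invertible because `⟨Lx, x⟩ =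
  -- a|x|²`.
  obtain ⟨v, hv⟩ := LinearMap.surjective_of_injective hLinj (-X')
  have hLW : ∀ x ∈ translationSpace 𝔤, L x ∈ translationSpace 𝔤 := fun x hx =>
    (translationSpace 𝔤).add_mem ((translationSpace 𝔤).smul_mem a hx)
      (ht.apply_mem_translationSpace hTZ hx)
  have hLW' : ∀ x, L x ∈ translationSpace 𝔤 → x ∈ translationSpace 𝔤 := by
    intro x hx
    have hinj : Function.Injective (L.restrict hLW) := fun y z e =>
      Subtype.ext (hLinj (congrArg Subtype.val e))
    obtain ⟨y, hy⟩ := LinearMap.surjective_of_injective hinj ⟨L x, hx⟩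
    rw [← hLinj (congrArg Subtype.val hy)]
    exact y.2
  -- The affine subspace through `v` directed by the translations is invariant: as `Z` commutes with
  -- `B`, the bracket with `(b, B, Y')` is the translation by `L (bv + Bv + Y')`, and `L` can be
  -- cancelled.
  refine eq_top_of_invariant_affine hwi ht v _ fun b B Y' hB h =>
    ⟨fun s hs => ht.apply_mem_translationSpace h hs, hLW' _ ?_⟩
  have hcomm : ⁅Z, B⁆ = 0 := by
    rw [← lie_skew, hz B ⟨b, Y', h⟩, neg_zero]
  have h1 := ht.lie_mem hTZ h
  rw [hcomm] at h1
  have hZB : Z (B v) = B (Z v) := by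
    have := congrArg (fun T : E →L[ℝ] E => T v) hcomm
    simpa [LieRing.of_associative_ring_bracket, sub_eq_zero] using this
  refine mem_translationSpace.2 ?_
  convert h1 using 2
  have hX' : X' = -(a • v + Z v) := by rw [← hL, hv, neg_neg]
  rw [hX', hL]
  simp only [map_add, map_smul, map_neg, hZB]
  module

/-- The `Wᗮ`-part of the translation vector is a cocycle `c` on the skew parts. Weak irreducibility,
used on two invariant affine subspaces, shows that the skew parts kill `Wᗮ` and that `c` maps onto
`Wᗮ`; then `c` vanishes on brackets and its restriction to the centre is `ψ`. -/
theorem type4_of_forall [Nontrivial E] (hwi : IsWeaklyIrreducibleAlg 𝔤)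
    (ht : ConsistsOfTriples 𝔤) (h0 : ∀ a A X, triple a A X ∈ 𝔤 → a = 0)
    (hW : translationSpace 𝔤 ≠ ⊤) : AlgType 𝔤 .type4 := by
  set W := translationSpace 𝔤 with hWdef
  have hsk : ∀ A ∈ ht.skewPart, IsSkewOp A := fun A hA => ht.isSkewOp_of_mem_skewPart hA
  have hBW : ∀ A ∈ ht.skewPart, ∀ x ∈ W, A x ∈ W := fun A ⟨a, X, h⟩ x hx =>
    ht.apply_mem_translationSpace h hx
  have hBU : ∀ A ∈ ht.skewPart, ∀ x ∈ Wᗮ, A x ∈ Wᗮ := fun A hA x hx =>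
    (hsk A hA).mem_orthogonal (hBW A hA) hx
  have hdisj : ∀ x, x ∈ W → x ∈ Wᗮ → x = 0 := fun x h k =>
    inner_self_eq_zero (𝕜 := ℝ) |>.1 (k x h)
  -- The relation is a graph: two candidates in `Wᗮ` for the same skew part differ by a translation
  -- in 𝔤, thus by a vector of `W ∩ Wᗮ`.
  let R : Submodule ℝ (ht.skewPart × E) :=
    { carrier := {v | v.2 ∈ Wᗮ ∧ triple 0 (v.1 : E →L[ℝ] E) v.2 ∈ 𝔤}
      add_mem' := fun h k =>
        ⟨Wᗮ.add_mem h.1 k.1, triple_add_mem h.2 k.2 (add_zero 0) rfl rfl⟩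
      zero_mem' := ⟨Wᗮ.zero_mem, triple_zero_mem⟩
      smul_mem' := fun t v h => by
        have := triple_smul_mem h.2 t
        rw [mul_zero] at this
        exact ⟨Wᗮ.smul_mem t h.1, this⟩ }
  obtain ⟨c, hc⟩ := exists_linearMap_of_graph R (by
      rintro ⟨A, a, X, h⟩
      obtain rfl := h0 _ _ _ h
      obtain ⟨w, hw, u, hu, e⟩ := W.exists_add_mem_mem_orthogonal X
      exact ⟨u, hu, triple_sub_mem h (mem_translationSpace.1 hw) (sub_zero 0) (sub_zero _)
        (sub_eq_iff_eq_add'.2 e)⟩)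
    (fun y hy => hdisj y hy.2 hy.1)
  have hcR : ∀ (A : ht.skewPart) u, (u ∈ Wᗮ ∧ triple 0 (A : E →L[ℝ] E) u ∈ 𝔤) ↔ u = c A := hc
  have hcU : ∀ A, c A ∈ Wᗮ := fun A => ((hcR A _).2 rfl).1
  have hcg : ∀ A : ht.skewPart, triple 0 (A : E →L[ℝ] E) (c A) ∈ 𝔤 := fun A => ((hcR A _).2 rfl).2
  have hcY : ∀ (A : ht.skewPart) X, triple 0 (A : E →L[ℝ] E) X ∈ 𝔤 → X - c A ∈ W := fun A X h =>
    triple_sub_mem h (hcg A) (sub_zero 0) (sub_self _) rfl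
  have hcoc : ∀ A B : ht.skewPart,
      c ⁅A, B⁆ = (A : E →L[ℝ] E) (c B) - (B : E →L[ℝ] E) (c A) := by
    intro A B
    refine ((hcR _ _).1 ⟨Wᗮ.sub_mem (hBU _ A.2 _ (hcU B)) (hBU _ B.2 _ (hcU A)), ?_⟩).symm
    have := ht.lie_mem (hcg A) (hcg B)
    simpa using this
  obtain ⟨u₀, hu₀⟩ := exists_coboundary hsk c hcoc
  let I : Submodule ℝ E :=
    { carrier := {x | ∀ A : ht.skewPart, (A : E →L[ℝ] E) x = 0}
      add_mem' := fun h k A => by simp [h A, k A]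
      zero_mem' := fun A => by simp
      smul_mem' := fun t x h A => by simp [h A] }
  -- Since `c A - A u₀` lies in the common kernel `I`, the affine subspace `-u₀ + (I ⊔ W)` is
  -- invariant.
  have hIW : I ⊔ W = ⊤ := by
    refine eq_top_of_invariant_affine hwi ht (-u₀) _ fun a A X hA h => ⟨fun s hs => ?_, ?_⟩
    · obtain ⟨i, hi, w, hw, rfl⟩ := Submodule.mem_sup.1 hs
      rw [map_add, hi ⟨A, a, X, h⟩, zero_add]
      exact Submodule.mem_sup_right (hBW A ⟨a, X, h⟩ w hw)
    · obtain rfl := h0 _ _ _ h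
      let A' : ht.skewPart := ⟨A, 0, X, h⟩
      refine Submodule.mem_sup.2 ⟨c A' - A u₀, fun B => hu₀ A' B, X - c A', hcY A' X h, ?_⟩
      rw [map_neg, zero_smul]
      abel
  have hUI : ∀ u ∈ Wᗮ, ∀ A : ht.skewPart, (A : E →L[ℝ] E) u = 0 := by
    intro u hu A
    have h1 : u ∈ I ⊔ W := hIW ▸ Submodule.mem_top
    obtain ⟨i, hi, w, hw, e⟩ := Submodule.mem_sup.1 h1
    refine hdisj _ ?_ (hBU A A.2 u hu)
    rw [← e, map_add, hi A, zero_add]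
    exact hBW A A.2 w hw
  have hcW : LinearMap.range c ⊔ W = ⊤ := by
    refine eq_top_of_invariant_affine hwi ht 0 _ fun a A X hA h => ⟨fun s hs => ?_, ?_⟩
    · obtain ⟨_, ⟨B, rfl⟩, w, hw, rfl⟩ := Submodule.mem_sup.1 hs
      have := hUI _ (hcU B) ⟨A, a, X, h⟩
      dsimp only at this
      rw [map_add, this, zero_add]
      exact Submodule.mem_sup_right (hBW A ⟨a, X, h⟩ w hw)
    · obtain rfl := h0 _ _ _ h
      let A' : ht.skewPart := ⟨A, 0, X, h⟩
      refine Submodule.mem_sup.2 ⟨c A', LinearMap.mem_range_self c A', X - c A', hcY A' X h, ?_⟩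
      simp
  have hcs : ∀ u ∈ Wᗮ, ∃ A, c A = u := by
    intro u hu
    have h1 : u ∈ LinearMap.range c ⊔ W := hcW ▸ Submodule.mem_top
    obtain ⟨_, ⟨B, rfl⟩, w, hw, e⟩ := Submodule.mem_sup.1 h1
    refine ⟨B, ?_⟩
    have h2 : u - c B = w := by rw [← e]; abel
    exact (sub_eq_zero.1 (hdisj _ (h2 ▸ hw) (Wᗮ.sub_mem hu (hcU B)))).symm
  have hcC : ∀ C ∈ commutant ht.skewPart, c C = 0 := by
    intro C hC
    change C ∈ (commutant ht.skewPart).toSubmodule at hC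
    rw [commutant_toSubmodule] at hC
    have : Submodule.span ℝ {x : ht.skewPart | ∃ A B : ht.skewPart, ⁅A, B⁆ = x} ≤
        LinearMap.ker c := by
      rw [Submodule.span_le]
      rintro _ ⟨A, B, rfl⟩
      change c ⁅A, B⁆ = 0
      rw [hcoc, hUI _ (hcU B), hUI _ (hcU A), sub_zero]
    exact this hC
  have hdec : ∀ A : ht.skewPart, ∃ (C : commutant ht.skewPart)
      (Z : LieAlgebra.center ℝ ht.skewPart),
      (A : E →L[ℝ] E) = ((C : ht.skewPart) : E →L[ℝ] E) + ((Z : ht.skewPart) : E →L[ℝ] E) ∧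
      c A = c Z := by
    intro A
    obtain ⟨C, Z, e⟩ := exists_commutant_add_center hsk A.2
    have e' : A = (C : ht.skewPart) + (Z : ht.skewPart) := Subtype.ext e
    refine ⟨C, Z, e, ?_⟩
    conv_lhs => rw [e', map_add, hcC C C.2, zero_add]
  have hWW : Wᗮᗮ = W := Submodule.orthogonal_orthogonal W
  refine ⟨Wᗮ, ht.skewPart,
    (c ∘ₗ (LieAlgebra.center ℝ ht.skewPart).toSubmodule.subtype).codRestrict Wᗮ fun A => hcU _,
    ?_, ?_, fun A hA => ⟨hsk A hA, fun Y hY => ?_⟩, ?_, fun T => ⟨fun hT => ?_, ?_⟩⟩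
  · intro h
    rw [Submodule.orthogonal_eq_bot_iff] at h
    exact hW h
  · rw [hWW]
    intro h
    -- With `W = 0` every skew part would kill `E`, so `c` would be zero although it maps onto `Wᗮ =
    -- E`.
    have hU : Wᗮ = ⊤ := by rw [h, Submodule.bot_orthogonal_eq_top]
    obtain ⟨y, hy⟩ := exists_ne (0 : E)
    obtain ⟨A, hA⟩ := hcs y (hU ▸ Submodule.mem_top)
    have hA0 : A = 0 := Subtype.ext (ContinuousLinearMap.ext fun x =>
      hUI x (hU ▸ Submodule.mem_top) A)
    rw [hA0, map_zero] at hA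
    exact hy hA.symm
  · rw [hWW] at hY
    exact hUI Y hY ⟨A, hA⟩
  · rintro ⟨u, hu⟩
    obtain ⟨A, hA⟩ := hcs u hu
    obtain ⟨C, Z, -, e⟩ := hdec A
    exact ⟨Z, Subtype.ext (e.symm.trans hA)⟩
  · obtain ⟨a, A, X, hA, rfl⟩ := ht T hT
    obtain rfl := h0 _ _ _ hT
    let A' : ht.skewPart := ⟨A, 0, X, hT⟩
    obtain ⟨C, Z, e1, e2⟩ := hdec A'
    refine ⟨C, Z, ⟨X - c A', hWW.symm ▸ hcY A' X hT⟩, ?_⟩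
    rw [triple_add, triple_add]
    change triple 0 (A' : E →L[ℝ] E) X = triple (0 + 0 + 0)
      (((C : ht.skewPart) : E →L[ℝ] E) + ((Z : ht.skewPart) : E →L[ℝ] E) + 0)
      (0 + c Z + (X - c A'))
    rw [← e1, ← e2]
    simp
  · rintro ⟨C, Z, ⟨X, hX⟩, rfl⟩
    rw [hWW] at hX
    refine 𝔤.add_mem (𝔤.add_mem ?_ (hcg Z)) hX
    have := hcg C
    rwa [hcC C C.2] at this

/-- The Bérard Bergery–Ikemakhen classification. -/
theorem exists_algType [Nontrivial E] (hwi : IsWeaklyIrreducibleAlg 𝔤)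
    (ht : ConsistsOfTriples 𝔤) : ∃ i, AlgType 𝔤 i := by
  have hN : translationSpace 𝔤 = ⊤ → ∀ X, triple 0 0 X ∈ 𝔤 := fun h X =>
    mem_translationSpace.1 (h ▸ Submodule.mem_top)
  by_cases hex : ∃ a A X, triple a A X ∈ 𝔤 ∧ a ≠ 0
  · have hW := translationSpace_eq_top hwi ht hex
    by_cases h1 : triple 1 0 0 ∈ 𝔤
    · exact ⟨_, type1_of_mem ht (hN hW) h1⟩
    · exact ⟨_, type3_of_notMem ht (hN hW) h1 hex⟩
  · push Not at hex
    by_cases hW : translationSpace 𝔤 = ⊤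
    · exact ⟨_, type2_of_forall ht (hN hW) hex⟩
    · exact ⟨_, type4_of_forall hwi ht hex hW⟩

end Classification

/-! ### Invariants that distinguish the four types -/

section Invariants

variable {E : Type*} [NormedAddCommGroup E] [InnerProductSpace ℝ E]

/-- Conditions on `𝔤` that distinguish the four types. -/
def TypeCondition (𝔤 : LieSubalgebra ℝ (Mink E →L[ℝ] Mink E)) : FourTypes → Prop
  | .type1 => triple 1 0 0 ∈ 𝔤
  | .type2 => (∀ a A X, triple a A X ∈ 𝔤 → a = 0) ∧ ∀ X, triple 0 0 X ∈ 𝔤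
  | .type3 => (∃ a A X, triple a A X ∈ 𝔤 ∧ a ≠ 0) ∧ triple 1 0 0 ∉ 𝔤
  | .type4 => (∀ a A X, triple a A X ∈ 𝔤 → a = 0) ∧ ¬ ∀ X, triple 0 0 X ∈ 𝔤

variable {𝔤 : LieSubalgebra ℝ (Mink E →L[ℝ] Mink E)}

theorem TypeCondition.unique {i j : FourTypes} (hi : TypeCondition 𝔤 i)
    (hj : TypeCondition 𝔤 j) : i = j := by
  have h10 : triple 1 0 0 ∈ 𝔤 → ¬ ∀ a A X, triple a A X ∈ 𝔤 → a = 0 := fun h k =>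
    one_ne_zero (k _ _ _ h)
  have hex : (∃ a A X, triple a A X ∈ 𝔤 ∧ a ≠ 0) → ¬ ∀ a A X, triple a A X ∈ 𝔤 → a = 0 := by
    rintro ⟨a, A, X, h, ha⟩ k
    exact ha (k _ _ _ h)
  cases i <;> cases j <;> simp only [TypeCondition] at hi hj <;> first | rfl | (exfalso; tauto)

variable [FiniteDimensional ℝ E]

/-- In types 3 and 4 a forbidden pure dilation, or a pure translation along `U`, would have skew
part `C + Z = 0` with `C` in the commutant and `Z` central. Then `Z = 0`, so its image under `φ` or
`ψ` vanishes. -/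
theorem AlgType.typeCondition {i : FourTypes} (h : AlgType 𝔤 i) : TypeCondition 𝔤 i := by
  cases i with
  | type1 =>
    obtain ⟨ℬ, -, h⟩ := h
    exact (h _).2 ⟨1, 0, 0, rfl⟩
  | type2 =>
    obtain ⟨ℬ, -, h⟩ := h
    refine ⟨fun a A X hT => ?_, fun X => (h _).2 ⟨0, X, rfl⟩⟩
    obtain ⟨B, Y, e⟩ := (h _).1 hT
    exact (triple_injective e).1
  | type3 =>
    obtain ⟨ℬ, φ, hℬ, hφ, h⟩ := h
    refine ⟨?_, fun hT => ?_⟩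
    · by_contra! hcon
      refine hφ (LinearMap.ext fun Z => hcon (φ Z) ((Z : ℬ) : E →L[ℝ] E) 0 ((h _).2 ⟨0, Z, 0, ?_⟩))
      rw [triple_add, triple_add]
      simp
    · obtain ⟨C, Z, X, e⟩ := (h _).1 hT
      rw [triple_add, triple_add] at e
      obtain ⟨e1, e2, -⟩ := triple_injective e
      have hZC : (Z : ℬ) = -(C : ℬ) := by
        refine Subtype.ext ?_
        have := e2.symm
        rw [add_zero, add_comm] at this
        exact eq_neg_of_add_eq_zero_left this
      have hZ0 : (Z : ℬ) = 0 := eq_zero_of_commutant_of_center (fun A hA => (hℬ A hA).1)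
        (by rw [hZC]; exact neg_mem C.2) Z.2
      have hZ : Z = 0 := Subtype.ext hZ0
      rw [hZ] at e1
      simp at e1
  | type4 =>
    obtain ⟨U, ℬ, ψ, hU, -, hℬ, hψ, h⟩ := h
    refine ⟨fun a A X hT => ?_, fun hN => ?_⟩
    · obtain ⟨C, Z, Y, e⟩ := (h _).1 hT
      rw [triple_add, triple_add] at e
      simpa using (triple_injective e).1
    · obtain ⟨u, hu, hu0⟩ := U.ne_bot_iff.1 hU
      obtain ⟨C, Z, X, e⟩ := (h _).1 (hN u)
      rw [triple_add, triple_add] at e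
      obtain ⟨-, e2, e3⟩ := triple_injective e
      have hZC : (Z : ℬ) = -(C : ℬ) := by
        refine Subtype.ext ?_
        have := e2.symm
        rw [add_zero, add_comm] at this
        exact eq_neg_of_add_eq_zero_left this
      have hZ0 : (Z : ℬ) = 0 := eq_zero_of_commutant_of_center (fun A hA => (hℬ A hA).1)
        (by rw [hZC]; exact neg_mem C.2) Z.2
      have hZ : Z = 0 := Subtype.ext hZ0
      rw [hZ, map_zero, ZeroMemClass.coe_zero, add_zero, zero_add] at e3
      refine hu0 (inner_self_eq_zero (𝕜 := ℝ) |>.1 ?_)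
      have := X.2 u hu
      rwa [← e3] at this

end Invariants

/-! ### Groups of similarities of the four types -/

section SimGroups

theorem Subgroup.exists_mul_of_mem_sup {S : Type*} [Group S] {K N : Subgroup S}
    (h : ∀ k ∈ K, ∀ n ∈ N, k * n * k⁻¹ ∈ N) {x : S} (hx : x ∈ K ⊔ N) :
    ∃ k ∈ K, ∃ n ∈ N, x = k * n := by
  have h' : ∀ k ∈ K, ∀ n ∈ N, k⁻¹ * n * k ∈ N := fun k hk n hn => by
    simpa using h k⁻¹ (K.inv_mem hk) n hn
  rw [Subgroup.sup_eq_closure] at hx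
  induction hx using Subgroup.closure_induction with
  | mem x hx =>
    rcases hx with hx | hx
    · exact ⟨x, hx, 1, N.one_mem, by simp⟩
    · exact ⟨1, K.one_mem, x, hx, by simp⟩
  | one => exact ⟨1, K.one_mem, 1, N.one_mem, by simp⟩
  | mul x y _ _ hx hy =>
    obtain ⟨k, hk, n, hn, rfl⟩ := hx
    obtain ⟨l, hl, m, hm, rfl⟩ := hy
    exact ⟨k * l, K.mul_mem hk hl, l⁻¹ * n * l * m, N.mul_mem (h' l hl n hn) hm, by group⟩
  | inv x _ hx =>
    obtain ⟨k, hk, n, hn, rfl⟩ := hx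
    exact ⟨k⁻¹, K.inv_mem hk, k * n⁻¹ * k⁻¹, h k hk _ (N.inv_mem hn), by group⟩

theorem Subgroup.exists_mul_of_commute {S : Type*} [Group S] {K N : Subgroup S}
    (h : ∀ k ∈ K, ∀ n ∈ N, k * n = n * k) {x : S} (hx : x ∈ K ⊔ N) :
    ∃ k ∈ K, ∃ n ∈ N, x = k * n :=
  exists_mul_of_mem_sup (fun k hk n hn => by rw [h k hk n hn, mul_inv_cancel_right]; exact hn) hx

theorem Sim.ratio_eq {E : Type*} [NormedAddCommGroup E] [Nontrivial E] {f : E ≃ᵈ E}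
    {r : ℝ} (h : ∀ x, ‖f x - f 0‖ = r * ‖x‖) :
    (Dilation.ratio f : ℝ) = r := by
  obtain ⟨y, hy⟩ := exists_ne (0 : E)
  have h1 := Sim.norm_sub f y 0
  rw [h, sub_zero] at h1
  exact (mul_right_cancel₀ (norm_ne_zero_iff.2 hy) h1).symm

theorem Sim.inv_apply_eq {E : Type*} [NormedAddCommGroup E] {f : E ≃ᵈ E} {x y : E}
    (h : f x = y) : f⁻¹ y = x := by
  rw [← h]
  exact f.symm_apply_apply x

variable {E : Type*} [NormedAddCommGroup E] [InnerProductSpace ℝ E]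

/-- The similarity `x ↦ r R x + v`. -/
noncomputable def Sim.ofLinear (r : ℝ) (hr : 0 < r) (R : E ≃ₗᵢ[ℝ] E) (v : E) : Sim E where
  toFun x := r • R x + v
  invFun x := R.symm (r⁻¹ • (x - v))
  left_inv x := by simp [smul_smul, hr.ne']
  right_inv x := by simp [smul_smul, hr.ne']
  edist_eq' := by
    refine ⟨⟨r, hr.le⟩, fun h => hr.ne' (congrArg NNReal.toReal h), fun x y => ?_⟩
    rw [edist_add_right, edist_smul₀, R.edist_map]
    congr 1
    ext
    simp [abs_of_pos hr]
    rfl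

theorem Sim.ofLinear_apply (r : ℝ) (hr : 0 < r) (R : E ≃ₗᵢ[ℝ] E) (v x : E) :
    Sim.ofLinear r hr R v x = r • R x + v := rfl

theorem ratio_eq_one_of_linearRotations [Nontrivial E] {f : Sim E} (hf : f ∈ linearRotations E) :
    (Dilation.ratio f : ℝ) = 1 := by
  obtain ⟨R, -, h⟩ := hf
  refine Sim.ratio_eq fun x => ?_
  rw [h, h, map_zero, sub_zero, one_mul, R.norm_map]

theorem ratio_eq_one_of_translations [Nontrivial E] {W : Submodule ℝ E} {f : Sim E}
    (hf : f ∈ translations W) : (Dilation.ratio f : ℝ) = 1 := by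
  obtain ⟨w, -, h⟩ := hf
  refine Sim.ratio_eq fun x => ?_
  rw [h, h, one_mul]
  simp

theorem ratio_eq_one_of_screwIsometries [Nontrivial E] {U : Submodule ℝ E}
    {Ψ : Multiplicative U →* rotations Uᗮ} {f : Sim E} (hf : f ∈ screwIsometries U Ψ) :
    (Dilation.ratio f : ℝ) = 1 := by
  obtain ⟨u, h⟩ := hf
  refine Sim.ratio_eq fun x => ?_
  rw [h, h, ← map_sub, LinearIsometryEquiv.norm_map, one_mul]
  simp

/-- The group of the isometries of `E`. -/
noncomputable def simIsometries (E : Type*) [NormedAddCommGroup E] [InnerProductSpace ℝ E] :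
    Subgroup (Sim E) :=
  (DilationEquiv.ratioHom : Sim E →* NNReal).ker

theorem mem_simIsometries {f : Sim E} : f ∈ simIsometries E ↔ (Dilation.ratio f : ℝ) = 1 := by
  rw [NNReal.coe_eq_one]
  rfl

theorem SimType.actsTransitively {G : Subgroup (Sim E)} [FiniteDimensional ℝ E] {i : FourTypes}
    (h : SimType G i) : ActsTransitively G := by
  have key : translations ⊤ ≤ G → ActsTransitively G := by
    intro hG x y
    refine ⟨Sim.ofLinear 1 one_pos 1 (y - x), hG ⟨y - x, Submodule.mem_top, fun z => ?_⟩, ?_⟩ <;>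
    simp [Sim.ofLinear_apply]
  cases i with
  | type1 =>
    obtain ⟨H, K, -, -, -, h⟩ := h
    exact key (h.2.2 ▸ le_sup_right)
  | type2 =>
    obtain ⟨H, -, -, h⟩ := h
    exact key (h.2.2 ▸ le_sup_right)
  | type3 =>
    obtain ⟨H, K, Φ, -, -, -, -, h, -⟩ := h
    exact key (h.2.2 ▸ le_sup_right)
  | type4 =>
    obtain ⟨H, K, U, Ψ, -, -, -, h1, h2, -⟩ := h
    intro x y
    obtain ⟨u, hu, w, hw, e⟩ := U.exists_add_mem_mem_orthogonal (y - x)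
    let R : rotations Uᗮ := Ψ (Multiplicative.ofAdd ⟨u, hu⟩)
    have hRu : ∀ u' ∈ U, (R : E ≃ₗᵢ[ℝ] E) u' = u' := fun u' hu' =>
      R.2.2 u' (Submodule.le_orthogonal_orthogonal U hu')
    have hRx : (R : E ≃ₗᵢ[ℝ] E) x - x ∈ Uᗮ := by
      intro u' hu'
      rw [inner_sub_right]
      conv_lhs => rw [← hRu u' hu']
      rw [LinearIsometryEquiv.inner_map_map, hRu u' hu', sub_self]
    -- After the screw motion by the `U`-part of `y - x`, the remaining displacement lies in `Uᗮ`,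
    -- because a rotation fixing `U` moves points only in directions of `Uᗮ`.
    have hw' : y - (R : E ≃ₗᵢ[ℝ] E) (x + u) ∈ Uᗮ := by
      have : y - (R : E ≃ₗᵢ[ℝ] E) (x + u) = w - ((R : E ≃ₗᵢ[ℝ] E) x - x) := by
        rw [map_add, hRu u hu]
        have : y = x + u + w := by rw [add_assoc, ← e]; abel
        rw [this]
        abel
      rw [this]
      exact Uᗮ.sub_mem hw hRx
    have hs : Sim.ofLinear 1 one_pos (R : E ≃ₗᵢ[ℝ] E) ((R : E ≃ₗᵢ[ℝ] E) u) ∈ screwIsometries U Ψ :=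
      ⟨⟨u, hu⟩, fun z => by rw [Sim.ofLinear_apply, one_smul, ← map_add]⟩
    have ht : Sim.ofLinear 1 one_pos 1 (y - (R : E ≃ₗᵢ[ℝ] E) (x + u)) ∈ translations Uᗮ :=
      ⟨_, hw', fun z => by simp [Sim.ofLinear_apply]⟩
    refine ⟨_, G.mul_mem ((h2.2.2 ▸ le_sup_right : translations Uᗮ ≤ G) ht)
      ((h2.2.2 ▸ le_sup_left : K ≤ G) ((h1.2.2 ▸ le_sup_right : screwIsometries U Ψ ≤ K) hs)), ?_⟩
    simp [Sim.ofLinear_apply]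

/-- `𝔤` is the Lie algebra of `G`: it consists of triples, the elements of `𝔤` are those whose
one-parameter groups lie in `G`, and these one-parameter groups generate `G`. -/
structure IsLieAlgebraOf (𝔤 : LieSubalgebra ℝ (Mink E →L[ℝ] Mink E)) (G : Subgroup (Sim E)) :
    Prop where
  triples : ConsistsOfTriples 𝔤
  mem_iff : ∀ (a : ℝ) (A : E →L[ℝ] E) (X : E), IsSkewOp A → (triple a A X ∈ 𝔤 ↔
    ∀ t : ℝ, ∃ f ∈ G, ∀ x, opExp (affineField (t • (a • 1 + A)) (t • X)) (x, 1) = (f x, 1))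
  le_of_exp_mem : ∀ K : Subgroup (Sim E), (∀ a A X, IsSkewOp A → triple a A X ∈ 𝔤 →
    ∃ f ∈ K, ∀ x, opExp (affineField (a • 1 + A) X) (x, 1) = (f x, 1)) → G ≤ K

variable [FiniteDimensional ℝ E] {𝔤 : LieSubalgebra ℝ (Mink E →L[ℝ] Mink E)}
  {G : Subgroup (Sim E)}

theorem lorentzAlgebra_isLieAlgebraOf [Nontrivial E]
    {𝔥 : LieSubalgebra ℝ ((E × ℝ) →L[ℝ] (E × ℝ))}
    (h : IsConnectedLieSubgroupWith (homogeneous G) 𝔥) :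
    IsLieAlgebraOf (lorentzAlgebra h.lie_eq) G where
  triples := fun T hT => exists_triple_of_mem_lieSet hT
  mem_iff := by
    have := FiniteDimensional.complete ℝ E
    intro a A X hA
    rw [mem_lorentzAlgebra_iff, triple_mem_lieSet_iff hA, affineField_mem_lieSet_iff]
  le_of_exp_mem := by
    intro K hK f hf
    have hle : homogeneous G ≤ homogeneous K := by
      rw [h.generates, Subgroup.closure_le]
      rintro M ⟨T, hT, e⟩
      have hT' := (mem_lieSet_iff_of_coe_eq h.lie_eq T).2 hT
      obtain ⟨a, A, X, hA, rfl⟩ := exists_of_mem_lieSet_homogeneous hT'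
      obtain ⟨f, hf, hfx⟩ := hK a A X hA ((triple_mem_lieSet_iff hA).2 hT')
      refine ⟨f, hf, fun x => ?_⟩
      rw [e]
      exact hfx x
    obtain ⟨M, hM⟩ := f.exists_homogeneous
    obtain ⟨g, hg, hMg⟩ := hle ⟨f, hf, hM⟩
    have : f = g := DilationEquiv.ext fun x => by
      have := hMg x
      rw [hM] at this
      exact congrArg Prod.fst this
    rwa [this]

/-- The translation part is left as the image of the origin; it only has to lie in a suitable
subspace and is never computed. -/
theorem exp_similarity_apply (a : ℝ) (A : E →L[ℝ] E) (X x : E) :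
    opExp (affineField (a • 1 + A) X) (x, 1) =
      (Real.exp a • opExp A x + (opExp (affineField (a • 1 + A) X) (0, 1)).1, 1) := by
  have := FiniteDimensional.complete ℝ E
  rw [exp_affineField_apply, exp_smul_one_add, smul_apply]

theorem exp_linear_apply (a : ℝ) (A : E →L[ℝ] E) (x : E) :
    opExp (affineField (a • 1 + A) 0) (x, 1) = (Real.exp a • opExp A x, 1) := by
  have := FiniteDimensional.complete ℝ E
  have h0 : opExp (affineField (a • 1 + A) 0) ((0, 1) : E × ℝ) = (0, 1) :=
    exp_apply_of_apply_eq_zero (by simp)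
  rw [exp_similarity_apply, h0, add_zero]

theorem ratio_of_exp [Nontrivial E] {a : ℝ} {A : E →L[ℝ] E} {X : E} (hA : IsSkewOp A) {f : Sim E}
    (h : ∀ x, opExp (affineField (a • 1 + A) X) (x, 1) = (f x, 1)) :
    (Dilation.ratio f : ℝ) = Real.exp a := by
  refine Sim.ratio_eq fun x => ?_
  have hx := congrArg Prod.fst (h x)
  have h0 := congrArg Prod.fst (h 0)
  rw [exp_similarity_apply] at hx h0
  dsimp only at hx h0
  rw [← hx, ← h0]
  simp [norm_smul, norm_exp_skew hA]

/-! ### Properties of the algebra read off from the group. -/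

namespace IsLieAlgebraOf

theorem forall_eq_zero_iff [Nontrivial E] (h : IsLieAlgebraOf 𝔤 G) :
    (∀ a A X, triple a A X ∈ 𝔤 → a = 0) ↔ G ≤ simIsometries E := by
  constructor
  · intro h0
    refine h.le_of_exp_mem _ fun a A X hA hT => ?_
    obtain ⟨f, -, hf⟩ := (h.mem_iff a A X hA).1 hT 1
    simp only [one_smul] at hf
    refine ⟨f, mem_simIsometries.2 ?_, hf⟩
    rw [ratio_of_exp hA hf, h0 _ _ _ hT, Real.exp_zero]
  · intro hG a A X hT
    have hA := h.triples.isSkewOp hT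
    obtain ⟨f, hfG, hf⟩ := (h.mem_iff a A X hA).1 hT 1
    simp only [one_smul] at hf
    have := mem_simIsometries.1 (hG hfG)
    rwa [ratio_of_exp hA hf, Real.exp_eq_one_iff] at this

theorem translation_mem_iff (h : IsLieAlgebraOf 𝔤 G) (W : Submodule ℝ E) :
    (∀ X ∈ W, triple 0 0 X ∈ 𝔤) ↔ translations W ≤ G := by
  have := FiniteDimensional.complete ℝ E
  constructor
  · rintro hN f ⟨w, hw, hf⟩
    obtain ⟨g, hg, e⟩ := (h.mem_iff 0 0 w IsSkewOp.zero).1 (hN w hw) 1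
    have : f = g := DilationEquiv.ext fun x => by
      have := e x
      rw [zero_smul, add_zero, one_smul, one_smul, exp_translationField] at this
      rw [hf]
      exact congrArg Prod.fst this
    rwa [this]
  · intro hG X hX
    refine (h.mem_iff 0 0 X IsSkewOp.zero).2 fun t =>
      ⟨Sim.ofLinear 1 one_pos 1 (t • X), hG ⟨t • X, W.smul_mem t hX, fun x => ?_⟩, fun x => ?_⟩
    · simp [Sim.ofLinear_apply]
    · rw [zero_smul, add_zero, smul_zero, exp_translationField]
      simp [Sim.ofLinear_apply]

theorem mem_iff_linear (h : IsLieAlgebraOf 𝔤 G) {a : ℝ} {A : E →L[ℝ] E} (hA : IsSkewOp A) :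
    triple a A 0 ∈ 𝔤 ↔ ∀ t : ℝ, ∃ f ∈ G, ∀ x, Real.exp (t * a) • opExp (t • A) x = f x := by
  rw [h.mem_iff a A 0 hA]
  refine forall_congr' fun t => exists_congr fun f => and_congr_right fun _ =>
    forall_congr' fun x => ?_
  rw [smul_add, smul_smul, smul_zero, exp_linear_apply, Prod.mk.injEq, and_iff_left rfl]

theorem typeCondition_of_simType [Nontrivial E] (h : IsLieAlgebraOf 𝔤 G) {i : FourTypes}
    (hi : SimType G i) : TypeCondition 𝔤 i := by
  have hrot : linearRotations E ≤ simIsometries E := fun f hf =>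
    mem_simIsometries.2 (ratio_eq_one_of_linearRotations hf)
  have htra : ∀ W : Submodule ℝ E, translations W ≤ simIsometries E := fun W f hf =>
    mem_simIsometries.2 (ratio_eq_one_of_translations hf)
  cases i with
  | type1 =>
    obtain ⟨H, K, -, -, hK, hG⟩ := hi
    refine (h.mem_iff_linear IsSkewOp.zero).2 fun t =>
      ⟨Sim.ofLinear (Real.exp t) (Real.exp_pos t) 1 0, ?_, fun x => ?_⟩
    · refine (hG.2.2 ▸ le_sup_left : K ≤ G) ((hK.2.2 ▸ le_sup_left : dilations E ≤ K) ?_)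
      exact ⟨⟨Real.exp t, Real.exp_pos t⟩, fun x => by simp [Sim.ofLinear_apply]⟩
    · simp [Sim.ofLinear_apply]
  | type2 =>
    obtain ⟨H, hH, -, hG⟩ := hi
    refine ⟨h.forall_eq_zero_iff.2 ?_, fun X => (h.translation_mem_iff ⊤).2
      (hG.2.2 ▸ le_sup_right) X Submodule.mem_top⟩
    rw [← hG.2.2]
    exact sup_le (hH.trans hrot) (htra _)
  | type3 =>
    obtain ⟨H, K, Φ, hH, -, -, hK, hG, a, ha⟩ := hi
    have hscrew : ∀ a : {a : ℝ // 0 < a}, Sim.ofLinear a a.2 (Φ a : E ≃ₗᵢ[ℝ] E) 0 ∈ G := fun a =>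
      (hG.2.2 ▸ le_sup_left : K ≤ G) ((hK.2.2 ▸ le_sup_left : screwDilations Φ ≤ K)
        ⟨a, fun x => by simp [Sim.ofLinear_apply]⟩)
    constructor
    · by_contra! hcon
      have h2 := mem_simIsometries.1 (h.forall_eq_zero_iff.1 hcon (hscrew ⟨2, two_pos⟩))
      rw [Sim.ratio_eq (r := 2) fun x => by simp [Sim.ofLinear_apply, norm_smul]] at h2
      norm_num at h2
    -- If `G` contained the pure dilation by `a`, it would contain the rotation `Φ a`. In its
    -- factorization (screw dilation)·(element of `H`)·(translation), the value at `0` kills the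
    -- translation and the ratio kills the screw dilation, so `Φ a` would be in `H`.
    · intro h1
      obtain ⟨f, hf, hfx⟩ := (h.mem_iff_linear IsSkewOp.zero).1 h1 (Real.log a)
      rw [mul_one, Real.exp_log a.2, smul_zero, opExp_zero] at hfx
      have hg := G.mul_mem (hscrew a) (G.inv_mem hf)
      have hgx : ∀ x, (Sim.ofLinear a a.2 (Φ a : E ≃ₗᵢ[ℝ] E) 0 * f⁻¹) x =
          (Φ a : E ≃ₗᵢ[ℝ] E) x := by
        intro x
        have : f⁻¹ x = (a : ℝ)⁻¹ • x := Sim.inv_apply_eq (by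
          rw [← hfx, one_apply_eq_self, smul_smul, mul_inv_cancel₀ a.2.ne', one_smul])
        rw [DilationEquiv.coe_mul, Function.comp_apply, this, Sim.ofLinear_apply, map_smul,
          smul_smul, mul_inv_cancel₀ a.2.ne', one_smul, add_zero]
      set g := Sim.ofLinear a a.2 (Φ a : E ≃ₗᵢ[ℝ] E) 0 * f⁻¹
      obtain ⟨k, hk, n, hn, e⟩ := Subgroup.exists_mul_of_mem_sup
        (fun k hk n hn => hG.1 k (hG.2.2 ▸ Subgroup.mem_sup_left hk) n hn) (hG.2.2.symm ▸ hg)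
      obtain ⟨s, hs, η, hη, rfl⟩ := Subgroup.exists_mul_of_commute hK.1 (hK.2.2.symm ▸ hk)
      obtain ⟨w, -, hn⟩ := hn
      obtain ⟨a', hs⟩ := hs
      obtain ⟨R, hR, hηR⟩ := hH hη
      have he : ∀ x, (Φ a : E ≃ₗᵢ[ℝ] E) x = (Φ a' : E ≃ₗᵢ[ℝ] E) ((a' : ℝ) • R (x + w)) := by
        intro x
        rw [← hgx, e]
        simp [hs, hn, hηR]
      have hw : w = 0 := by
        have h0 := he 0
        rw [map_zero, zero_add] at h0
        have h1 := congrArg norm h0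
        rw [LinearIsometryEquiv.norm_map, norm_smul, LinearIsometryEquiv.norm_map, norm_zero] at h1
        have h2 := (mul_eq_zero.1 h1.symm).resolve_left (norm_ne_zero_iff.2 a'.2.ne')
        exact norm_eq_zero.1 h2
      have ha' : a' = 1 := by
        obtain ⟨y, hy⟩ := exists_ne (0 : E)
        have h1 := congrArg norm (he y)
        rw [hw, add_zero, LinearIsometryEquiv.norm_map, LinearIsometryEquiv.norm_map, norm_smul,
          LinearIsometryEquiv.norm_map, Real.norm_of_nonneg a'.2.le] at h1
        refine Subtype.ext (mul_right_cancel₀ (norm_ne_zero_iff.2 hy) ?_)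
        rw [← h1]
        simp
      refine ha ⟨η, hη, fun x => ?_⟩
      rw [he, hw, ha', map_one, hηR]
      simp
  | type4 =>
    obtain ⟨H, K, U, Ψ, hH, -, -, hK, hG, u, hu⟩ := hi
    constructor
    · rw [h.forall_eq_zero_iff, ← hG.2.2, ← hK.2.2]
      exact sup_le (sup_le (hH.trans hrot) fun f hf =>
        mem_simIsometries.2 (ratio_eq_one_of_screwIsometries hf)) (htra _)
    -- If all translations were in `G`, so would be the rotation `Ψ u`. Its factorization moves the
    -- origin by `w + u'` before rotating, with `w ∈ Uᗮ` and `u' ∈ U`; both vanish, so `Ψ u` would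
    -- be in `H`.
    · intro hN
      have hT : translations ⊤ ≤ G := (h.translation_mem_iff ⊤).1 fun X _ => hN X
      let v : U := Multiplicative.toAdd u
      let R₀ : E ≃ₗᵢ[ℝ] E := (Ψ u : E ≃ₗᵢ[ℝ] E)
      have hscrew : Sim.ofLinear 1 one_pos R₀ (R₀ v) ∈ G :=
        (hG.2.2 ▸ le_sup_left : K ≤ G) ((hK.2.2 ▸ le_sup_right : screwIsometries U Ψ ≤ K)
          ⟨v, fun x => by
            rw [Sim.ofLinear_apply, one_smul, ← map_add]
            rfl⟩)
      have htr : Sim.ofLinear 1 one_pos 1 (-(v : E)) ∈ G :=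
        hT ⟨-(v : E), Submodule.mem_top, fun x => by simp [Sim.ofLinear_apply]⟩
      have hg := G.mul_mem hscrew htr
      have hgx : ∀ x, (Sim.ofLinear 1 one_pos R₀ (R₀ v) * Sim.ofLinear 1 one_pos 1 (-(v : E))) x =
          R₀ x := by
        intro x
        simp [Sim.ofLinear_apply]
      set g := Sim.ofLinear 1 one_pos R₀ (R₀ v) * Sim.ofLinear 1 one_pos 1 (-(v : E))
      obtain ⟨k, hk, n, hn, e⟩ := Subgroup.exists_mul_of_mem_sup
        (fun k hk n hn => hG.1 k (hG.2.2 ▸ Subgroup.mem_sup_left hk) n hn) (hG.2.2.symm ▸ hg)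
      obtain ⟨η, hη, s, hs, rfl⟩ := Subgroup.exists_mul_of_commute hK.1 (hK.2.2.symm ▸ hk)
      obtain ⟨w, hw, hn⟩ := hn
      obtain ⟨u', hs⟩ := hs
      obtain ⟨R, hR, hηR⟩ := hH hη
      have he : ∀ x, R₀ x = R ((Ψ (Multiplicative.ofAdd u') : E ≃ₗᵢ[ℝ] E) (x + w + u')) := by
        intro x
        rw [← hgx, e]
        simp [hs, hn, hηR]
      have hsum : w + (u' : E) = 0 := by
        have h0 := he 0
        rw [map_zero, zero_add] at h0
        have h1 := congrArg norm h0
        rw [LinearIsometryEquiv.norm_map, LinearIsometryEquiv.norm_map, norm_zero] at h1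
        exact norm_eq_zero.1 h1.symm
      have hu' : (u' : E) = 0 := by
        have h1 := hw u' u'.2
        rw [eq_neg_of_add_eq_zero_left hsum, inner_neg_right, neg_eq_zero, inner_self_eq_zero] at h1
        exact h1
      have hw0 : w = 0 := by rwa [hu', add_zero] at hsum
      have hu'' : u' = 0 := Subtype.ext hu'
      refine hu ⟨η, hη, fun x => ?_⟩
      change η x = R₀ x
      rw [he, hw0, hu'', hηR]
      simp

end IsLieAlgebraOf

end SimGroups

/-! ### Construction of the groups from the algebras -/

section Construction

variable {E : Type*} [NormedAddCommGroup E] [InnerProductSpace ℝ E]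

theorem innerₗ_nondegenerate : (innerₗ E : LinearMap.BilinForm ℝ E).Nondegenerate :=
  ⟨fun x h => inner_self_eq_zero (𝕜 := ℝ) |>.1 (h x),
    fun x h => inner_self_eq_zero (𝕜 := ℝ) |>.1 (h x)⟩

theorem conj_translation (g : Sim E) {t : Sim E} {w : E} (ht : ∀ x, t x = x + w) :
    ∃ w', (∀ x, (g * t * g⁻¹) x = x + w') ∧ ∀ x, g (x + w) = g x + w' := by
  obtain ⟨r, -, R, h⟩ := g.exists_linear
  have h2 : ∀ x, g (x + w) = g x + r • R w := by
    intro x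
    rw [h, h x, map_add, smul_add]
    abel
  refine ⟨r • R w, fun x => ?_, h2⟩
  have : g (g⁻¹ x) = x := g.apply_symm_apply x
  simp [ht, h2, this]

/-- The stabilizer of a point in the group of similarities. -/
def Sim.fixing (x : E) : Subgroup (Sim E) where
  carrier := {f | f x = x}
  one_mem' := rfl
  mul_mem' := by
    intro f g (hf : f x = x) (hg : g x = x)
    change f (g x) = x
    rw [hg, hf]
  inv_mem' := fun hf => Sim.inv_apply_eq hf

theorem translation_mem {W : Submodule ℝ E} {w : E} (hw : w ∈ W) :
    Sim.ofLinear 1 one_pos 1 w ∈ translations W :=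
  ⟨w, hw, fun x => by simp [Sim.ofLinear_apply]⟩

theorem affineField_commute {A : E →L[ℝ] E} {w u : E} (h : A u = 0) :
    Commute (affineField A w) (affineField 0 u) := by
  refine sub_eq_zero.1 ?_
  rw [← LieRing.of_associative_ring_bracket, lie_affineField, h]
  refine ContinuousLinearMap.ext fun v => ?_
  simp

variable [FiniteDimensional ℝ E]

theorem exp_neg_apply_exp (A : E →L[ℝ] E) (x : E) : opExp (-A) (opExp A x) = x :=
  haveI := FiniteDimensional.complete ℝ E
  clm_exp_neg_apply A x

/-- The rotation `exp A`. -/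
noncomputable def expRot {A : E →L[ℝ] E} (hA : IsSkewOp A) : E ≃ₗᵢ[ℝ] E where
  toLinearEquiv := LinearEquiv.ofLinearMap (opExp A : E →L[ℝ] E).toLinearMap
    (opExp (-A) : E →L[ℝ] E).toLinearMap
    (by
      ext x
      have := exp_neg_apply_exp (-A) x
      rwa [neg_neg] at this)
    (by
      ext x
      exact exp_neg_apply_exp A x)
  norm_map' := norm_exp_skew hA

theorem expRot_apply {A : E →L[ℝ] E} (hA : IsSkewOp A) (x : E) : expRot hA x = opExp A x := rfl

theorem expRot_mem_rotations {A : E →L[ℝ] E} (hA : IsSkewOp A) {W : Submodule ℝ E}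
    (h : ∀ x ∈ Wᗮ, A x = 0) : expRot hA ∈ rotations W :=
  haveI := FiniteDimensional.complete ℝ E
  ⟨det_exp_eq_one_of_skew innerₗ_nondegenerate (fun v w => hA v w),
    fun x hx => exp_apply_of_apply_eq_zero (h x hx)⟩

theorem expRot_mem_rotations_top {A : E →L[ℝ] E} (hA : IsSkewOp A) :
    expRot hA ∈ rotations (⊤ : Submodule ℝ E) :=
  expRot_mem_rotations hA fun x hx => by
    rw [Submodule.top_orthogonal_eq_bot, Submodule.mem_bot] at hx
    rw [hx, map_zero]

variable {𝔤 : LieSubalgebra ℝ (Mink E →L[ℝ] Mink E)} {G : Subgroup (Sim E)}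

/-- The group generated by the rotations `exp A` with `A ∈ 𝔤`. -/
def rotationGroup (𝔤 : LieSubalgebra ℝ (Mink E →L[ℝ] Mink E)) : Subgroup (Sim E) :=
  Subgroup.closure {f | ∃ A : E →L[ℝ] E, IsSkewOp A ∧ triple 0 A 0 ∈ 𝔤 ∧ ∀ x, f x = opExp A x}

/-- The rotation `exp A` as a similarity. -/
noncomputable def simRot {A : E →L[ℝ] E} (hA : IsSkewOp A) : Sim E :=
  Sim.ofLinear 1 one_pos (expRot hA) 0

theorem simRot_apply {A : E →L[ℝ] E} (hA : IsSkewOp A) (x : E) : simRot hA x = opExp A x := by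
  simp [simRot, Sim.ofLinear_apply, expRot_apply]

theorem simRot_mem {A : E →L[ℝ] E} (hA : IsSkewOp A) (h : triple 0 A 0 ∈ 𝔤) :
    simRot hA ∈ rotationGroup 𝔤 :=
  Subgroup.subset_closure ⟨A, hA, h, simRot_apply hA⟩

theorem rotationGroup_le_linearRotations : rotationGroup 𝔤 ≤ linearRotations E := by
  rw [rotationGroup, Subgroup.closure_le]
  rintro f ⟨A, hA, -, hf⟩
  exact ⟨expRot hA, expRot_mem_rotations_top hA, hf⟩

theorem rotationGroup_apply_zero {f : Sim E} (hf : f ∈ rotationGroup 𝔤) : f 0 = 0 := by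
  obtain ⟨R, -, h⟩ := rotationGroup_le_linearRotations hf
  rw [h, map_zero]

namespace IsLieAlgebraOf

theorem rotationGroup_le (h : IsLieAlgebraOf 𝔤 G) : rotationGroup 𝔤 ≤ G := by
  rw [rotationGroup, Subgroup.closure_le]
  rintro f ⟨A, hA, hT, hf⟩
  obtain ⟨g, hg, e⟩ := (h.mem_iff_linear hA).1 hT 1
  have : f = g := DilationEquiv.ext fun x => by simpa [hf] using e x
  rwa [this]

theorem mem_of_forall_mem_rotationGroup (h : IsLieAlgebraOf 𝔤 G) {A : E →L[ℝ] E}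
    (hA : IsSkewOp A)
    (hH : ∀ t : ℝ, ∃ f ∈ rotationGroup 𝔤, ∀ x, f x = opExp (t • A) x) : triple 0 A 0 ∈ 𝔤 := by
  refine (h.mem_iff_linear hA).2 fun t => ?_
  obtain ⟨f, hf, hfx⟩ := hH t
  exact ⟨f, h.rotationGroup_le hf, fun x => by simp [hfx]⟩

/-- The Lie algebra is that of the linear fields `A` with `(0, A, 0) ∈ 𝔤`. It is not larger:
one-parameter groups in `H` fix the origin and have ratio 1, and lie in `G`, so `mem_iff` returns
their generators to 𝔤. -/
theorem rotationGroup_isConnected [Nontrivial E] (h : IsLieAlgebraOf 𝔤 G) :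
    IsConnectedSimSubgroup (rotationGroup 𝔤) := by
  have := FiniteDimensional.complete ℝ E
  let 𝔥 : LieSubalgebra ℝ ((E × ℝ) →L[ℝ] (E × ℝ)) :=
    { carrier := {T | ∃ A : E →L[ℝ] E, triple 0 A 0 ∈ 𝔤 ∧ T = affineField A 0}
      add_mem' := by
        rintro S T ⟨A, hA, rfl⟩ ⟨B, hB, rfl⟩
        exact ⟨A + B, triple_add_mem hA hB (add_zero 0) rfl (add_zero 0), by
          rw [add_affineField, add_zero]⟩
      zero_mem' := ⟨0, triple_zero_mem, by
        refine ContinuousLinearMap.ext fun v => ?_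
        simp
        rfl⟩
      smul_mem' := by
        rintro t S ⟨A, hA, rfl⟩
        have := triple_smul_mem hA t
        rw [mul_zero, smul_zero] at this
        exact ⟨t • A, this, by rw [smul_affineField, smul_zero]⟩
      lie_mem' := by
        rintro S T ⟨A, hA, rfl⟩ ⟨B, hB, rfl⟩
        have := h.triples.lie_mem hA hB
        refine ⟨⁅A, B⁆, by simpa using this, ?_⟩
        rw [lie_affineField, map_zero, map_zero, sub_zero] }
  have mem𝔥 : ∀ T, T ∈ 𝔥 ↔ ∃ A : E →L[ℝ] E, triple 0 A 0 ∈ 𝔤 ∧ T = affineField A 0 :=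
    fun T => Iff.rfl
  have hexp : ∀ A : E →L[ℝ] E, ∀ x : E, opExp (affineField A 0) (x, 1) = (opExp A x, 1) := by
    intro A x
    have := exp_linear_apply 0 A x
    simpa using this
  refine ⟨𝔥, ⟨Set.ext fun T => ⟨?_, fun hT => ?_⟩, le_antisymm ?_ ?_⟩⟩
  · rintro ⟨A, hA, rfl⟩
    have hsk := h.triples.isSkewOp hA
    refine affineField_mem_lieSet_iff.2 fun t => ⟨simRot (hsk.smul t), simRot_mem _ ?_, fun x => ?_⟩
    · have := triple_smul_mem hA t
      rwa [mul_zero, smul_zero] at this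
    · rw [smul_zero, hexp, simRot_apply]
  · obtain ⟨a, A, X, hA, rfl⟩ := exists_of_mem_lieSet_homogeneous hT
    have hT' := affineField_mem_lieSet_iff.1 hT
    have hX : X = 0 := by
      have h1 : affineField (a • 1 + A) X ((0, 1) : E × ℝ) ∈
          Submodule.span ℝ {((0, 1) : E × ℝ)} := by
        refine apply_mem_of_forall_exp_mem (Submodule.closed_of_finiteDimensional _) fun t => ?_
        obtain ⟨f, hf, e⟩ := hT' t
        rw [smul_affineField, e, rotationGroup_apply_zero hf]
        exact Submodule.mem_span_singleton_self _
      obtain ⟨c, hc⟩ := Submodule.mem_span_singleton.1 h1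
      simpa using (congrArg Prod.fst hc).symm
    have ha : a = 0 := by
      obtain ⟨f, hf, e⟩ := hT' 1
      simp only [one_smul] at e
      have h1 := ratio_eq_one_of_linearRotations (rotationGroup_le_linearRotations hf)
      rwa [ratio_of_exp hA e, Real.exp_eq_one_iff] at h1
    subst hX ha
    refine ⟨A, h.mem_of_forall_mem_rotationGroup hA fun t => ?_, by simp⟩
    obtain ⟨f, hf, e⟩ := hT' t
    refine ⟨f, hf, fun x => ?_⟩
    have := e x
    rw [zero_smul, zero_add, smul_zero, hexp] at this
    exact (congrArg Prod.fst this).symm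
  · rintro M ⟨f, hf, hM⟩
    suffices H : ∃ N ∈ Subgroup.closure {g : ((E × ℝ) →L[ℝ] (E × ℝ))ˣ |
        ∃ X ∈ 𝔥, (g : (E × ℝ) →L[ℝ] (E × ℝ)) = opExp X},
        ∀ x : E, (N : (E × ℝ) →L[ℝ] (E × ℝ)) (x, 1) = (f x, 1) by
      obtain ⟨N, hN, e⟩ := H
      have : M = N := Units.ext (clm_ext_of_affine fun x => by rw [hM, e])
      rw [this]
      exact hN
    clear hM M
    induction hf using Subgroup.closure_induction with
    | mem f hf =>
      obtain ⟨A, hA, hT, hf⟩ := hf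
      refine ⟨(clm_isUnit_exp (affineField A 0)).unit,
        Subgroup.subset_closure ⟨_, ⟨A, hT, rfl⟩, rfl⟩, fun x => ?_⟩
      rw [hf, ← hexp]
      rfl
    | one => exact ⟨1, Subgroup.one_mem _, fun x => rfl⟩
    | mul f g _ _ h1 h2 =>
      obtain ⟨M, hM, e⟩ := h1
      obtain ⟨N, hN, e'⟩ := h2
      exact ⟨M * N, Subgroup.mul_mem _ hM hN, fun x => by simp [e', e]⟩
    | inv f _ h1 =>
      obtain ⟨M, hM, e⟩ := h1
      refine ⟨M⁻¹, Subgroup.inv_mem _ hM, fun x => ?_⟩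
      have h1 := e (f⁻¹ x)
      have h2 : f (f⁻¹ x) = x := f.apply_symm_apply x
      rw [h2] at h1
      rw [← h1, ← mul_apply_eq_comp]
      simp
  · rw [Subgroup.closure_le]
    rintro M ⟨T, ⟨A, hA, rfl⟩, e⟩
    have hsk := h.triples.isSkewOp hA
    refine ⟨simRot hsk, simRot_mem hsk hA, fun x => ?_⟩
    rw [e, simRot_apply]
    exact hexp A x

theorem type2 [Nontrivial E] (h : IsLieAlgebraOf 𝔤 G) (hc : TypeCondition 𝔤 .type2) :
    SimType G .type2 := by
  obtain ⟨h0, hN⟩ := hc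
  refine ⟨rotationGroup 𝔤, rotationGroup_le_linearRotations, h.rotationGroup_isConnected,
    fun g _ t ht => ?_, ?_, le_antisymm ?_ ?_⟩
  · obtain ⟨w, -, ht⟩ := ht
    obtain ⟨w', hw', -⟩ := conj_translation g ht
    exact ⟨w', Submodule.mem_top, hw'⟩
  · rw [eq_bot_iff]
    rintro f ⟨hf, w, -, hw⟩
    have h1 := hw 0
    rw [rotationGroup_apply_zero hf, zero_add] at h1
    exact DilationEquiv.ext fun x => by simp [hw, ← h1]
  · exact sup_le h.rotationGroup_le ((h.translation_mem_iff ⊤).1 fun X _ => hN X)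
  · refine h.le_of_exp_mem _ fun a A X hA hT => ?_
    obtain rfl := h0 _ _ _ hT
    have hA0 : triple 0 A 0 ∈ 𝔤 := triple_sub_mem hT (hN X) (sub_zero 0) (sub_zero _) (sub_self _)
    refine ⟨Sim.ofLinear 1 one_pos 1 (opExp (affineField ((0 : ℝ) • 1 + A) X) (0, 1)).1 * simRot hA,
      Subgroup.mul_mem _ (Subgroup.mem_sup_right (translation_mem Submodule.mem_top))
        (Subgroup.mem_sup_left (simRot_mem hA hA0)), fun x => ?_⟩
    rw [exp_similarity_apply]
    simp [Sim.ofLinear_apply, simRot_apply]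

/-- The structure of `G` if `𝔤` contains all translations and an infinitesimal screw dilation. -/
theorem screwDilation_decomposition [Nontrivial E] (h : IsLieAlgebraOf 𝔤 G)
    (hN : ∀ X, triple 0 0 X ∈ 𝔤) {D : E →L[ℝ] E} (hD : triple 1 D 0 ∈ 𝔤)
    (hcomm : ∀ A, triple 0 A 0 ∈ 𝔤 → Commute D A)
    {Φ : {a : ℝ // 0 < a} →* rotations (⊤ : Submodule ℝ E)}
    (hΦ : ∀ a x, (Φ a : E ≃ₗᵢ[ℝ] E) x = opExp (Real.log a • D) x) :
    IsInternalDirect (screwDilations Φ) (rotationGroup 𝔤) (screwDilations Φ ⊔ rotationGroup 𝔤) ∧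
    IsInternalSemidirect (screwDilations Φ ⊔ rotationGroup 𝔤) (translations ⊤) G := by
  have := FiniteDimensional.complete ℝ E
  have hDs := h.triples.isSkewOp hD
  refine ⟨⟨fun k hk l hl => ?_, ?_, rfl⟩, fun g _ t ht => ?_, ?_, le_antisymm ?_ ?_⟩
  · obtain ⟨a, hk⟩ := hk
    have hle : rotationGroup 𝔤 ≤ Subgroup.centralizer {k} := by
      rw [rotationGroup, Subgroup.closure_le]
      rintro f ⟨A, hA, hT, hf⟩
      refine Subgroup.mem_centralizer_singleton_iff.2 (DilationEquiv.ext fun x => ?_)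
      have h1 : Commute (opExp (Real.log a • D)) (opExp A) :=
        clm_exp_commute ((hcomm A hT).smul_left _)
      have h2 := congrArg (fun T : E →L[ℝ] E => T x) h1.eq
      simp only [mul_apply_eq_comp] at h2
      simp [hf, hk, hΦ, h2]
    exact (Subgroup.mem_centralizer_singleton_iff.1 (hle hl)).symm
  · rw [eq_bot_iff]
    rintro f ⟨⟨a, hf⟩, hH⟩
    have h1 := ratio_eq_one_of_linearRotations (rotationGroup_le_linearRotations hH)
    rw [Sim.ratio_eq (r := a) fun x => by
      rw [hf, hf, smul_zero, map_zero, sub_zero, LinearIsometryEquiv.norm_map, norm_smul,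
        Real.norm_of_nonneg a.2.le]] at h1
    have ha : a = 1 := Subtype.ext h1
    exact DilationEquiv.ext fun x => by simp [hf, ha]
  · obtain ⟨w, -, ht⟩ := ht
    obtain ⟨w', hw', -⟩ := conj_translation g ht
    exact ⟨w', Submodule.mem_top, hw'⟩
  · rw [eq_bot_iff]
    rintro f ⟨hf, w, -, hw⟩
    have hle : screwDilations Φ ⊔ rotationGroup 𝔤 ≤ Sim.fixing (0 : E) := by
      refine sup_le ?_ fun f hf => rotationGroup_apply_zero hf
      rintro f ⟨a, hf⟩
      change f 0 = 0
      rw [hf, smul_zero, map_zero]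
    have h0 : f 0 = 0 := hle hf
    have h1 := hw 0
    rw [h0, zero_add] at h1
    exact DilationEquiv.ext fun x => by simp [hw, ← h1]
  · refine sup_le (sup_le ?_ h.rotationGroup_le) ((h.translation_mem_iff ⊤).1 fun X _ => hN X)
    rintro f ⟨a, hf⟩
    obtain ⟨g, hg, e⟩ := (h.mem_iff_linear hDs).1 hD (Real.log a)
    have : f = g := DilationEquiv.ext fun x => by
      rw [hf, ← e, map_smul, hΦ, mul_one, Real.exp_log a.2]
    rwa [this]
  · refine h.le_of_exp_mem _ fun a A X hA hT => ?_
    -- `(a, A, X)` splits as `a(1, D, 0) + (0, A - aD, 0) + (0, 0, X)`; the first two summands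
    -- commute, so the linear part of the exponential is a screw dilation times a rotation of `H`.
    have hB : triple 0 (A - a • D) 0 ∈ 𝔤 := by
      have h1 := triple_sub_mem hT (triple_smul_mem hD a) rfl rfl rfl
      refine triple_sub_mem h1 (hN X) ?_ ?_ ?_ <;> simp
    have hBs := h.triples.isSkewOp hB
    let s : Sim E := Sim.ofLinear (Real.exp a) (Real.exp_pos a)
      (Φ ⟨Real.exp a, Real.exp_pos a⟩ : E ≃ₗᵢ[ℝ] E) 0
    have hs : s ∈ screwDilations Φ :=
      ⟨⟨Real.exp a, Real.exp_pos a⟩, fun x => by simp [s, Sim.ofLinear_apply]⟩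
    refine ⟨Sim.ofLinear 1 one_pos 1 (opExp (affineField (a • 1 + A) X) (0, 1)).1 *
      (s * simRot hBs), Subgroup.mul_mem _
        (Subgroup.mem_sup_right (translation_mem Submodule.mem_top))
        (Subgroup.mem_sup_left (Subgroup.mul_mem _ (Subgroup.mem_sup_left hs)
          (Subgroup.mem_sup_right (simRot_mem hBs hB)))), fun x => ?_⟩
    have hA' : A = a • D + (A - a • D) := by abel
    have h2 : opExp A = opExp (a • D) * opExp (A - a • D) := by
      conv_lhs => rw [hA']
      exact clm_exp_add ((hcomm _ hB).smul_left a)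
    rw [exp_similarity_apply, h2]
    simp [s, Sim.ofLinear_apply, simRot_apply, hΦ]

theorem type1 [Nontrivial E] (h : IsLieAlgebraOf 𝔤 G) (hN : ∀ X, triple 0 0 X ∈ 𝔤)
    (h1 : triple 1 0 0 ∈ 𝔤) : SimType G .type1 := by
  obtain ⟨h2, h3⟩ := h.screwDilation_decomposition hN h1 (fun A _ => Commute.zero_left A) (Φ := 1)
    (fun a x => by simp)
  exact ⟨rotationGroup 𝔤, _, rotationGroup_le_linearRotations, h.rotationGroup_isConnected, h2, h3⟩

theorem type3 [Nontrivial E] (h : IsLieAlgebraOf 𝔤 G) (hN : ∀ X, triple 0 0 X ∈ 𝔤)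
    (h1 : triple 1 0 0 ∉ 𝔤) {D : E →L[ℝ] E} (hD : triple 1 D 0 ∈ 𝔤)
    (hcomm : ∀ A, triple 0 A 0 ∈ 𝔤 → Commute D A) : SimType G .type3 := by
  have := FiniteDimensional.complete ℝ E
  have hDs := h.triples.isSkewOp hD
  let Φ : {a : ℝ // 0 < a} →* rotations (⊤ : Submodule ℝ E) :=
    MonoidHom.mk' (fun a => ⟨expRot (hDs.smul (Real.log a)), expRot_mem_rotations_top _⟩) (by
      intro a b
      refine Subtype.ext (LinearIsometryEquiv.ext fun x => ?_)
      change opExp (Real.log (a * b) • D) x = opExp (Real.log a • D) (opExp (Real.log b • D) x)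
      rw [Real.log_mul a.2.ne' b.2.ne', add_smul,
        clm_exp_add (((Commute.refl D).smul_left _).smul_right _), mul_apply_eq_comp])
  have hΦ : ∀ a x, (Φ a : E ≃ₗᵢ[ℝ] E) x = opExp (Real.log a • D) x := fun a x => rfl
  obtain ⟨h2, h3⟩ := h.screwDilation_decomposition hN hD hcomm hΦ
  refine ⟨rotationGroup 𝔤, _, Φ, rotationGroup_le_linearRotations, h.rotationGroup_isConnected,
    fun x => ?_, h2, h3, ?_⟩
  · simp only [hΦ]
    have hlog : Continuous fun a : {a : ℝ // 0 < a} => Real.log a :=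
      Continuous.log continuous_subtype_val fun a => a.2.ne'
    exact (clm_exp_continuous.comp (hlog.smul continuous_const)).clm_apply continuous_const
  -- If all `Φ a` were in `H`, the one-parameter group of `D` would be too, so `(0, D, 0) ∈ 𝔤` and
  -- by subtraction `(1, 0, 0) ∈ 𝔤`.
  · by_contra! hcon
    refine h1 (triple_sub_mem hD (h.mem_of_forall_mem_rotationGroup hDs fun t => ?_)
      (sub_zero 1) (sub_self D) (sub_zero 0))
    obtain ⟨f, hf, e⟩ := hcon ⟨Real.exp t, Real.exp_pos t⟩
    exact ⟨f, hf, fun x => by rw [e, hΦ, Real.log_exp]⟩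

/-- `σ` is a linear choice of skew part for each translation along `U`, and `Ψ u = exp (σ u)`. All
skew parts kill `U` and commute with `σ u`, so rotations, screw motions and translations of `Uᗮ`
separate. -/
theorem type4 [Nontrivial E] (h : IsLieAlgebraOf 𝔤 G) {U : Submodule ℝ E}
    (h0 : ∀ a A X, triple a A X ∈ 𝔤 → a = 0) (hN : ¬ ∀ X, triple 0 0 X ∈ 𝔤)
    (hW : ∀ X ∈ Uᗮ, triple 0 0 X ∈ 𝔤) (hU : ∀ a A X, triple a A X ∈ 𝔤 → ∀ u ∈ U, A u = 0)
    (σ : U →ₗ[ℝ] E →L[ℝ] E) (hσ : ∀ u : U, triple 0 (σ u) (u : E) ∈ 𝔤)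
    (hcomm : ∀ (u : U) a A X, triple a A X ∈ 𝔤 → Commute (σ u) A) : SimType G .type4 := by
  have := FiniteDimensional.complete ℝ E
  have hσs : ∀ u, IsSkewOp (σ u) := fun u => h.triples.isSkewOp (hσ u)
  have hσ0 : ∀ (u : U), ∀ x ∈ Uᗮᗮ, σ u x = 0 := fun u x hx =>
    hU _ _ _ (hσ u) x (by rwa [Submodule.orthogonal_orthogonal] at hx)
  have hfix : ∀ A : E →L[ℝ] E, (∀ u ∈ U, A u = 0) → ∀ u ∈ U, opExp A u = u :=
    fun A hA u hu => exp_apply_of_apply_eq_zero (hA u hu)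
  let Ψ : Multiplicative U →* rotations Uᗮ :=
    MonoidHom.mk' (fun u => ⟨expRot (hσs (Multiplicative.toAdd u)), expRot_mem_rotations _ (hσ0 _)⟩)
      (by
        intro u v
        refine Subtype.ext (LinearIsometryEquiv.ext fun x => ?_)
        change opExp (σ (Multiplicative.toAdd u + Multiplicative.toAdd v)) x =
          opExp (σ (Multiplicative.toAdd u)) (opExp (σ (Multiplicative.toAdd v)) x)
        rw [map_add, clm_exp_add (hcomm _ _ _ _ (hσ _)), mul_apply_eq_comp])
  have hΨ : ∀ u x, (Ψ u : E ≃ₗᵢ[ℝ] E) x = opExp (σ (Multiplicative.toAdd u)) x := fun u x => rfl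
  have hscrew : ∀ f ∈ screwIsometries U Ψ, ∃ u : U, ∀ x, f x = opExp (σ u) x + u := by
    rintro f ⟨u, hf⟩
    refine ⟨u, fun x => ?_⟩
    rw [hf, hΨ, toAdd_ofAdd, map_add, hfix _ (hU _ _ _ (hσ u)) u u.2]
  have hrotU : ∀ f ∈ rotationGroup 𝔤, ∀ u ∈ U, f u = u := by
    intro f hf u hu
    have hle : rotationGroup 𝔤 ≤ Sim.fixing u := by
      rw [rotationGroup, Subgroup.closure_le]
      rintro f ⟨A, hA, hT, hf⟩
      change f u = u
      rw [hf, hfix A (hU _ _ _ hT) u hu]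
    exact hle hf
  have hdirect : ∀ k ∈ rotationGroup 𝔤, ∀ l ∈ screwIsometries U Ψ, k * l = l * k := by
    intro k hk l hl
    obtain ⟨u, hl⟩ := hscrew l hl
    have hle : rotationGroup 𝔤 ≤ Subgroup.centralizer {l} := by
      rw [rotationGroup, Subgroup.closure_le]
      rintro f ⟨A, hA, hT, hf⟩
      refine Subgroup.mem_centralizer_singleton_iff.2 (DilationEquiv.ext fun x => ?_)
      have h2 := congrArg (fun T : E →L[ℝ] E => T x) (clm_exp_commute (hcomm u _ _ _ hT)).eq
      simp only [mul_apply_eq_comp] at h2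
      simp [hf, hl, hfix A (hU _ _ _ hT) u u.2, h2]
    exact Subgroup.mem_centralizer_singleton_iff.1 (hle hk)
  -- The one-parameter groups of `𝔤`, split along `E = U ⊕ Uᗮ`.
  have hexp : ∀ a A X, IsSkewOp A → triple a A X ∈ 𝔤 → ∃ u : U, ∃ v ∈ Uᗮ,
      triple 0 (A - σ u) 0 ∈ 𝔤 ∧
      ∀ x, opExp (affineField (a • 1 + A) X) (x, 1) = (opExp A x + u + v, 1) := by
    intro a A X hA hT
    obtain rfl := h0 _ _ _ hT
    obtain ⟨u, hu, w, hw, rfl⟩ := U.exists_add_mem_mem_orthogonal X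
    have hAu := hU _ _ _ hT
    refine ⟨⟨u, hu⟩, (opExp (affineField A w) (0, 1)).1, ?_, ?_, fun x => ?_⟩
    · have hle : ∀ v ∈ Uᗮ.comap (LinearMap.fst ℝ E ℝ),
          affineField A w v ∈ Uᗮ.comap (LinearMap.fst ℝ E ℝ) := by
        intro v hv
        rw [Submodule.mem_comap] at hv ⊢
        simp only [affineField_apply, LinearMap.fst_apply] at hv ⊢
        exact Uᗮ.add_mem (hA.mem_orthogonal (fun y hy => by rw [hAu y hy]; exact U.zero_mem) hv)
          (Uᗮ.smul_mem _ hw)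
      exact exp_mem_of_invariant (Submodule.closed_of_finiteDimensional _) hle
        (v := ((0, 1) : E × ℝ)) (by simp)
    · have h1 := triple_sub_mem hT (hσ ⟨u, hu⟩) (sub_zero 0) rfl rfl
      refine triple_sub_mem h1 (hW w hw) (sub_zero 0) (sub_zero _) ?_
      simp
    -- Because `A u = 0`, the translation by `u` commutes with the field `(A, w)` and splits off
    -- from the exponential.
    · have hsum : affineField ((0 : ℝ) • 1 + A) (u + w) = affineField A w + affineField 0 u := by
        rw [add_affineField, zero_smul, zero_add, add_zero, add_comm u]
      have hc : Commute (affineField A w) (affineField 0 u) :=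
        affineField_commute (hAu u hu)
      rw [hsum, clm_exp_add hc, mul_apply_eq_comp, exp_translationField, exp_affineField_apply,
        map_add, hfix A hAu u hu]
  have hG : G ≤ (rotationGroup 𝔤 ⊔ screwIsometries U Ψ) ⊔ translations Uᗮ := by
    refine h.le_of_exp_mem _ fun a A X hA hT => ?_
    obtain ⟨u, v, hv, hB, e⟩ := hexp a A X hA hT
    have hBs := h.triples.isSkewOp hB
    let s : Sim E := Sim.ofLinear 1 one_pos (expRot (hσs u)) (expRot (hσs u) u)
    have hs : s ∈ screwIsometries U Ψ := ⟨u, fun x => by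
      rw [Sim.ofLinear_apply, one_smul, ← map_add]
      rfl⟩
    refine ⟨Sim.ofLinear 1 one_pos 1 v * (simRot hBs * s), Subgroup.mul_mem _
      (Subgroup.mem_sup_right (translation_mem hv))
      (Subgroup.mem_sup_left (Subgroup.mul_mem _ (Subgroup.mem_sup_left (simRot_mem hBs hB))
        (Subgroup.mem_sup_right hs))), fun x => ?_⟩
    have h2 : opExp A = opExp (A - σ u) * opExp (σ u) := by
      rw [← clm_exp_add (hcomm u _ _ _ hB).symm, sub_add_cancel]
    have h3 := hfix _ (hU _ _ _ (hσ u)) u u.2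
    have h4 := hfix _ (hU _ _ _ hB) u u.2
    rw [e, h2]
    simp [s, Sim.ofLinear_apply, simRot_apply, expRot_apply, h3, h4]
  refine ⟨rotationGroup 𝔤, _, U, Ψ, rotationGroup_le_linearRotations, h.rotationGroup_isConnected,
    fun x => ?_, ⟨hdirect, ?_, rfl⟩, ⟨fun g hg t ht => ?_, ?_, le_antisymm ?_ hG⟩, ?_⟩
  · exact (clm_exp_continuous.comp σ.continuous_of_finiteDimensional).clm_apply continuous_const
  · rw [eq_bot_iff]
    rintro f ⟨hH, hf⟩
    obtain ⟨u, hf⟩ := hscrew f hf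
    have h1 := hf 0
    rw [rotationGroup_apply_zero hH, map_zero, zero_add] at h1
    have hu : u = 0 := Subtype.ext h1.symm
    exact DilationEquiv.ext fun x => by simp [hf, hu]
  · obtain ⟨w, hw, ht⟩ := ht
    obtain ⟨w', hw', hgw⟩ := conj_translation g ht
    refine ⟨w', ?_, hw'⟩
    -- `Q` consists of the similarities that displace all points by the same amount along `U`. Hence
    -- `g` maps differences in `Uᗮ` to differences in `Uᗮ`, which makes the translations of `Uᗮ`
    -- normal in `G`.
    let Q : Subgroup (Sim E) :=
      { carrier := {g | ∃ u : E, ∀ x, g x - x - u ∈ Uᗮ}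
        one_mem' := ⟨0, fun x => by simp⟩
        mul_mem' := by
          rintro g k ⟨u, hu⟩ ⟨v, hv⟩
          refine ⟨u + v, fun x => ?_⟩
          have := Uᗮ.add_mem (hu (k x)) (hv x)
          convert this using 1
          rw [DilationEquiv.coe_mul, Function.comp_apply]
          abel
        inv_mem' := by
          rintro g ⟨u, hu⟩
          refine ⟨-u, fun x => ?_⟩
          have := Uᗮ.neg_mem (hu (g⁻¹ x))
          have e : g (g⁻¹ x) = x := g.apply_symm_apply x
          rw [e] at this
          convert this using 1
          abel }
    have hQ : G ≤ Q := by
      refine h.le_of_exp_mem _ fun a A X hA hT => ?_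
      obtain ⟨u, v, hv, -, e⟩ := hexp a A X hA hT
      refine ⟨Sim.ofLinear 1 one_pos (expRot hA) (u + v), ⟨u, fun x => ?_⟩, fun x => ?_⟩
      · have h1 : opExp A x - x ∈ Uᗮ := by
          intro u' hu'
          have h2 := (expRot hA).inner_map_map u' x
          rw [expRot_apply, expRot_apply, hfix A (hU _ _ _ hT) u' hu'] at h2
          rw [inner_sub_right, h2, sub_self]
        have := Uᗮ.add_mem h1 hv
        convert this using 1
        rw [Sim.ofLinear_apply, one_smul, expRot_apply]
        abel
      · rw [e, Sim.ofLinear_apply, one_smul, expRot_apply, add_assoc]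
    obtain ⟨u, hu⟩ := hQ hg
    have h1 := Uᗮ.sub_mem (hu (0 + w)) (hu 0)
    rw [hgw] at h1
    have h2 := Uᗮ.add_mem h1 hw
    convert h2 using 1
    abel
  · rw [eq_bot_iff]
    rintro f ⟨hf, w, hw, hfw⟩
    obtain ⟨k, hk, s, hs, rfl⟩ := Subgroup.exists_mul_of_commute hdirect hf
    obtain ⟨u, hs⟩ := hscrew s hs
    have h1 := hfw 0
    rw [DilationEquiv.coe_mul, Function.comp_apply, hs, map_zero, zero_add, zero_add,
      hrotU k hk u u.2] at h1
    have hw0 : w = 0 := by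
      have h2 := hw u u.2
      rw [h1] at h2
      exact inner_self_eq_zero (𝕜 := ℝ) |>.1 h2
    exact DilationEquiv.ext fun x => by rw [hfw, hw0, add_zero]; rfl
  · refine sup_le (sup_le h.rotationGroup_le ?_) ((h.translation_mem_iff Uᗮ).1 hW)
    intro f hf
    obtain ⟨u, hf⟩ := hscrew f hf
    obtain ⟨g, hg, e⟩ := (h.mem_iff _ _ _ (hσs u)).1 (hσ u) 1
    have : f = g := DilationEquiv.ext fun x => by
      have hc : Commute (affineField (σ u) 0) (affineField 0 (u : E)) :=
        affineField_commute (hU _ _ _ (hσ u) u u.2)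
      have hsum : affineField (σ u) (u : E) = affineField (σ u) 0 + affineField 0 (u : E) := by
        rw [add_affineField, zero_add, add_zero]
      have h1 := e x
      have h2 := exp_linear_apply 0 (σ u) (x + u)
      rw [zero_smul, zero_add, Real.exp_zero, one_smul] at h2
      rw [one_smul, one_smul, zero_smul, zero_add, hsum, clm_exp_add hc, mul_apply_eq_comp,
        exp_translationField, h2, map_add, hfix _ (hU _ _ _ (hσ u)) u u.2] at h1
      rw [hf]
      exact congrArg Prod.fst h1
    rwa [this]
  -- If all `Ψ u` were in `H`, then `(0, σ u, 0) ∈ 𝔤`, hence `(0, 0, u) ∈ 𝔤`, and together with `Uᗮ`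
  -- all translations would lie in 𝔤.
  · by_contra! hcon
    refine hN fun X => ?_
    obtain ⟨u, hu, w, hw, rfl⟩ := U.exists_add_mem_mem_orthogonal X
    let u' : U := ⟨u, hu⟩
    have hσu : triple 0 (σ u') 0 ∈ 𝔤 := by
      refine h.mem_of_forall_mem_rotationGroup (hσs u') fun t => ?_
      obtain ⟨f, hf, e⟩ := hcon (Multiplicative.ofAdd (t • u'))
      exact ⟨f, hf, fun x => by rw [e, hΨ, toAdd_ofAdd, map_smul]⟩
    have := triple_sub_mem (hσ u') hσu (sub_zero 0) (sub_self _) (sub_zero u)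
    exact triple_add_mem this (hW w hw) (add_zero 0) (add_zero 0) rfl

theorem simType_of_algType [Nontrivial E] (h : IsLieAlgebraOf 𝔤 G) {i : FourTypes}
    (hi : AlgType 𝔤 i) : SimType G i := by
  have hc := hi.typeCondition
  have zero_lie_commute : ∀ A B : E →L[ℝ] E, ⁅A, B⁆ = 0 → Commute B A := fun A B e => by
    rw [LieRing.of_associative_ring_bracket, sub_eq_zero] at e
    exact e.symm
  cases i with
  | type1 =>
    obtain ⟨ℬ, -, hm⟩ := hi
    exact h.type1 (fun X => (hm _).2 ⟨0, 0, X, rfl⟩) hc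
  | type2 => exact h.type2 hc
  | type3 =>
    obtain ⟨ℬ, φ, -, hφ, hm⟩ := hi
    -- A central element with `φ Z₁ = 1` generates the screw dilations.
    obtain ⟨Z₁, hZ₁⟩ := LinearMap.surjective hφ 1
    have hN : ∀ X, triple 0 0 X ∈ 𝔤 := fun X => (hm _).2 ⟨0, 0, X, by
      rw [triple_add, triple_add]
      simp⟩
    refine h.type3 hN hc.2 (D := ((Z₁ : ℬ) : E →L[ℝ] E)) ((hm _).2 ⟨0, Z₁, 0, ?_⟩) fun A hA => ?_
    · rw [triple_add, triple_add, hZ₁]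
      simp
    · obtain ⟨C, Y, X, e⟩ := (hm _).1 hA
      rw [triple_add, triple_add] at e
      refine zero_lie_commute _ _ (mem_center_iff.1 Z₁.2 A ?_)
      rw [(triple_injective e).2.1]
      exact ℬ.add_mem (ℬ.add_mem (C : ℬ).2 (Y : ℬ).2) ℬ.zero_mem
  | type4 =>
    obtain ⟨U, ℬ, ψ, -, -, hℬ, hψ, hm⟩ := hi
    -- A linear section of `ψ` selects the rotation accompanying each translation along `U`.
    obtain ⟨s, hs⟩ := ψ.exists_rightInverse_of_surjective (LinearMap.range_eq_top.2 hψ)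
    have hs' : ∀ u, ψ (s u) = u := fun u => LinearMap.congr_fun hs u
    have hmem : ∀ a A X, triple a A X ∈ 𝔤 → A ∈ ℬ := by
      intro a A X hT
      obtain ⟨C, Y, X, e⟩ := (hm _).1 hT
      rw [triple_add, triple_add] at e
      rw [(triple_injective e).2.1]
      exact ℬ.add_mem (ℬ.add_mem (C : ℬ).2 (Y : ℬ).2) ℬ.zero_mem
    refine h.type4 (U := U) hc.1 hc.2 (fun X hX => (hm _).2 ⟨0, 0, ⟨X, hX⟩, ?_⟩)
      (fun a A X hT u hu => (hℬ A (hmem _ _ _ hT)).2 u (Submodule.le_orthogonal_orthogonal U hu))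
      (ℬ.toSubmodule.subtype ∘ₗ (LieAlgebra.center ℝ ℬ).toSubmodule.subtype ∘ₗ s)
      (fun u => (hm _).2 ⟨0, s u, 0, ?_⟩)
      (fun u a A X hT => zero_lie_commute _ _ (mem_center_iff.1 (s u).2 A (hmem _ _ _ hT)))
    · rw [triple_add, triple_add]
      simp
    · rw [triple_add, triple_add, hs']
      simp

end IsLieAlgebraOf

end Construction

/-! ### Assembly of the correspondence and the classification. -/

theorem theorem5 {E : Type*} [NormedAddCommGroup E] [InnerProductSpace ℝ E]
    [FiniteDimensional ℝ E] [Nontrivial E] (G : Subgroup (Sim E))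
    (hG : IsConnectedSimSubgroup G) :
    ∃ 𝔤 : LieSubalgebra ℝ (Mink E →L[ℝ] Mink E),
      IsConnectedLieSubgroupWith (lorentzGroup G) 𝔤 ∧
      IsSubalgebraOfSOP 𝔤 ∧
      (∀ f ∈ G, ∃! M, M ∈ lorentzGroup G ∧ Induces M f) ∧
      (ActsTransitively G ↔ IsWeaklyIrreducibleAlg 𝔤 ∧ ¬ IsIrreducibleAlg 𝔤) ∧
      (ActsTransitively G →
        (∃! i : FourTypes, SimType G i) ∧ ∀ i : FourTypes, SimType G i ↔ AlgType 𝔤 i) := by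
  obtain ⟨𝔥, h⟩ := hG
  have hΓ := lorentzGroup_isConnected h
  have hsub := lorentzAlgebra_isSubalgebraOfSOP h.lie_eq
  have hex : ∀ f ∈ G, ∃! M, M ∈ lorentzGroup G ∧ Induces M f :=
    fun f hf => existsUnique_induces h hf
  have hlie := lorentzAlgebra_isLieAlgebraOf h
  have hwi : ActsTransitively G → IsWeaklyIrreducibleAlg (lorentzAlgebra h.lie_eq) :=
    fun htr => htr.isWeaklyIrreducibleAlg hΓ hsub hex
  refine ⟨lorentzAlgebra h.lie_eq, hΓ, hsub, hex,
    ⟨fun htr => ⟨hwi htr, not_isIrreducibleAlg hsub⟩, fun hw => ?_⟩, fun htr => ?_⟩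
  -- Transitivity is not derived directly from weak irreducibility: the algebra has some type, `G`
  -- then has the same type, and groups of every type are transitive.
  · obtain ⟨i, hi⟩ := exists_algType hw.1 hlie.triples
    exact (hlie.simType_of_algType hi).actsTransitively
  · obtain ⟨i, hi⟩ := exists_algType (hwi htr) hlie.triples
    have huniq : ∀ j, SimType G j → j = i := fun j hj =>
      (hlie.typeCondition_of_simType hj).unique hi.typeCondition
    refine ⟨⟨i, hlie.simType_of_algType hi, huniq⟩,
      fun j => ⟨fun hj => ?_, hlie.simType_of_algType⟩⟩
    rwa [huniq j hj]
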